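/- Everything is smooth ($C^\infty$) and real; $M$ is a finite-dimensional Hausdorff, $\sigma$-compact manifold without boundary. **Setting.** Let $(A\to M,\rho,[\cdot,\cdot])$ be a Lie algebroid. The bundles $TM\oplus A^*$ and $A\oplus T^*M$ are paired by $\langle (X,\alpha),(a,\theta)\rangle=\alpha(a)+\theta(X)$, and $(\rho,\rho^t)\colon A\oplus T^*M\to TM\oplus A^*$ is $(a,\theta)\mapsto(\rho(a),\rho^t\theta)$. For $a\in\Gamma(A)$ put $\mathcal L_a(X,\alpha)=([\rho(a),X],\mathcal L_a\alpha)$ with $\langle\mathcal L_a\alpha,b\rangle=\rho(a)\langle\alpha,b\rangle-\langle\alpha,[a,b]\rangle$, and $\mathcal L_a(b,\theta)=([a,b],\mathcal L_{\rho(a)}\theta)$. For $\tau_i=(a_i,\theta_i)\in\Gamma(A\oplus T^*M)$ put $$[\tau_1,\tau_2]_d=\bigl([a_1,a_2],\ \mathcal L_{\rho(a_1)}\theta_2-\mathbf i_{\rho(a_2)}\mathbf d\theta_1\bigr).$$ The double vector bundle $TA\oplus T^*A$ has sides $A$ and $TM\oplus A^*$ and core $A\oplus T^*M$. Over $A$ it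 carries the standard Courant algebroid structure of the manifold $A$; over $TM\oplus A^*$ it carries the Lie algebroid structure induced by that of $A$. An *LA-Dirac structure* $(\mathsf D_A,U,A,M)$ over $A$ is a Dirac structure $\mathsf D_A\subseteq TA\oplus T^*A\to A$ that is also a subalgebroid of $TA\oplus T^*A\to TM\oplus A^*$ over a subbundle $U\subseteq TM\oplus A^*$. Let $U^\circ\subseteq A\oplus T^*M$ be the annihilator of $U$. A *Dorfman connection* $\Delta\colon\Gamma(TM\oplus A^*)\times\Gamma(A\oplus T^*M)\to\Gamma(A\oplus T^*M)$ is an $\mathbb R$-bilinear map such that, for $q=(X,\alpha)$, $\tau\in\Gamma(A\oplus T^*M)$ and $f\in C^\infty(M)$, $$\Delta_q(f\tau)=f\Delta_q\tau+X(f)\tau,\qquad \Delta_{fq}\tau=f\Delta_q\tau+\langle q,\tau\rangle(0,\mathbf df),\qquad \Delta_q(0,\mathbf df)=(0,\mathbf d(X(f))).$$ Its dual dull bracket $\llbracket\cdot,\cdot\rrbracket_\Delta$ on $\Gamma(TM\oplus A^*)$ is given by $\langle\llbracket q_1,q_2\rrbracket_\Delta,\tau\rangle=X_1\langle q_2,\tau\rangle-\langle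 q_2,\Delta_{q_1}\tau\rangle$, where $q_1=(X_1,\alpha_1)$. With $\Omega_{(X,\alpha)}a=\Delta_{(X,\alpha)}(a,0)-(0,\mathbf d\langle\alpha,a\rangle)$, its basic connection is $$\nabla^{\rm bas}_aq=(\rho,\rho^t)(\Omega_qa)+\mathcal L_aq\qquad(a\in\Gamma(A),\ q\in\Gamma(TM\oplus A^*)),$$ and $\nabla^{\rm bas}_\tau=\nabla^{\rm bas}_a$ for $\tau=(a,\theta)$. The connection $\Delta$ is *adapted* to $\mathsf D_A$ if the vector bundle $\mathsf D_A\to A$ is spanned by the core sections $k^\uparrow$, where $k$ runs through the sections of the core of $\mathsf D_A$ (which equals $U^\circ$), and by the sections $\sigma^\Delta(u)$, $u\in\Gamma(U)$; here $(b,\theta)^\uparrow=(b^\uparrow,q_A^*\theta)$ with $b^\uparrow$ the vertical lift of $b$ and $q_A\colon A\to M$ the projection, $\ell_\alpha$ is the fibrewise linear function of $\alpha$, and for $x\in M$, $a\in\Gamma(A)$, $$\sigma^\Delta(X,\alpha)(a(x))=\bigl(T_xa\,X(x),\ \mathbf d_{a(x)}\ell_\alpha\bigr)-\bigl(\Delta_{(X,\alpha)}(a,0)\bigr)^\uparrow(a(x)).$$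 **Theorem.** Let $(\mathsf D_A,U,A,M)$ be an LA-Dirac structure over the Lie algebroid $A$, and let $\Delta$ be a Dorfman connection adapted to $\mathsf D_A$. Then $$C=\frac{U\oplus A\oplus T^*M}{\operatorname{graph}\bigl(-(\rho,\rho^t)|_{U^\circ}\colon U^\circ\to U\bigr)}$$ is a vector bundle over $M$. Write $u\oplus\tau$ for the class of $(u,\tau)$. The following are well defined and make $C$ a Courant algebroid: the anchor $$c(u\oplus\tau)=\operatorname{pr}_{TM}u+\rho(\operatorname{pr}_A\tau),$$ the pairing $$\langle\langle u_1\oplus\tau_1,u_2\oplus\tau_2\rangle\rangle_C=\langle u_1,\tau_2\rangle+\langle u_2,\tau_1\rangle+\langle\tau_1,(\rho,\rho^t)\tau_2\rangle,$$ and the bracket on $\Gamma(C)$ $$\llbracket u_1\oplus\tau_1,u_2\oplus\tau_2\rrbracket=\bigl(\llbracket u_1,u_2\rrbracket_\Delta+\nabla^{\rm bas}_{\tau_1}u_2-\nabla^{\rm bas}_{\tau_2}u_1\bigr)\oplus\bigl([\tau_1,\tau_2]_d+\Delta_{u_1}\tau_2-\Delta_{u_2}\tau_1+(0,\mathbf d\langle\tau_1,u_2\rangle)\bigr),$$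 whose first component is a section of $U$. Explicitly: the pairing is symmetric and fibrewise nondegenerate, the bracket is $\mathbb R$-bilinear, and for all $c_1,c_2,c_3\in\Gamma(C)$ 1. $\llbracket c_1,\llbracket c_2,c_3\rrbracket\rrbracket=\llbracket\llbracket c_1,c_2\rrbracket,c_3\rrbracket+\llbracket c_2,\llbracket c_1,c_3\rrbracket\rrbracket$, 2. $c(c_1)\langle\langle c_2,c_3\rangle\rangle_C=\langle\langle\llbracket c_1,c_2\rrbracket,c_3\rangle\rangle_C+\langle\langle c_2,\llbracket c_1,c_3\rrbracket\rangle\rangle_C$, 3. $\llbracket c_1,c_2\rrbracket+\llbracket c_2,c_1\rrbracket=\mathcal D\langle\langle c_1,c_2\rangle\rangle_C$, where $\mathcal D\colon C^\infty(M)\to\Gamma(C)$ is defined by $\langle\langle\mathcal Df,c_1\rangle\rangle_C=c(c_1)f$. One has $\mathcal Df=0\oplus(0,\mathbf df)$. The bracket does not depend on the choice of $\Delta$: every Dorfman connection adapted to $\mathsf D_A$ gives the same bracket on $\Gamma(C)$. -/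

import Mathlib

open Bundle Filter Module
open scoped Manifold ContDiff Topology

set_option linter.unusedSectionVars false

noncomputable section

namespace LADirac

section Sections

variable {E : Type*} [NormedAddCommGroup E] [NormedSpace ℝ E]
  {H : Type*} [TopologicalSpace H] {I : ModelWithCorners ℝ E H}
  {M : Type*} [TopologicalSpace M] [ChartedSpace H M]
  {F : Type*} [NormedAddCommGroup F] [NormedSpace ℝ F]
  {V : M → Type*} [TopologicalSpace (TotalSpace F V)] [∀ x, AddCommGroup (V x)]
  [∀ x, Module ℝ (V x)] [∀ x, TopologicalSpace (V x)] [FiberBundle F V] [VectorBundle ℝ F V]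

instance : SMul C^∞⟮I, M; ℝ⟯ Cₛ^∞⟮I; F, V⟯ :=
  ⟨fun f s => ⟨fun x => f x • s x, f.contMDiff.smul_section s.contMDiff⟩⟩

theorem smul_sec_apply (f : C^∞⟮I, M; ℝ⟯) (s : Cₛ^∞⟮I; F, V⟯) (x : M) :
    (f • s) x = f x • s x := rfl

instance : Module C^∞⟮I, M; ℝ⟯ Cₛ^∞⟮I; F, V⟯ where
  one_smul s := by ext x; simp [smul_sec_apply]
  mul_smul f g s := by ext x; simp [smul_sec_apply, mul_smul]
  smul_zero f := by ext x; simp [smul_sec_apply]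
  smul_add f s t := by ext x; simp [smul_sec_apply]
  add_smul f g s := by ext x; simp [smul_sec_apply, add_smul]
  zero_smul s := by ext x; simp [smul_sec_apply]

theorem sum_sec_apply {ι : Type*} (A : Finset ι) (s : ι → Cₛ^∞⟮I; F, V⟯) (x : M) :
    (∑ i ∈ A, s i) x = ∑ i ∈ A, s i x := by
  induction A using Finset.cons_induction with
  | empty => simp
  | cons a A ha ih => simp [Finset.sum_cons, ih]

theorem sum_fun_apply {ι : Type*} (A : Finset ι) (f : ι → C^∞⟮I, M; ℝ⟯) (x : M) :
    (∑ i ∈ A, f i) x = ∑ i ∈ A, f i x := by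
  induction A using Finset.cons_induction with
  | empty => simp
  | cons a A ha ih => simp [Finset.sum_cons, ih]

/-- Pointwise evaluation of a section of the dual bundle on a section. -/
def ev (α : Cₛ^∞⟮I; F →L[ℝ] ℝ, fun x => V x →L[ℝ] ℝ⟯) (s : Cₛ^∞⟮I; F, V⟯) : C^∞⟮I, M; ℝ⟯ :=
  ⟨fun x => α x (s x), by
    have h : ContMDiff I (I.prod 𝓘(ℝ, ℝ)) ∞
        (fun x => TotalSpace.mk' ℝ (E := Bundle.Trivial M ℝ) x (α x (s x))) :=
      ContMDiff.clm_bundle_apply (F₁ := F) (F₂ := ℝ) (E₁ := V) (E₂ := Bundle.Trivial M ℝ)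
        (IB := I) (b := id) α.contMDiff s.contMDiff
    intro x
    have h' := h x
    simp only [contMDiffAt_totalSpace] at h'
    exact h'.2⟩

theorem ev_add (α : Cₛ^∞⟮I; F →L[ℝ] ℝ, fun x => V x →L[ℝ] ℝ⟯) (s t : Cₛ^∞⟮I; F, V⟯) :
    ev α (s + t) = ev α s + ev α t := by ext x; exact map_add (α x) (s x) (t x)

theorem ev_smul (α : Cₛ^∞⟮I; F →L[ℝ] ℝ, fun x => V x →L[ℝ] ℝ⟯) (f : C^∞⟮I, M; ℝ⟯)
    (s : Cₛ^∞⟮I; F, V⟯) : ev α (f • s) = f * ev α s := by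
  ext x; exact map_smul (α x) (f x) (s x)

/-- A continuous linear bundle map (a section of the bundle `Hom(V, W)`) applied to a section. -/
def app {F' : Type*} [NormedAddCommGroup F'] [NormedSpace ℝ F']
    {W : M → Type*} [TopologicalSpace (TotalSpace F' W)] [∀ x, AddCommGroup (W x)]
    [∀ x, Module ℝ (W x)] [∀ x, TopologicalSpace (W x)] [FiberBundle F' W] [VectorBundle ℝ F' W]
    [∀ x, IsTopologicalAddGroup (W x)] [∀ x, ContinuousSMul ℝ (W x)]
    (T : Cₛ^∞⟮I; F →L[ℝ] F', fun x => V x →L[ℝ] W x⟯) (s : Cₛ^∞⟮I; F, V⟯) : Cₛ^∞⟮I; F', W⟯ :=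
  ⟨fun x => T x (s x), T.contMDiff.clm_bundle_apply s.contMDiff⟩

theorem exists_section_germ [FiniteDimensional ℝ E] [IsManifold I ∞ M] [T2Space M]
    {x₀ : M} {u : Set M} (hu : u ∈ 𝓝 x₀) (s : ∀ x, V x)
    (hs : ContMDiffOn I (I.prod 𝓘(ℝ, F)) ∞ (fun x => TotalSpace.mk' F x (s x)) u) :
    ∃ t : Cₛ^∞⟮I; F, V⟯, ∀ᶠ x in 𝓝 x₀, t x = s x := by
  obtain ⟨w, hwu, hwo, hxw⟩ := mem_nhds_iff.1 hu
  obtain ⟨f, -, hf⟩ := (SmoothBumpFunction.nhds_basis_tsupport (I := I) x₀).mem_iff.1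
    (hwo.mem_nhds hxw)
  refine ⟨⟨_, ContMDiffOn.smul_section_of_tsupport (ψ := f) f.contMDiff.contMDiffOn hwo hf
    (hs.mono hwu)⟩, ?_⟩
  filter_upwards [f.eventuallyEq_one] with x hx
  change f x • s x = s x
  rw [hx]; simp

theorem exists_function_germ [FiniteDimensional ℝ E] [IsManifold I ∞ M] [T2Space M]
    {x₀ : M} {u : Set M} (hu : u ∈ 𝓝 x₀) (g : M → ℝ) (hg : ContMDiffOn I 𝓘(ℝ, ℝ) ∞ g u) :
    ∃ f : C^∞⟮I, M; ℝ⟯, ∀ᶠ x in 𝓝 x₀, f x = g x := by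
  obtain ⟨w, hwu, hwo, hxw⟩ := mem_nhds_iff.1 hu
  obtain ⟨f, -, hf⟩ := (SmoothBumpFunction.nhds_basis_tsupport (I := I) x₀).mem_iff.1
    (hwo.mem_nhds hxw)
  refine ⟨⟨fun x => f x * g x, contMDiff_of_tsupport fun x hx => ?_⟩, ?_⟩
  · have hxw' : x ∈ w := hf (closure_mono (Function.support_mul_subset_left f g) hx)
    exact f.contMDiff.contMDiffAt.mul ((hg.mono hwu).contMDiffAt (hwo.mem_nhds hxw'))
  · filter_upwards [f.eventuallyEq_one] with x hx
    change f x * g x = g x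
    rw [hx]; simp

variable [FiniteDimensional ℝ E] [IsManifold I ∞ M] [T2Space M]

theorem apply_congr_germ
    {Q W : Type*} [AddCommGroup Q] [Module C^∞⟮I, M; ℝ⟯ Q] [AddCommGroup W] [Module ℝ W]
    (φ : Cₛ^∞⟮I; F, V⟯ →ₗ[C^∞⟮I, M; ℝ⟯] Q) (x₀ : M) (r : Q →+ W)
    (hr : ∀ (f : C^∞⟮I, M; ℝ⟯) q, r (f • q) = f x₀ • r q)
    (s t : Cₛ^∞⟮I; F, V⟯) (h : ∀ᶠ x in 𝓝 x₀, s x = t x) : r (φ s) = r (φ t) := by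
  obtain ⟨w, hw, hwo, hxw⟩ := eventually_nhds_iff.1 h
  obtain ⟨f, -, hf⟩ := (SmoothBumpFunction.nhds_basis_tsupport (I := I) x₀).mem_iff.1
    (hwo.mem_nhds hxw)
  let g : C^∞⟮I, M; ℝ⟯ := ⟨f, f.contMDiff⟩
  have h1 : g • s = g • t := by
    ext x
    by_cases hx : x ∈ w
    · simp [smul_sec_apply, hw x hx]
    · have : g x = 0 := image_eq_zero_of_notMem_tsupport fun h' => hx (hf h')
      simp [smul_sec_apply, this]
  have h2 : g x₀ = 1 := f.eq_one
  have h3 := congrArg (fun k => r (φ k)) h1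
  simpa [map_smul, hr, h2] using h3

variable [ContMDiffVectorBundle ∞ F V I]

theorem exists_section_eq (I : ModelWithCorners ℝ E H) [IsManifold I ∞ M]
    [ContMDiffVectorBundle ∞ F V I] {x : M} (v : V x) : ∃ s : Cₛ^∞⟮I; F, V⟯, s x = v := by
  obtain ⟨u, hu, hs⟩ := FiberBundle.exists_contMDiffOn_extend (k := ∞) I F v
  obtain ⟨t, ht⟩ := exists_section_germ hu _ hs
  exact ⟨t, by simpa using ht.self_of_nhds⟩


/-- Around every point there are global smooth sections that form a frame nearby, together with the
(linear) coefficient functions of sections in this frame. -/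
theorem exists_frame_germ [FiniteDimensional ℝ F] (I : ModelWithCorners ℝ E H) [IsManifold I ∞ M]
    [ContMDiffVectorBundle ∞ F V I] (x₀ : M) :
    ∃ e : Fin (finrank ℝ F) → Cₛ^∞⟮I; F, V⟯,
      (∀ᶠ x in 𝓝 x₀, ∀ i, trivializationAt F V x₀ ⟨x, e i x⟩ = (x, Module.finBasis ℝ F i)) ∧
      ∀ s : Cₛ^∞⟮I; F, V⟯, ∃ f : Fin (finrank ℝ F) → C^∞⟮I, M; ℝ⟯,
        (∀ᶠ x in 𝓝 x₀, s x = ∑ i, f i x • e i x) ∧ (s x₀ = 0 → ∀ i, f i x₀ = 0) := by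
  let t := trivializationAt F V x₀
  let b := Module.finBasis ℝ F
  have hxt : x₀ ∈ t.baseSet := FiberBundle.mem_baseSet_trivializationAt F V x₀
  have h1 : ContMDiffVectorBundle 1 F V I := ContMDiffVectorBundle.of_le (n := ∞) (by simp)
  have (i : Fin (finrank ℝ F)) := exists_section_germ (I := I)
    (t.open_baseSet.mem_nhds hxt) (t.localFrame b i)
    (t.contMDiffOn_localFrame_baseSet (I := I) ∞ b i)
  choose e he using this
  refine ⟨e, ?_, fun s => ?_⟩
  · filter_upwards [eventually_all.2 he, t.open_baseSet.mem_nhds hxt] with x hx hxb i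
    rw [hx i, t.localFrame_apply_of_mem_baseSet b hxb]
    simp [Trivialization.basisAt, t.apply_mk_symm hxb, b, t]
  · have (i : Fin (finrank ℝ F)) := exists_function_germ (I := I) (t.open_baseSet.mem_nhds hxt) _
      (contMDiffOn_baseSet_localFrameCoeff (I := I) (k := ∞) b s.contMDiff.contMDiffOn i)
    choose f hf using this
    refine ⟨f, ?_, fun h0 i => ?_⟩
    · filter_upwards [eventually_all.2 he, eventually_all.2 hf,
        t.eventually_eq_localFrame_sum_coeff_smul (I := I) b hxt (s := s)] with x hx hfx hs
      rw [hs]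
      exact Finset.sum_congr rfl fun i _ => by rw [hx i, hfx i]; rfl
    · rw [(hf i).self_of_nhds]
      change t.localFrameCoeff I b i x₀ (s x₀) = 0
      rw [h0, map_zero]

/-- A `C^∞(M)`-linear map on sections is tensorial. -/
theorem apply_congr_point [FiniteDimensional ℝ F]
    {Q W : Type*} [AddCommGroup Q] [Module C^∞⟮I, M; ℝ⟯ Q] [AddCommGroup W] [Module ℝ W]
    (φ : Cₛ^∞⟮I; F, V⟯ →ₗ[C^∞⟮I, M; ℝ⟯] Q) (x : M) (r : Q →+ W)
    (hr : ∀ (f : C^∞⟮I, M; ℝ⟯) q, r (f • q) = f x • r q)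
    (s t : Cₛ^∞⟮I; F, V⟯) (h : s x = t x) : r (φ s) = r (φ t) := by
  obtain ⟨e, -, he⟩ := exists_frame_germ (V := V) (F := F) I x
  obtain ⟨f, hf, hf0⟩ := he (s - t)
  have h0 := hf0 (by simp [h])
  have h1 : r (φ (s - t)) = r (φ (∑ i, f i • e i)) := by
    apply apply_congr_germ φ x r hr
    filter_upwards [hf] with y hy
    rw [hy]
    simp [sum_sec_apply, smul_sec_apply]
  have h2 : r (φ (∑ i, f i • e i)) = 0 := by
    simp [map_sum, hr, h0]
  rw [h2, map_sub, map_sub] at h1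
  exact sub_eq_zero.1 h1

/-- Evaluation of smooth functions at a point. -/
def evalAt (I : ModelWithCorners ℝ E H) (x : M) : C^∞⟮I, M; ℝ⟯ →+ ℝ where
  toFun f := f x
  map_zero' := rfl
  map_add' _ _ := rfl

theorem exists_dualSection [FiniteDimensional ℝ F]
    (φ : Cₛ^∞⟮I; F, V⟯ →ₗ[C^∞⟮I, M; ℝ⟯] C^∞⟮I, M; ℝ⟯) :
    ∃ α : Cₛ^∞⟮I; F →L[ℝ] ℝ, fun x => V x →L[ℝ] ℝ⟯, ∀ s x, α x (s x) = φ s x := by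
  have hlin (x : M) : ∃ l : V x →L[ℝ] ℝ, ∀ s : Cₛ^∞⟮I; F, V⟯, l (s x) = φ s x := by
    have : T2Space (V x) := FiberBundle.t2Space F V x
    have : FiniteDimensional ℝ (V x) := VectorBundle.finiteDimensional ℝ F V x
    have : IsTopologicalAddGroup (V x) :=
      (VectorBundle.continuousLinearEquivAt ℝ F V x).toContinuousAddEquiv.isTopologicalAddGroup
    have : ContinuousSMul ℝ (V x) :=
      (VectorBundle.continuousLinearEquivAt ℝ F V x).continuousSMul
    choose ext hext using fun v : V x => exists_section_eq (F := F) I v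
    refine ⟨LinearMap.toContinuousLinearMap
      { toFun := fun v => φ (ext v) x
        map_add' := fun v w => ?_
        map_smul' := fun c v => ?_ }, fun s => ?_⟩
    · have := apply_congr_point φ x (evalAt I x) (fun _ _ => rfl) (ext (v + w)) (ext v + ext w)
        (by simp [hext])
      rw [map_add] at this
      exact this
    · have := apply_congr_point φ x (evalAt I x) (fun _ _ => rfl) (ext (c • v))
        ((algebraMap ℝ C^∞⟮I, M; ℝ⟯ c) • ext v) (by simp only [hext, smul_sec_apply]; rfl)
      rw [map_smul] at this
      exact this
    · exact apply_congr_point φ x (evalAt I x) (fun _ _ => rfl) _ _ (hext _)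
  choose l hl using hlin
  refine ⟨⟨l, fun x₀ => ?_⟩, fun s x => hl x s⟩
  rw [contMDiffAt_hom_bundle]
  refine ⟨contMDiffAt_id, ?_⟩
  obtain ⟨e, he, -⟩ := exists_frame_germ (V := V) (F := F) I x₀
  let t := trivializationAt F V x₀
  let b := Module.finBasis ℝ F
  have h1 : ContMDiffAt I 𝓘(ℝ, F →L[ℝ] ℝ) ∞
      (fun x => ∑ i, φ (e i) x • LinearMap.toContinuousLinearMap (b.coord i)) x₀ :=
    contMDiffAt_finsetSum fun i _ => (φ (e i)).contMDiff.contMDiffAt.smul contMDiffAt_const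
  refine h1.congr_of_eventuallyEq ?_
  filter_upwards [he, t.open_baseSet.mem_nhds (FiberBundle.mem_baseSet_trivializationAt F V x₀)]
    with x hx hxb
  have hsymm (i) : t.symm x (b i) = e i x := by
    have h2 : t ⟨x, e i x⟩ = (x, b i) := hx i
    have h3 := t.symm_apply_apply_mk hxb (e i x)
    rw [h2] at h3
    exact h3
  refine ContinuousLinearMap.coe_injective (b.ext fun i => ?_)
  have h4 : t.symmL ℝ x (b i) = e i x := by
    rw [t.symmL_apply hxb]; exact hsymm i
  have h5 : (∑ j, φ (e j) x • LinearMap.toContinuousLinearMap (b.coord j)) (b i) = φ (e i) x := by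
    rw [sum_apply, Finset.sum_eq_single i] <;> simp +contextual
  refine Eq.trans ?_ h5.symm
  change (trivializationAt ℝ (Bundle.Trivial M ℝ) x₀).continuousLinearMapAt ℝ x
    (l x (t.symmL ℝ x (b i))) = _
  rw [h4, hl]
  simp

/-- The smooth section of the dual bundle `V*` given by a `C^∞(M)`-linear functional on `Γ(V)`. -/
def dualSection [FiniteDimensional ℝ F]
    (φ : Cₛ^∞⟮I; F, V⟯ →ₗ[C^∞⟮I, M; ℝ⟯] C^∞⟮I, M; ℝ⟯) :
    Cₛ^∞⟮I; F →L[ℝ] ℝ, fun x => V x →L[ℝ] ℝ⟯ :=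
  (exists_dualSection φ).choose

theorem dualSection_apply [FiniteDimensional ℝ F]
    (φ : Cₛ^∞⟮I; F, V⟯ →ₗ[C^∞⟮I, M; ℝ⟯] C^∞⟮I, M; ℝ⟯) (s : Cₛ^∞⟮I; F, V⟯) (x : M) :
    dualSection φ x (s x) = φ s x :=
  (exists_dualSection φ).choose_spec s x

end Sections

theorem minSmooth_le : minSmoothness ℝ 2 ≤ ((⊤ : ℕ∞) : WithTop ℕ∞) := by
  rw [minSmoothness_of_isRCLikeNormedField]
  exact WithTop.coe_le_coe.2 le_top

section VectorFields

variable {E : Type*} [NormedAddCommGroup E] [NormedSpace ℝ E]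
  {H : Type*} [TopologicalSpace H] {I : ModelWithCorners ℝ E H}
  {M : Type*} [TopologicalSpace M] [ChartedSpace H M] [IsManifold I ∞ M]

/-- The derivative `X f` of a smooth function along a smooth vector field. -/
def lieD (X : Cₛ^∞⟮I; E, (TangentSpace I : M → Type _)⟯) (f : C^∞⟮I, M; ℝ⟯) : C^∞⟮I, M; ℝ⟯ :=
  ⟨fun x => mfderiv I 𝓘(ℝ, ℝ) f x (X x), by
    have h := (contMDiff_snd_tangentBundle_modelSpace ℝ 𝓘(ℝ, ℝ) (n := ∞)).comp
      ((f.contMDiff.contMDiff_tangentMap (m := ∞) (by simp)).comp X.contMDiff)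
    exact h⟩

/-- The Lie bracket of smooth vector fields. -/
def vbracket [FiniteDimensional ℝ E] (X Y : Cₛ^∞⟮I; E, (TangentSpace I : M → Type _)⟯) :
    Cₛ^∞⟮I; E, (TangentSpace I : M → Type _)⟯ :=
  ⟨VectorField.mlieBracket I X Y, by
    have : CompleteSpace E := FiniteDimensional.complete ℝ E
    have : IsManifold I (((⊤ : ℕ∞) : WithTop ℕ∞) + 1) M := by simpa using ‹IsManifold I ∞ M›
    have : IsManifold I (minSmoothness ℝ 2) M := IsManifold.of_le (n := ∞) minSmooth_le
    exact ContDiff.mlieBracket_vectorField (m := ⊤) (n := ⊤) X.contMDiff Y.contMDiff (by simp)⟩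


theorem lieD_mul (X : Cₛ^∞⟮I; E, (TangentSpace I : M → Type _)⟯) (f g : C^∞⟮I, M; ℝ⟯) :
    lieD X (f * g) = f * lieD X g + lieD X f * g := by
  ext x
  have hf := f.contMDiff.mdifferentiable (by simp) x
  have hg := g.contMDiff.mdifferentiable (by simp) x
  change mfderiv I 𝓘(ℝ, ℝ) (⇑f * ⇑g) x (X x) = _
  rw [(hf.hasMFDerivAt.mul hg.hasMFDerivAt).mfderiv]
  change f x • _ + g x • _ = f x * _ + _ * g x
  rw [mul_comm _ (g x)]
  rfl

theorem lieD_add (X : Cₛ^∞⟮I; E, (TangentSpace I : M → Type _)⟯) (f g : C^∞⟮I, M; ℝ⟯) :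
    lieD X (f + g) = lieD X f + lieD X g := by
  ext x
  have hf := f.contMDiff.mdifferentiable (by simp) x
  have hg := g.contMDiff.mdifferentiable (by simp) x
  change mfderiv I 𝓘(ℝ, ℝ) (⇑f + ⇑g) x (X x) = _
  rw [mfderiv_add hf hg]
  rfl

theorem vbracket_add_right [FiniteDimensional ℝ E]
    (X Y Z : Cₛ^∞⟮I; E, (TangentSpace I : M → Type _)⟯) :
    vbracket X (Y + Z) = vbracket X Y + vbracket X Z := by
  ext x
  have : CompleteSpace E := FiniteDimensional.complete ℝ E
  have : IsManifold I (minSmoothness ℝ 2) M := IsManifold.of_le (n := ∞) minSmooth_le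
  exact VectorField.mlieBracket_add_right ((Y.contMDiff x).mdifferentiableAt (by simp))
    ((Z.contMDiff x).mdifferentiableAt (by simp))

theorem vbracket_smul_right [FiniteDimensional ℝ E]
    (X Y : Cₛ^∞⟮I; E, (TangentSpace I : M → Type _)⟯) (f : C^∞⟮I, M; ℝ⟯) :
    vbracket X (f • Y) = f • vbracket X Y + lieD X f • Y := by
  ext x
  have : CompleteSpace E := FiniteDimensional.complete ℝ E
  have : IsManifold I (minSmoothness ℝ 2) M := IsManifold.of_le (n := ∞) minSmooth_le
  have := VectorField.mlieBracket_smul_right (I := I) (V := X) (W := Y) (f := f) (x := x)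
    (f.contMDiff.mdifferentiable (by simp) x) ((Y.contMDiff x).mdifferentiableAt (by simp))
  refine Eq.trans this ?_
  rw [add_comm]
  rfl

variable [FiniteDimensional ℝ E] [T2Space M]

/-- The differential `d f` as a smooth `1`-form. -/
def dOne (f : C^∞⟮I, M; ℝ⟯) : Cₛ^∞⟮I; E →L[ℝ] ℝ, fun x : M => TangentSpace I x →L[ℝ] ℝ⟯ :=
  dualSection
    { toFun := fun X => lieD X f
      map_add' := fun X Y => by ext x; exact map_add (mfderiv I 𝓘(ℝ, ℝ) f x) (X x) (Y x)
      map_smul' := fun g X => by ext x; exact map_smul (mfderiv I 𝓘(ℝ, ℝ) f x) (g x) (X x) }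

section Dual

variable {F : Type*} [NormedAddCommGroup F] [NormedSpace ℝ F] [FiniteDimensional ℝ F]
  {V : M → Type*} [TopologicalSpace (TotalSpace F V)] [∀ x, AddCommGroup (V x)]
  [∀ x, Module ℝ (V x)] [∀ x, TopologicalSpace (V x)] [FiberBundle F V] [VectorBundle ℝ F V]
  [ContMDiffVectorBundle ∞ F V I]

/-- The derivation of `Γ(V*)` dual to a derivation `D` of `Γ(V)` over the vector field `X`:
`⟨D* α, s⟩ = X ⟨α, s⟩ - ⟨α, D s⟩`. -/
def dualDer (X : Cₛ^∞⟮I; E, (TangentSpace I : M → Type _)⟯) (D : Cₛ^∞⟮I; F, V⟯ → Cₛ^∞⟮I; F, V⟯)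
    (hadd : ∀ s t, D (s + t) = D s + D t)
    (hsmul : ∀ (f : C^∞⟮I, M; ℝ⟯) s, D (f • s) = f • D s + lieD X f • s)
    (α : Cₛ^∞⟮I; F →L[ℝ] ℝ, fun x => V x →L[ℝ] ℝ⟯) :
    Cₛ^∞⟮I; F →L[ℝ] ℝ, fun x => V x →L[ℝ] ℝ⟯ :=
  dualSection
    { toFun := fun s => lieD X (ev α s) - ev α (D s)
      map_add' := fun s t => by rw [hadd, ev_add, ev_add, lieD_add]; ring
      map_smul' := fun f s => by
        rw [hsmul, ev_add, ev_smul, ev_smul, ev_smul, lieD_mul, RingHom.id_apply, smul_eq_mul]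
        ring }

end Dual

/-- The Lie derivative `L_X θ` of a `1`-form. -/
def lieForm (X : Cₛ^∞⟮I; E, (TangentSpace I : M → Type _)⟯)
    (θ : Cₛ^∞⟮I; E →L[ℝ] ℝ, fun x : M => TangentSpace I x →L[ℝ] ℝ⟯) :
    Cₛ^∞⟮I; E →L[ℝ] ℝ, fun x : M => TangentSpace I x →L[ℝ] ℝ⟯ :=
  dualDer X (vbracket X) (vbracket_add_right X) (fun f Y => vbracket_smul_right X Y f) θ

end VectorFields

theorem t2Space_totalSpace {B F : Type*} [TopologicalSpace B] [T2Space B]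
    [TopologicalSpace F] [T2Space F]
    {V : B → Type*} [TopologicalSpace (TotalSpace F V)] [∀ x, TopologicalSpace (V x)]
    [FiberBundle F V] : T2Space (TotalSpace F V) := by
  refine ⟨fun p q hpq => ?_⟩
  by_cases h : p.1 = q.1
  · let t := trivializationAt F V p.1
    have hp : p ∈ t.source := FiberBundle.mem_trivializationAt_proj_source
    have hq : q ∈ t.source := by rw [t.mem_source] at hp ⊢; rw [← h]; exact hp
    obtain ⟨u, v, hu, hv, hpu, hqv, huv⟩ := t2_separation (t.toOpenPartialHomeomorph.injOn.ne hp hq hpq)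
    refine ⟨t.source ∩ t ⁻¹' u, t.source ∩ t ⁻¹' v,
      t.toOpenPartialHomeomorph.isOpen_inter_preimage hu,
      t.toOpenPartialHomeomorph.isOpen_inter_preimage hv, ⟨hp, hpu⟩, ⟨hq, hqv⟩, ?_⟩
    exact (huv.preimage t).mono Set.inter_subset_right Set.inter_subset_right
  · obtain ⟨u, v, hu, hv, hpu, hqv, huv⟩ := t2_separation h
    have hc := FiberBundle.continuous_proj F V
    exact ⟨_, _, hu.preimage hc, hv.preimage hc, hpu, hqv, huv.preimage _⟩

section Bundles

variable {E : Type*} [NormedAddCommGroup E] [NormedSpace ℝ E]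
  {H : Type*} [TopologicalSpace H] (I : ModelWithCorners ℝ E H)
  (M : Type*) [TopologicalSpace M] [ChartedSpace H M] [IsManifold I ∞ M]

/-- Smooth vector fields. -/
abbrev VF := Cₛ^∞⟮I; E, (TangentSpace I : M → Type _)⟯

/-- Smooth `1`-forms. -/
abbrev Form := Cₛ^∞⟮I; E →L[ℝ] ℝ, fun x : M => TangentSpace I x →L[ℝ] ℝ⟯

variable {M}
variable (F : Type*) [NormedAddCommGroup F] [NormedSpace ℝ F]
  (A : M → Type*) [TopologicalSpace (TotalSpace F A)] [∀ x, AddCommGroup (A x)]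
  [∀ x, Module ℝ (A x)] [∀ x, TopologicalSpace (A x)] [FiberBundle F A] [VectorBundle ℝ F A]

/-- Smooth sections of `A*`. -/
abbrev DualSec := Cₛ^∞⟮I; F →L[ℝ] ℝ, fun x => A x →L[ℝ] ℝ⟯

/-- `Γ(TM ⊕ A*) = 𝔛(M) × Γ(A*)`. -/
abbrev SecB := VF I M × DualSec I F A

/-- `Γ(A ⊕ T*M) = Γ(A) × Ω¹(M)`. -/
abbrev SecC := Cₛ^∞⟮I; F, A⟯ × Form I M

/-- The fibre of `TM ⊕ A*`. -/
abbrev FibB (x : M) := TangentSpace I x × (A x →L[ℝ] ℝ)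

/-- The fibre of `A ⊕ T*M`. -/
abbrev FibC (x : M) := A x × (TangentSpace I x →L[ℝ] ℝ)

variable {I F A}

/-- The value at `x` of a pair of sections. -/
def val {F₁ F₂ : Type*} [NormedAddCommGroup F₁] [NormedSpace ℝ F₁] [NormedAddCommGroup F₂]
    [NormedSpace ℝ F₂] {V₁ V₂ : M → Type*}
    [TopologicalSpace (TotalSpace F₁ V₁)] [∀ x, TopologicalSpace (V₁ x)] [FiberBundle F₁ V₁]
    [TopologicalSpace (TotalSpace F₂ V₂)] [∀ x, TopologicalSpace (V₂ x)] [FiberBundle F₂ V₂]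
    (q : Cₛ^∞⟮I; F₁, V₁⟯ × Cₛ^∞⟮I; F₂, V₂⟯) (x : M) : V₁ x × V₂ x := (q.1 x, q.2 x)

/-- The canonical pairing `⟨(X, α), (a, θ)⟩ = α(a) + θ(X)` of the fibres over `x`. -/
def pairFib (x : M) (q : FibB I A x) (τ : FibC I A x) : ℝ := q.2 τ.1 + τ.2 q.1

/-- The canonical pairing `⟨(X, α), (a, θ)⟩ = α(a) + θ(X)` of `TM ⊕ A*` with `A ⊕ T*M`. -/
def pairBC (q : SecB I F A) (τ : SecC I F A) : C^∞⟮I, M; ℝ⟯ := ev q.2 τ.1 + ev τ.2 q.1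

/-- A smooth vector subbundle of the Whitney sum of two vector bundles: a family of subspaces
which near every point is framed by finitely many smooth sections. -/
def IsSubbundle {F₁ F₂ : Type*} [NormedAddCommGroup F₁] [NormedSpace ℝ F₁] [NormedAddCommGroup F₂]
    [NormedSpace ℝ F₂] {V₁ V₂ : M → Type*}
    [TopologicalSpace (TotalSpace F₁ V₁)] [∀ x, AddCommGroup (V₁ x)] [∀ x, Module ℝ (V₁ x)]
    [∀ x, TopologicalSpace (V₁ x)] [FiberBundle F₁ V₁]
    [TopologicalSpace (TotalSpace F₂ V₂)] [∀ x, AddCommGroup (V₂ x)] [∀ x, Module ℝ (V₂ x)]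
    [∀ x, TopologicalSpace (V₂ x)] [FiberBundle F₂ V₂]
    (I : ModelWithCorners ℝ E H) (W : ∀ x, Submodule ℝ (V₁ x × V₂ x)) : Prop :=
  ∀ x₀ : M, ∃ (r : ℕ) (e : Fin r → Cₛ^∞⟮I; F₁, V₁⟯ × Cₛ^∞⟮I; F₂, V₂⟯), ∀ᶠ x in 𝓝 x₀,
    LinearIndependent ℝ (fun i => val (e i) x) ∧
      Submodule.span ℝ (Set.range fun i => val (e i) x) = W x

/-- The smooth sections of `TM ⊕ A*` with values in the family of subspaces `U`. -/
def secU (U : ∀ x : M, Submodule ℝ (FibB I A x)) : Submodule ℝ (SecB I F A) where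
  carrier := {q | ∀ x, val q x ∈ U x}
  add_mem' h₁ h₂ x := (U x).add_mem (h₁ x) (h₂ x)
  zero_mem' x := (U x).zero_mem
  smul_mem' c _ h x := (U x).smul_mem c (h x)

end Bundles

section Dirac

variable {E : Type*} [NormedAddCommGroup E] [NormedSpace ℝ E] [FiniteDimensional ℝ E]
  {H : Type*} [TopologicalSpace H] {I : ModelWithCorners ℝ E H}
  {M : Type*} [TopologicalSpace M] [ChartedSpace H M] [IsManifold I ∞ M] [T2Space M]

theorem vbracket_jacobi (X Y Z : Cₛ^∞⟮I; E, (TangentSpace I : M → Type _)⟯) :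
    vbracket X (vbracket Y Z) = vbracket (vbracket X Y) Z + vbracket Y (vbracket X Z) := by
  ext x
  have : CompleteSpace E := FiniteDimensional.complete ℝ E
  have : IsManifold I (minSmoothness ℝ 3) M := IsManifold.of_le (n := ∞) (by
    rw [minSmoothness_of_isRCLikeNormedField]
    exact WithTop.coe_le_coe.2 le_top)
  exact VectorField.leibniz_identity_mlieBracket_apply
    ((X.contMDiff x).of_le minSmooth_le) ((Y.contMDiff x).of_le minSmooth_le)
    ((Z.contMDiff x).of_le minSmooth_le)

theorem lieD_vbracket (X Y : Cₛ^∞⟮I; E, (TangentSpace I : M → Type _)⟯) (f : C^∞⟮I, M; ℝ⟯) :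
    lieD (vbracket X Y) f = lieD X (lieD Y f) - lieD Y (lieD X f) := by
  have key (Z) := vbracket_jacobi X Y (f • Z)
  simp only [vbracket_smul_right, vbracket_add_right] at key
  ext x
  by_cases hE : ∃ v : TangentSpace I x, v ≠ 0
  · obtain ⟨v, hv⟩ := hE
    obtain ⟨Z, hZ⟩ := exists_section_eq (F := E) I v
    have h1 := key Z
    rw [vbracket_jacobi X Y Z, smul_add] at h1
    have h2 : (lieD (vbracket X Y) f - (lieD X (lieD Y f) - lieD Y (lieD X f))) • Z = 0 := by
      rw [← sub_eq_zero] at h1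
      rw [← neg_eq_zero, ← h1]
      module
    have h3 := congrArg (fun s => s x) h2
    simp only [smul_sec_apply, hZ] at h3
    exact sub_eq_zero.1 ((smul_eq_zero.1 h3).resolve_right hv)
  · push Not at hE
    have h0 (X : Cₛ^∞⟮I; E, (TangentSpace I : M → Type _)⟯) (f : C^∞⟮I, M; ℝ⟯) :
        lieD X f x = 0 :=
      (congrArg (mfderiv I 𝓘(ℝ, ℝ) f x) (hE (X x))).trans (map_zero _)
    exact (h0 _ _).trans (by
      change _ = lieD X _ x - lieD Y _ x
      rw [h0, h0, sub_zero])

theorem form_ext {F : Type*} [NormedAddCommGroup F] [NormedSpace ℝ F]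
    {V : M → Type*} [TopologicalSpace (TotalSpace F V)] [∀ x, AddCommGroup (V x)]
    [∀ x, Module ℝ (V x)] [∀ x, TopologicalSpace (V x)] [FiberBundle F V] [VectorBundle ℝ F V]
    [ContMDiffVectorBundle ∞ F V I] {θ η : Cₛ^∞⟮I; F →L[ℝ] ℝ, fun x : M => V x →L[ℝ] ℝ⟯}
    (h : ∀ Y, ev θ Y = ev η Y) : θ = η := by
  ext x v
  obtain ⟨Y, rfl⟩ := exists_section_eq (F := F) I v
  exact congrArg (fun g => g x) (h Y)

theorem ev_dualSection {F : Type*} [NormedAddCommGroup F] [NormedSpace ℝ F] [FiniteDimensional ℝ F]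
    {V : M → Type*} [TopologicalSpace (TotalSpace F V)] [∀ x, AddCommGroup (V x)]
    [∀ x, Module ℝ (V x)] [∀ x, TopologicalSpace (V x)] [FiberBundle F V] [VectorBundle ℝ F V]
    [ContMDiffVectorBundle ∞ F V I]
    (φ : Cₛ^∞⟮I; F, V⟯ →ₗ[C^∞⟮I, M; ℝ⟯] C^∞⟮I, M; ℝ⟯) (s : Cₛ^∞⟮I; F, V⟯) :
    ev (dualSection φ) s = φ s := by
  ext x; exact dualSection_apply φ s x

theorem ev_lieForm (X : VF I M) (θ : Form I M) (Y : VF I M) :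
    ev (lieForm X θ) Y = lieD X (ev θ Y) - ev θ (vbracket X Y) := ev_dualSection _ _

theorem ev_dOne (f : C^∞⟮I, M; ℝ⟯) (Y : VF I M) : ev (dOne f) Y = lieD Y f := ev_dualSection _ _

theorem lieForm_dOne (X : VF I M) (f : C^∞⟮I, M; ℝ⟯) :
    lieForm X (dOne f) = dOne (lieD X f) :=
  form_ext fun Y => by rw [ev_lieForm, ev_dOne, ev_dOne, ev_dOne, lieD_vbracket]; abel

theorem lieForm_add (X : VF I M) (θ η : Form I M) :
    lieForm X (θ + η) = lieForm X θ + lieForm X η :=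
  form_ext fun Y => by
    have h (θ η : Form I M) Z : ev (θ + η) Z = ev θ Z + ev η Z := rfl
    simp only [h, ev_lieForm, lieD_add]; abel

theorem lieForm_smul (X : VF I M) (f : C^∞⟮I, M; ℝ⟯) (θ : Form I M) :
    lieForm X (f • θ) = f • lieForm X θ + lieD X f • θ :=
  form_ext fun Y => by
    have h (θ η : Form I M) Z : ev (θ + η) Z = ev θ Z + ev η Z := rfl
    have h' (f : C^∞⟮I, M; ℝ⟯) (θ : Form I M) Z : ev (f • θ) Z = f * ev θ Z := rfl
    simp only [h, h', ev_lieForm, lieD_mul]; ring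

/-- Every covector is the differential of a smooth function. -/
theorem exists_dOne_eq (θ : Form I M) (x : M) : ∃ f : C^∞⟮I, M; ℝ⟯, dOne f x = θ x := by
  let φ : TangentSpace I x →L[ℝ] E := mfderiv I 𝓘(ℝ, E) (extChartAt I x) x
  obtain ⟨e, he⟩ : φ.IsInvertible := isInvertible_mfderiv_extChartAt (mem_extChartAt_source x)
  let l : E →L[ℝ] ℝ := (θ x).comp (e.symm : E →L[ℝ] TangentSpace I x)
  obtain ⟨f, hf⟩ := exists_function_germ (I := I)
    ((chartAt H x).open_source.mem_nhds (mem_chart_source H x)) (fun y => l (extChartAt I x y))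
    (l.contMDiff.comp_contMDiffOn contMDiffOn_extChartAt)
  refine ⟨f, ?_⟩
  have h1 : mfderiv I 𝓘(ℝ, ℝ) f x = l.comp φ := by
    rw [Filter.EventuallyEq.mfderiv_eq hf]
    refine (mfderiv_comp (g := l) x (l.contMDiff.mdifferentiable (n := ∞) (by simp) _)
      (contMDiffAt_extChartAt.mdifferentiableAt (n := ∞) (by simp))).trans ?_
    rw [ContinuousLinearMap.mfderiv_eq]
    rfl
  ext v
  obtain ⟨Y, hY⟩ := exists_section_eq (F := E) I v
  rw [← hY]
  refine (congrArg (fun g => g x) (ev_dOne f Y)).trans ?_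
  change mfderiv I 𝓘(ℝ, ℝ) f x (Y x) = _
  rw [h1, ← he]
  change θ x (e.symm (e (Y x))) = _
  rw [e.symm_apply_apply]
/-- The contraction `i_Y dθ`, written by Cartan's formula as `L_Y θ - d(θ(Y))`. -/
def insD (Y : VF I M) (θ : Form I M) : Form I M := lieForm Y θ - dOne (ev θ Y)

/-- The Courant-Dorfman bracket on `Γ(TM ⊕ T*M)`. -/
def courantDorfman (s t : VF I M × Form I M) : VF I M × Form I M :=
  (vbracket s.1 t.1, lieForm s.1 t.2 - insD t.1 s.2)

/-- A Dirac structure in the standard Courant algebroid `TM ⊕ T*M`: a subbundle which is equal to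
its own orthogonal and whose sections are closed under the Courant-Dorfman bracket. -/
structure IsDirac (I : ModelWithCorners ℝ E H) [IsManifold I ∞ M]
    (D : ∀ x : M, Submodule ℝ (TangentSpace I x × (TangentSpace I x →L[ℝ] ℝ))) : Prop where
  subbundle : IsSubbundle (F₁ := E) (F₂ := E →L[ℝ] ℝ) I D
  lagrangian : ∀ x d, d ∈ D x ↔ ∀ e ∈ D x, d.2 e.1 + e.2 d.1 = 0
  involutive : ∀ s t : VF I M × Form I M, (∀ x, val s x ∈ D x) → (∀ x, val t x ∈ D x) →
    ∀ x, val (courantDorfman s t) x ∈ D x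

end Dirac

section LieAlgebroids

variable {E : Type*} [NormedAddCommGroup E] [NormedSpace ℝ E] [FiniteDimensional ℝ E]
  {H : Type*} [TopologicalSpace H] (I : ModelWithCorners ℝ E H)
  {M : Type*} [TopologicalSpace M] [ChartedSpace H M] [IsManifold I ∞ M] [T2Space M]
  (F : Type*) [NormedAddCommGroup F] [NormedSpace ℝ F] [FiniteDimensional ℝ F]
  (A : M → Type*) [TopologicalSpace (TotalSpace F A)] [∀ x, AddCommGroup (A x)]
  [∀ x, Module ℝ (A x)] [∀ x, TopologicalSpace (A x)] [FiberBundle F A] [VectorBundle ℝ F A]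
  [ContMDiffVectorBundle ∞ F A I]

/-- A Lie algebroid structure on the smooth vector bundle `A → M`. -/
structure LieAlgebroid where
  /-- the anchor `ρ : A → TM`, a smooth vector bundle map over the identity -/
  anchor : Cₛ^∞⟮I; F →L[ℝ] E, fun x : M => A x →L[ℝ] TangentSpace I x⟯
  /-- the bracket on `Γ(A)`, an `ℝ`-bilinear map -/
  bracket : Cₛ^∞⟮I; F, A⟯ →ₗ[ℝ] Cₛ^∞⟮I; F, A⟯ →ₗ[ℝ] Cₛ^∞⟮I; F, A⟯
  skew : ∀ a b, bracket a b = -bracket b a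
  jacobi : ∀ a b c, bracket a (bracket b c) = bracket (bracket a b) c + bracket b (bracket a c)
  leibniz : ∀ a (f : C^∞⟮I, M; ℝ⟯) b,
    bracket a (f • b) = f • bracket a b + lieD (app anchor a) f • b
  anchor_bracket : ∀ a b, app anchor (bracket a b) = vbracket (app anchor a) (app anchor b)

variable {I F A}

namespace LieAlgebroid

variable (𝒜 : LieAlgebroid I F A)

/-- The anchor on sections. -/
def rho (a : Cₛ^∞⟮I; F, A⟯) : VF I M := app 𝒜.anchor a

/-- The transpose `ρᵗ : T*M → A*` of the anchor on sections, `⟨ρᵗ θ, a⟩ = ⟨θ, ρ(a)⟩`. -/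
def rhoT (θ : Form I M) : DualSec I F A :=
  dualSection
    { toFun := fun a => ev θ (𝒜.rho a)
      map_add' := fun a b => by
        ext x
        exact (congrArg (θ x) (map_add (𝒜.anchor x) (a x) (b x))).trans (map_add (θ x) _ _)
      map_smul' := fun f a => by
        ext x
        exact (congrArg (θ x) (map_smul (𝒜.anchor x) (f x) (a x))).trans (map_smul (θ x) _ _) }

/-- The map `(ρ, ρᵗ) : A ⊕ T*M → TM ⊕ A*` on sections. -/
def par (τ : SecC I F A) : SecB I F A := (𝒜.rho τ.1, 𝒜.rhoT τ.2)

/-- The map `(ρ, ρᵗ) : A ⊕ T*M → TM ⊕ A*` on the fibre over `x`. -/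
def parFib (x : M) : FibC I A x →ₗ[ℝ] FibB I A x where
  toFun τ := (𝒜.anchor x τ.1, τ.2 ∘L 𝒜.anchor x)
  map_add' τ σ := by ext <;> simp
  map_smul' c τ := by ext <;> simp

/-- The Lie derivative `L_a : Γ(A*) → Γ(A*)`, `⟨L_a α, b⟩ = ρ(a)⟨α, b⟩ - ⟨α, [a, b]⟩`. -/
def lieDual (a : Cₛ^∞⟮I; F, A⟯) (α : DualSec I F A) : DualSec I F A :=
  dualDer (𝒜.rho a) (𝒜.bracket a) (map_add _) (𝒜.leibniz a) α

/-- `L_a (X, α) = ([ρ(a), X], L_a α)` on `Γ(TM ⊕ A*)`. -/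
def lieB (a : Cₛ^∞⟮I; F, A⟯) (q : SecB I F A) : SecB I F A :=
  (vbracket (𝒜.rho a) q.1, 𝒜.lieDual a q.2)

/-- `L_a (b, θ) = ([a, b], L_{ρ(a)} θ)` on `Γ(A ⊕ T*M)`. -/
def lieC (a : Cₛ^∞⟮I; F, A⟯) (τ : SecC I F A) : SecC I F A :=
  (𝒜.bracket a τ.1, lieForm (𝒜.rho a) τ.2)

/-- The bracket `[(a₁, θ₁), (a₂, θ₂)]_d = ([a₁, a₂], L_{ρ(a₁)} θ₂ - i_{ρ(a₂)} dθ₁)` of the degenerate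
Courant algebroid `A ⊕ T*M`. -/
def brD (τ σ : SecC I F A) : SecC I F A :=
  (𝒜.bracket τ.1 σ.1, lieForm (𝒜.rho τ.1) σ.2 - insD (𝒜.rho σ.1) τ.2)

end LieAlgebroid

variable (I F A) in
/-- A Dorfman connection `Δ : Γ(TM ⊕ A*) × Γ(A ⊕ T*M) → Γ(A ⊕ T*M)`, where `TM ⊕ A*` is anchored by
the projection to `TM`. -/
structure DorfmanConnection where
  toFun : SecB I F A →ₗ[ℝ] SecC I F A →ₗ[ℝ] SecC I F A
  leibniz_right : ∀ q (f : C^∞⟮I, M; ℝ⟯) τ, toFun q (f • τ) = f • toFun q τ + lieD q.1 f • τ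
  leibniz_left : ∀ (f : C^∞⟮I, M; ℝ⟯) q τ,
    toFun (f • q) τ = f • toFun q τ + pairBC q τ • ((0, dOne f) : SecC I F A)
  map_d : ∀ q (f : C^∞⟮I, M; ℝ⟯), toFun q (0, dOne f) = (0, dOne (lieD q.1 f))

theorem pairBC_add (q : SecB I F A) (τ σ : SecC I F A) :
    pairBC q (τ + σ) = pairBC q τ + pairBC q σ := by
  have h (θ η : Form I M) Z : ev (θ + η) Z = ev θ Z + ev η Z := rfl
  simp only [pairBC, Prod.fst_add, Prod.snd_add, ev_add, h]
  abel

theorem pairBC_smul (q : SecB I F A) (f : C^∞⟮I, M; ℝ⟯) (τ : SecC I F A) :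
    pairBC q (f • τ) = f * pairBC q τ := by
  have h (θ : Form I M) Z : ev (f • θ) Z = f * ev θ Z := rfl
  simp only [pairBC, Prod.smul_fst, Prod.smul_snd, ev_smul, h]
  ring

namespace DorfmanConnection

variable (Δ : DorfmanConnection I F A)

/-- The map `b ↦ X₁⟨q₂, (b, 0)⟩ - ⟨q₂, Δ_{q₁} (b, 0)⟩`. -/
def dullFun (q₁ q₂ : SecB I F A) : Cₛ^∞⟮I; F, A⟯ →ₗ[C^∞⟮I, M; ℝ⟯] C^∞⟮I, M; ℝ⟯ where
  toFun b := lieD q₁.1 (pairBC q₂ (b, 0)) - pairBC q₂ (Δ.toFun q₁ (b, 0))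
  map_add' b c := by
    have h : ((b + c, 0) : SecC I F A) = (b, 0) + (c, 0) := by simp
    rw [h, map_add, pairBC_add, pairBC_add, lieD_add]
    abel
  map_smul' f b := by
    have h : ((f • b, 0) : SecC I F A) = f • (b, 0) :=
      Prod.ext rfl (by ext x : 1; exact (smul_zero (f x)).symm)
    rw [h, Δ.leibniz_right, pairBC_add, pairBC_smul, pairBC_smul, pairBC_smul, lieD_mul,
      RingHom.id_apply, smul_eq_mul]
    ring

/-- The dull bracket `⟦q₁, q₂⟧_Δ` on `Γ(TM ⊕ A*)` that is dual to `Δ`. It is characterised by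
`⟨⟦q₁, q₂⟧_Δ, τ⟩ = X₁⟨q₂, τ⟩ - ⟨q₂, Δ_{q₁} τ⟩`, see `dull_dual` below. -/
def dull (q₁ q₂ : SecB I F A) : SecB I F A :=
  (vbracket q₁.1 q₂.1, dualSection (Δ.dullFun q₁ q₂))

/-- `Δ_{(X, α)} (0, θ) = (0, L_X θ)`. -/
theorem toFun_form (q : SecB I F A) (θ : Form I M) : Δ.toFun q (0, θ) = (0, lieForm q.1 θ) := by
  let P : Form I M →ₗ[C^∞⟮I, M; ℝ⟯] SecC I F A :=
    { toFun := fun θ => Δ.toFun q (0, θ) - (0, lieForm q.1 θ)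
      map_add' := fun θ η => by
        have h : ((0, θ + η) : SecC I F A) = (0, θ) + (0, η) := by simp
        have h' : ((0, lieForm q.1 θ + lieForm q.1 η) : SecC I F A)
          = (0, lieForm q.1 θ) + (0, lieForm q.1 η) := by simp
        rw [h, map_add, lieForm_add, h']
        abel
      map_smul' := fun f θ => by
        have h : ((0, f • θ) : SecC I F A) = f • (0, θ) := by rw [Prod.smul_mk, smul_zero]
        have h' : ((0, f • lieForm q.1 θ + lieD q.1 f • θ) : SecC I F A)
          = f • (0, lieForm q.1 θ) + lieD q.1 f • (0, θ) := by
          rw [Prod.smul_mk, smul_zero, Prod.smul_mk, smul_zero, Prod.mk_add_mk, add_zero]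
        rw [h, Δ.leibniz_right, lieForm_smul, h', RingHom.id_apply]
        module }
  have h0 (f) : P (dOne f) = 0 := by
    change Δ.toFun q (0, dOne f) - (0, lieForm q.1 (dOne f)) = 0
    rw [Δ.map_d, lieForm_dOne, sub_self]
  refine sub_eq_zero.1 (?_ : P θ = 0)
  refine Prod.ext ?_ ?_
  · ext x
    obtain ⟨f, hf⟩ := exists_dOne_eq θ x
    let r : SecC I F A →+ A x := ⟨⟨fun τ => τ.1 x, rfl⟩, fun _ _ => rfl⟩
    have := apply_congr_point P x r (fun _ _ => rfl) θ (dOne f) hf.symm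
    rw [h0] at this
    exact this
  · ext x : 1
    obtain ⟨f, hf⟩ := exists_dOne_eq θ x
    let r : SecC I F A →+ (TangentSpace I x →L[ℝ] ℝ) := ⟨⟨fun τ => τ.2 x, rfl⟩, fun _ _ => rfl⟩
    have := apply_congr_point P x r (fun _ _ => rfl) θ (dOne f) hf.symm
    rw [h0] at this
    exact this

/-- The dull bracket is the dual of the Dorfman connection. -/
theorem dull_dual (q₁ q₂ : SecB I F A) (τ : SecC I F A) :
    pairBC (Δ.dull q₁ q₂) τ = lieD q₁.1 (pairBC q₂ τ) - pairBC q₂ (Δ.toFun q₁ τ) := by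
  obtain ⟨b, θ⟩ := τ
  have h : ((b, θ) : SecC I F A) = (b, 0) + (0, θ) := by simp
  rw [h, map_add, pairBC_add, pairBC_add, pairBC_add, lieD_add, toFun_form]
  have h1 : pairBC (Δ.dull q₁ q₂) (b, 0)
      = lieD q₁.1 (pairBC q₂ (b, 0)) - pairBC q₂ (Δ.toFun q₁ (b, 0)) := by
    refine Eq.trans ?_ (ev_dualSection (Δ.dullFun q₁ q₂) b)
    exact add_eq_left.2 (by ext x; rfl)
  have h2 (q : SecB I F A) (η : Form I M) : pairBC q (0, η) = ev η q.1 :=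
    add_eq_right.2 (by ext x; exact map_zero (q.2 x))
  rw [h1, h2, h2, h2]
  have h3 : ev θ (Δ.dull q₁ q₂).1 = lieD q₁.1 (ev θ q₂.1) - ev (lieForm q₁.1 θ) q₂.1 := by
    rw [ev_lieForm]
    exact (sub_sub_cancel _ _).symm
  rw [h3]
  abel

/-- `Ω_{(X, α)} a = Δ_{(X, α)} (a, 0) - (0, d⟨α, a⟩)`. -/
def Omega (q : SecB I F A) (a : Cₛ^∞⟮I; F, A⟯) : SecC I F A :=
  Δ.toFun q (a, 0) - (0, dOne (ev q.2 a))

/-- The basic connection `∇ᵇᵃˢ_a q = (ρ, ρᵗ)(Ω_q a) + L_a q` on `TM ⊕ A*`. -/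
def nablaBas (𝒜 : LieAlgebroid I F A) (a : Cₛ^∞⟮I; F, A⟯) (q : SecB I F A) : SecB I F A :=
  𝒜.par (Δ.Omega q a) + 𝒜.lieB a q

end DorfmanConnection

end LieAlgebroids

section TotalSpaceOfA

variable {E : Type*} [NormedAddCommGroup E] [NormedSpace ℝ E] [FiniteDimensional ℝ E]
  {H : Type*} [TopologicalSpace H] {I : ModelWithCorners ℝ E H}
  {M : Type*} [TopologicalSpace M] [ChartedSpace H M] [IsManifold I ∞ M] [T2Space M]
  {F : Type*} [NormedAddCommGroup F] [NormedSpace ℝ F] [FiniteDimensional ℝ F]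
  {A : M → Type*} [TopologicalSpace (TotalSpace F A)] [∀ x, AddCommGroup (A x)]
  [∀ x, Module ℝ (A x)] [∀ x, TopologicalSpace (A x)] [FiberBundle F A] [VectorBundle ℝ F A]
  [ContMDiffVectorBundle ∞ F A I]

instance : T2Space (TotalSpace F A) := t2Space_totalSpace

variable (I) in
/-- The fibre of `TA ⊕ T*A → A` over the point `p` of the manifold `A`. -/
abbrev Pont (p : TotalSpace F A) :=
  TangentSpace (I.prod 𝓘(ℝ, F)) p × (TangentSpace (I.prod 𝓘(ℝ, F)) p →L[ℝ] ℝ)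

variable (I) in
/-- The derivative at `p` of the bundle projection `A → M`. -/
def dproj (p : TotalSpace F A) : TangentSpace (I.prod 𝓘(ℝ, F)) p →L[ℝ] TangentSpace I p.1 :=
  mfderiv (I.prod 𝓘(ℝ, F)) I (fun z : TotalSpace F A => z.1) p

variable (I) in
/-- The vertical vector at `p` given by `b`, i.e. the velocity of `t ↦ p + t b` at `t = 0`. -/
def vlift (p : TotalSpace F A) (b : A p.1) : TangentSpace (I.prod 𝓘(ℝ, F)) p :=
  mfderiv 𝓘(ℝ, ℝ) (I.prod 𝓘(ℝ, F)) (fun t : ℝ => (⟨p.1, p.2 + t • b⟩ : TotalSpace F A)) 0 (1 : ℝ)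

/-- `(b, θ)^↑ = (b^↑, q_A^* θ)` at the point `p` of `A`. -/
def core (p : TotalSpace F A) (τ : FibC I A p.1) : Pont I p := (vlift I p τ.1, τ.2 ∘L dproj I p)

/-- The fibrewise linear function `ℓ_α` on `A`. -/
def linFun (α : DualSec I F A) (p : TotalSpace F A) : ℝ := α p.1 p.2

/-- For `q = (X, α)` and a section `a` of `A`, the element `(T_x a (X(x)), d_{a(x)} ℓ_α)`. -/
def horiz (a : Cₛ^∞⟮I; F, A⟯) (q : SecB I F A) (x : M) : Pont I (⟨x, a x⟩ : TotalSpace F A) :=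
  (mfderiv I (I.prod 𝓘(ℝ, F)) (fun y => (⟨y, a y⟩ : TotalSpace F A)) x (q.1 x),
    mfderiv (I.prod 𝓘(ℝ, F)) 𝓘(ℝ, ℝ) (linFun q.2) ⟨x, a x⟩)

/-- The value at `a(x)` of the linear section `σ^Δ(q)` of `TA ⊕ T*A → A`,
`σ^Δ(X, α)(a(x)) = (T_x a X(x), d ℓ_α(a(x))) - (Δ_{(X, α)} (a, 0))^↑(a(x))`. -/
def sigma (Δ : DorfmanConnection I F A) (q : SecB I F A) (a : Cₛ^∞⟮I; F, A⟯) (x : M) :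
    Pont I (⟨x, a x⟩ : TotalSpace F A) :=
  horiz a q x - core ⟨x, a x⟩ (val (Δ.toFun q (a, 0)) x)

/-- `a^l(q(x)) + τ(x)^↑`, where `a^l = (Ta, a^R)` is the linear section of `TA ⊕ T*A → TM ⊕ A*`
given by `a`: for `q = (X, α)` one has
`a^l(q(x)) = (T_x a X(x), d_{a(x)} (ℓ_α - q_A^* ⟨α, a⟩))`. Every element of `TA ⊕ T*A` over `q(x)`
is of this form. -/
def linElt (a : Cₛ^∞⟮I; F, A⟯) (q : SecB I F A) (τ : SecC I F A) (x : M) :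
    Pont I (⟨x, a x⟩ : TotalSpace F A) :=
  horiz a q x + core ⟨x, a x⟩ (val (τ - (0, dOne (ev q.2 a))) x)

/-- The projection `TA ⊕ T*A → TM ⊕ A*` sends the element `d` over `p` to `u`. -/
def IsOver (p : TotalSpace F A) (d : Pont I p) (u : FibB I A p.1) : Prop :=
  dproj I p d.1 = u.1 ∧ ∀ b, d.2 (vlift I p b) = u.2 b

/-- The linear section `b ↦ a^l(b) + φ(b)^↑` of `TA ⊕ T*A → TM ⊕ A*` takes values in `D` over `U`. -/
def LinIn (D : ∀ p : TotalSpace F A, Submodule ℝ (Pont I p))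
    (U : ∀ x : M, Submodule ℝ (FibB I A x)) (a : Cₛ^∞⟮I; F, A⟯)
    (φ : SecB I F A → SecC I F A) : Prop :=
  ∀ u ∈ secU (F := F) U, ∀ x, linElt a u (φ u) x ∈ D ⟨x, a x⟩

/-- The core section `τ^†` of `TA ⊕ T*A → TM ⊕ A*` takes values in `D` over `U`. -/
def CoreIn (D : ∀ p : TotalSpace F A, Submodule ℝ (Pont I p))
    (U : ∀ x : M, Submodule ℝ (FibB I A x)) (τ : SecC I F A) : Prop :=
  ∀ u ∈ secU (F := F) U, ∀ x, linElt 0 u τ x ∈ D ⟨x, (0 : Cₛ^∞⟮I; F, A⟯) x⟩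

/-- An LA-Dirac structure `(D, U, A, M)` on the Lie algebroid `A`: a Dirac structure `D` in
`TA ⊕ T*A → A` which is also a subalgebroid of the Lie algebroid `TA ⊕ T*A → TM ⊕ A*` over the
subbundle `U` of `TM ⊕ A*`.

The Lie algebroid `TA ⊕ T*A → TM ⊕ A*` is generated by its linear sections `a^l + φ~`
(where `φ~(b) = φ(b)^†` for a section `φ` of `Hom(TM ⊕ A*, A ⊕ T*M)`) and its core sections `τ^†`.
Its anchor and bracket are determined by
`Θ(a^l) = \hat{L_a}`, `Θ(τ^†) = ((ρ, ρᵗ) τ)^↑`, `[a^l, b^l] = [a, b]^l`,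
`[a^l, τ^†] = (L_a τ)^†`, `[τ^†, σ^†] = 0` and the Leibniz rule; hence `Θ(a^l + φ~)` is the linear
vector field of the derivation `L_a - (ρ, ρᵗ) ∘ φ` of `Γ(TM ⊕ A*)`,
`[a^l + φ~, τ^†] = (L_a τ - φ((ρ, ρᵗ) τ))^†` and `[a^l + φ~, b^l + ψ~] = [a, b]^l + χ~` with
`χ = L_a ψ - L_b φ + ψ (ρ, ρᵗ) φ - φ (ρ, ρᵗ) ψ`. -/
structure IsLADirac (𝒜 : LieAlgebroid I F A) (D : ∀ p : TotalSpace F A, Submodule ℝ (Pont I p))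
    (U : ∀ x : M, Submodule ℝ (FibB I A x)) : Prop where
  /-- `D` is a Dirac structure on the manifold `A`. -/
  dirac : IsDirac (I.prod 𝓘(ℝ, F)) D
  /-- `U` is a subbundle of `TM ⊕ A*`. -/
  subbundle : IsSubbundle (F₁ := E) (F₂ := F →L[ℝ] ℝ) I U
  /-- `D` projects to `U`. -/
  proj_mem : ∀ p, ∀ d ∈ D p, ∃ u : FibB I A p.1, u ∈ U p.1 ∧ IsOver p d u
  /-- `D → A ×_M U` is onto. -/
  proj_surj : ∀ p, ∀ u : FibB I A p.1, u ∈ U p.1 → ∃ d ∈ D p, IsOver p d u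
  /-- `D` is closed under the addition of `TA ⊕ T*A → TM ⊕ A*`. -/
  add_mem : ∀ (u : SecB I F A) (a b : Cₛ^∞⟮I; F, A⟯) (τ σ : SecC I F A) (x : M),
    linElt a u τ x ∈ D ⟨x, a x⟩ → linElt b u σ x ∈ D ⟨x, b x⟩ →
      linElt (a + b) u (τ + σ) x ∈ D ⟨x, (a + b) x⟩
  /-- `D` is closed under the scalar multiplication of `TA ⊕ T*A → TM ⊕ A*`. -/
  smul_mem : ∀ (u : SecB I F A) (c : ℝ) (a : Cₛ^∞⟮I; F, A⟯) (τ : SecC I F A) (x : M),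
    linElt a u τ x ∈ D ⟨x, a x⟩ → linElt (c • a) u (c • τ) x ∈ D ⟨x, (c • a) x⟩
  /-- The anchor of a core section of `D` is tangent to `U`. -/
  anchor_core : ∀ τ, CoreIn D U τ → 𝒜.par τ ∈ secU U
  /-- The anchor of a linear section of `D` is tangent to `U`. -/
  anchor_lin : ∀ a (φ : SecB I F A →ₗ[C^∞⟮I, M; ℝ⟯] SecC I F A), LinIn D U a φ →
    ∀ u ∈ secU (F := F) U, 𝒜.lieB a u - 𝒜.par (φ u) ∈ secU U
  /-- Brackets of linear and core sections of `D` are sections of `D`. -/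
  bracket_lin_core : ∀ a (φ : SecB I F A →ₗ[C^∞⟮I, M; ℝ⟯] SecC I F A) (τ : SecC I F A),
    LinIn D U a φ → CoreIn D U τ → CoreIn D U (𝒜.lieC a τ - φ (𝒜.par τ))
  /-- Brackets of linear sections of `D` are sections of `D`. -/
  bracket_lin_lin : ∀ a b (φ ψ : SecB I F A →ₗ[C^∞⟮I, M; ℝ⟯] SecC I F A),
    LinIn D U a φ → LinIn D U b ψ →
      LinIn D U (𝒜.bracket a b) fun u =>
        (𝒜.lieC a (ψ u) - ψ (𝒜.lieB a u)) - (𝒜.lieC b (φ u) - φ (𝒜.lieB b u))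
          + ψ (𝒜.par (φ u)) - φ (𝒜.par (ψ u))

/-- The Dorfman connection `Δ` is adapted to `D` (with side `U`): `D → A` is spanned by the sections
`σ^Δ(u)`, `u ∈ Γ(U)`, and `k^↑`, `k ∈ Γ(K)`, where `K` is the core of `D`. -/
def IsAdapted (Δ : DorfmanConnection I F A) (D : ∀ p : TotalSpace F A, Submodule ℝ (Pont I p))
    (U : ∀ x : M, Submodule ℝ (FibB I A x)) : Prop :=
  ∀ (a : Cₛ^∞⟮I; F, A⟯) (x : M), D ⟨x, a x⟩ = Submodule.span ℝ
    ({d | ∃ u ∈ secU (F := F) U, d = sigma Δ u a x} ∪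
      {d | ∃ k : SecC I F A, (∀ y, core (⟨y, 0⟩ : TotalSpace F A) (val k y) ∈ D ⟨y, 0⟩) ∧
        d = core ⟨x, a x⟩ (val k x)})

end TotalSpaceOfA

section Courant

variable {E : Type*} [NormedAddCommGroup E] [NormedSpace ℝ E]
  {H : Type*} [TopologicalSpace H] (I : ModelWithCorners ℝ E H)
  {M : Type*} [TopologicalSpace M] [ChartedSpace H M] [IsManifold I ∞ M]
  {V : M → Type*} [∀ x, AddCommGroup (V x)] [∀ x, Module ℝ (V x)]

/-- The sections in `Γ` are the smooth sections of a smooth vector bundle with fibres `V x`: they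
are a sheaf of modules over the smooth functions which is locally free of finite rank, with local
frames that are frames of the fibres. -/
structure IsVectorBundle (Γ : Submodule ℝ (∀ x, V x)) : Prop where
  smul_mem : ∀ (f : C^∞⟮I, M; ℝ⟯), ∀ s ∈ Γ, (fun x => f x • s x) ∈ Γ
  of_local : ∀ s : ∀ x, V x, (∀ x₀, ∃ t ∈ Γ, ∀ᶠ x in 𝓝 x₀, s x = t x) → s ∈ Γ
  exists_frame : ∀ x₀, ∃ (r : ℕ) (e : Fin r → ∀ x, V x), (∀ i, e i ∈ Γ) ∧
    (∀ᶠ x in 𝓝 x₀, LinearIndependent ℝ (fun i => e i x) ∧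
      Submodule.span ℝ (Set.range fun i => e i x) = ⊤) ∧
    ∀ s ∈ Γ, ∃ f : Fin r → C^∞⟮I, M; ℝ⟯, ∀ᶠ x in 𝓝 x₀, s x = ∑ i, f i x • e i x

/-- A Courant algebroid over `M` on the vector bundle with fibres `V x` and smooth sections `Γ`. -/
structure CourantAlgebroid (Γ : Submodule ℝ (∀ x, V x)) where
  isVectorBundle : IsVectorBundle I Γ
  /-- the pairing -/
  pairing : ∀ x, V x →ₗ[ℝ] V x →ₗ[ℝ] ℝ
  pairing_smooth : ∀ s ∈ Γ, ∀ t ∈ Γ, ContMDiff I 𝓘(ℝ, ℝ) ∞ fun x => pairing x (s x) (t x)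
  pairing_symm : ∀ x v w, pairing x v w = pairing x w v
  pairing_nondegenerate : ∀ x v, (∀ w, pairing x v w = 0) → v = 0
  /-- the anchor -/
  anchor : ∀ x, V x →ₗ[ℝ] TangentSpace I x
  anchor_smooth : ∀ s ∈ Γ,
    ContMDiff I I.tangent ∞ fun x => (⟨x, anchor x (s x)⟩ : TangentBundle I M)
  /-- the bracket -/
  bracket : Γ →ₗ[ℝ] Γ →ₗ[ℝ] Γ
  /-- the map `𝒟 = ρᵗ ∘ d` -/
  diff : C^∞⟮I, M; ℝ⟯ → Γ
  diff_spec : ∀ f x v, pairing x ((diff f).1 x) v = mfderiv I 𝓘(ℝ, ℝ) f x (anchor x v)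
  jacobi : ∀ a b c, bracket a (bracket b c) = bracket (bracket a b) c + bracket b (bracket a c)
  invariance : ∀ (a b c : Γ) (x : M),
    mfderiv I 𝓘(ℝ, ℝ) (fun y => pairing y (b.1 y) (c.1 y)) x (anchor x (a.1 x)) =
      pairing x ((bracket a b).1 x) (c.1 x) + pairing x (b.1 x) ((bracket a c).1 x)
  symmetric_part : ∀ a b : Γ, bracket a b + bracket b a =
    diff ⟨fun y => pairing y (a.1 y) (b.1 y), pairing_smooth _ a.2 _ b.2⟩

end Courant

section QuotientBundle

variable {E : Type*} [NormedAddCommGroup E] [NormedSpace ℝ E] [FiniteDimensional ℝ E]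
  {H : Type*} [TopologicalSpace H] {I : ModelWithCorners ℝ E H}
  {M : Type*} [TopologicalSpace M] [ChartedSpace H M] [IsManifold I ∞ M] [T2Space M]
  {F : Type*} [NormedAddCommGroup F] [NormedSpace ℝ F] [FiniteDimensional ℝ F]
  {A : M → Type*} [TopologicalSpace (TotalSpace F A)] [∀ x, AddCommGroup (A x)]
  [∀ x, Module ℝ (A x)] [∀ x, TopologicalSpace (A x)] [FiberBundle F A] [VectorBundle ℝ F A]
  [ContMDiffVectorBundle ∞ F A I]
  (𝒜 : LieAlgebroid I F A) (U : ∀ x : M, Submodule ℝ (FibB I A x))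

/-- The annihilator `U°` in `A ⊕ T*M`. -/
def ann (x : M) : Submodule ℝ (FibC I A x) where
  carrier := {τ | ∀ u ∈ U x, pairFib x u τ = 0}
  add_mem' {τ σ} h₁ h₂ u hu := by
    have h := congrArg₂ (· + ·) (h₁ u hu) (h₂ u hu)
    simp only [add_zero] at h
    rw [← h, pairFib, pairFib, pairFib, Prod.fst_add, Prod.snd_add, map_add, add_apply]
    ring
  zero_mem' u _ := by simp [pairFib]
  smul_mem' c τ h u hu := by
    have h' := congrArg (c * ·) (h u hu)
    simp only [mul_zero] at h'
    rw [← h', pairFib, pairFib, Prod.smul_fst, Prod.smul_snd, map_smul, smul_apply, smul_eq_mul,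
      smul_eq_mul]
    ring

/-- The graph of `-(ρ, ρᵗ) : U° → U` in `U ⊕ A ⊕ T*M`. -/
def graphSub (x : M) : Submodule ℝ (U x × FibC I A x) where
  carrier := {w | w.2 ∈ ann U x ∧ (w.1 : FibB I A x) = -𝒜.parFib x w.2}
  add_mem' {v w} h₁ h₂ := ⟨(ann U x).add_mem h₁.1 h₂.1, by
    rw [Prod.fst_add, Prod.snd_add, map_add, Submodule.coe_add, h₁.2, h₂.2, neg_add]⟩
  zero_mem' := ⟨(ann U x).zero_mem, by simp⟩
  smul_mem' c w h := ⟨(ann U x).smul_mem c h.1, by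
    rw [Prod.smul_fst, Prod.smul_snd, map_smul, Submodule.coe_smul, h.2, smul_neg]⟩

instance (x : M) (W : Submodule ℝ (FibB I A x)) : AddCommGroup (W × FibC I A x) :=
  letI : AddCommGroup W := Submodule.addCommGroup W
  Prod.instAddCommGroup

/-- The fibre of `C = (U ⊕ A ⊕ T*M) / graph(-(ρ, ρᵗ)|_{U°})`. -/
abbrev QFib (x : M) := (U x × FibC I A x) ⧸ graphSub 𝒜 U x

/-- The map `(u, τ) ↦ u ⊕ τ` from smooth sections of `U ⊕ A ⊕ T*M` to sections of `C`. -/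
def clsMap : (secU (F := F) U × SecC I F A) →ₗ[ℝ] ∀ x, QFib 𝒜 U x where
  toFun w x := Submodule.Quotient.mk (⟨val w.1.1 x, w.1.2 x⟩, val w.2 x)
  map_add' _ _ := rfl
  map_smul' _ _ := rfl

/-- The smooth sections of the quotient bundle `C`: the classes of the smooth sections of
`U ⊕ A ⊕ T*M`. -/
def secQ : Submodule ℝ (∀ x, QFib 𝒜 U x) := LinearMap.range (clsMap 𝒜 U)

/-- The section `u ⊕ τ` of `C`. -/
def cls (u : secU (F := F) U) (τ : SecC I F A) : secQ 𝒜 U := ⟨clsMap 𝒜 U (u, τ), ⟨(u, τ), rfl⟩⟩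

variable {U}

/-- The bracket of the Courant algebroid `𝒞` on `C` is given by
`⟦u₁ ⊕ τ₁, u₂ ⊕ τ₂⟧ = (⟦u₁, u₂⟧_Δ + ∇ᵇᵃˢ_{τ₁} u₂ - ∇ᵇᵃˢ_{τ₂} u₁)
  ⊕ ([τ₁, τ₂]_d + Δ_{u₁} τ₂ - Δ_{u₂} τ₁ + (0, d⟨τ₁, u₂⟩))`,
where in particular the first component is a section of `U`. -/
def HasBracket (𝒞 : CourantAlgebroid I (secQ 𝒜 U)) (Δ : DorfmanConnection I F A) : Prop :=
  ∀ (u₁ u₂ : secU (F := F) U) (τ₁ τ₂ : SecC I F A),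
    ∃ h : Δ.dull u₁ u₂ + Δ.nablaBas 𝒜 τ₁.1 u₂ - Δ.nablaBas 𝒜 τ₂.1 u₁ ∈ secU (F := F) U,
      𝒞.bracket (cls 𝒜 U u₁ τ₁) (cls 𝒜 U u₂ τ₂) =
        cls 𝒜 U ⟨_, h⟩ (𝒜.brD τ₁ τ₂ + Δ.toFun u₁ τ₂ - Δ.toFun u₂ τ₁
          + (0, dOne (pairBC (u₂ : SecB I F A) τ₁)))

end QuotientBundle

end LADirac

end

noncomputable section

namespace LADirac

section Frames

variable {E : Type*} [NormedAddCommGroup E] [NormedSpace ℝ E] [FiniteDimensional ℝ E]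
  {H : Type*} [TopologicalSpace H] {I : ModelWithCorners ℝ E H}
  {M : Type*} [TopologicalSpace M] [ChartedSpace H M] [IsManifold I ∞ M] [T2Space M]

theorem exists_bump (I : ModelWithCorners ℝ E H) [IsManifold I ∞ M] {x₀ : M} {p : M → Prop}
    (h : ∀ᶠ x in 𝓝 x₀, p x) :
    ∃ f : C^∞⟮I, M; ℝ⟯, (∀ᶠ x in 𝓝 x₀, f x = 1) ∧ ∀ x, p x ∨ f x = 0 := by
  obtain ⟨w, hw, hwo, hxw⟩ := eventually_nhds_iff.1 h
  obtain ⟨f, -, hf⟩ := (SmoothBumpFunction.nhds_basis_tsupport (I := I) x₀).mem_iff.1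
    (hwo.mem_nhds hxw)
  refine ⟨⟨f, f.contMDiff⟩, f.eventuallyEq_one, fun x => ?_⟩
  by_cases hx : x ∈ w
  · exact .inl (hw x hx)
  · exact .inr (image_eq_zero_of_notMem_tsupport fun h' => hx (hf h'))

/-- Sections that are dual to each other at a point can be corrected to be dual nearby. -/
theorem exists_dual_germ {S T : Type*} [AddCommGroup T] [Module C^∞⟮I, M; ℝ⟯ T]
    (P : S → T → C^∞⟮I, M; ℝ⟯) (hadd : ∀ s t t', P s (t + t') = P s t + P s t')
    (hsmul : ∀ s (f : C^∞⟮I, M; ℝ⟯) t, P s (f • t) = f * P s t) {x₀ : M} {r : ℕ}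
    (e : Fin r → S) (t : Fin r → T) (h : ∀ i j, P (e i) (t j) x₀ = if i = j then 1 else 0) :
    ∃ t' : Fin r → T, ∀ᶠ x in 𝓝 x₀, ∀ i j, P (e i) (t' j) x = if i = j then 1 else 0 := by
  classical
  let G : Matrix (Fin r) (Fin r) C^∞⟮I, M; ℝ⟯ := fun i j => P (e i) (t j)
  let ev₀ (x : M) : C^∞⟮I, M; ℝ⟯ →+* ℝ := (ContMDiffMap.evalRingHom x)
  have hdet : G.det x₀ = 1 := by
    have h1 : ev₀ x₀ G.det = ((ev₀ x₀).mapMatrix G).det := RingHom.map_det _ _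
    have h2 : (ev₀ x₀).mapMatrix G = 1 := by
      ext i j
      rw [RingHom.mapMatrix_apply, Matrix.map_apply, Matrix.one_apply]
      exact h i j
    rw [h2, Matrix.det_one] at h1
    exact h1
  have hne : ∀ᶠ x in 𝓝 x₀, G.det x ≠ 0 :=
    (G.det.contMDiff.continuous.continuousAt (x := x₀)).eventually_ne (by rw [hdet]; simp)
  obtain ⟨g, hg⟩ := exists_function_germ (I := I) hne (fun x => (G.det x)⁻¹)
    (fun x hx => (G.det.contMDiff.contMDiffAt.inv₀ hx).contMDiffWithinAt)
  let Pt (s : S) : T →ₗ[C^∞⟮I, M; ℝ⟯] C^∞⟮I, M; ℝ⟯ :=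
    { toFun := P s, map_add' := hadd s, map_smul' := fun f t => hsmul s f t }
  refine ⟨fun j => g • ∑ k, G.adjugate k j • t k, ?_⟩
  filter_upwards [hne, hg] with x hx hgx i j
  have h1 : P (e i) (g • ∑ k, G.adjugate k j • t k) = g * (G * G.adjugate) i j := by
    refine ((Pt (e i)).map_smul _ _).trans ?_
    rw [map_sum, Matrix.mul_apply, smul_eq_mul]
    congr 1
    refine Finset.sum_congr rfl fun k _ => ?_
    rw [map_smul, smul_eq_mul, mul_comm]
    rfl
  rw [h1, Matrix.mul_adjugate, Matrix.smul_apply, Matrix.one_apply]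
  split_ifs with hij
  · change g x * (G.det x * 1) = 1
    rw [hgx, mul_one, inv_mul_cancel₀ hx]
  · change g x * (G.det x * 0) = 0
    rw [mul_zero, mul_zero]

variable {F : Type*} [NormedAddCommGroup F] [NormedSpace ℝ F] [FiniteDimensional ℝ F]
  {V : M → Type*} [TopologicalSpace (TotalSpace F V)] [∀ x, AddCommGroup (V x)]
  [∀ x, Module ℝ (V x)] [∀ x, TopologicalSpace (V x)] [FiberBundle F V] [VectorBundle ℝ F V]
  [ContMDiffVectorBundle ∞ F V I]

theorem fibre_instances (F : Type*) [NormedAddCommGroup F] [NormedSpace ℝ F]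
    [FiniteDimensional ℝ F] {V : M → Type*} [TopologicalSpace (TotalSpace F V)]
    [∀ x, AddCommGroup (V x)] [∀ x, Module ℝ (V x)] [∀ x, TopologicalSpace (V x)] [FiberBundle F V]
    [VectorBundle ℝ F V] (x : M) : T2Space (V x) ∧ FiniteDimensional ℝ (V x) ∧
      IsTopologicalAddGroup (V x) ∧ ContinuousSMul ℝ (V x) :=
  ⟨FiberBundle.t2Space F V x, VectorBundle.finiteDimensional ℝ F V x,
    (VectorBundle.continuousLinearEquivAt ℝ F V x).toContinuousAddEquiv.isTopologicalAddGroup,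
    (VectorBundle.continuousLinearEquivAt ℝ F V x).continuousSMul⟩

/-- A local frame in the trivialization at `x₀`, together with the dual frame. -/
theorem exists_dual_frame_germ (I : ModelWithCorners ℝ E H) [IsManifold I ∞ M]
    [ContMDiffVectorBundle ∞ F V I] (x₀ : M) :
    ∃ (e : Fin (finrank ℝ F) → Cₛ^∞⟮I; F, V⟯)
      (ε : Fin (finrank ℝ F) → Cₛ^∞⟮I; F →L[ℝ] ℝ, fun x => V x →L[ℝ] ℝ⟯), ∀ᶠ x in 𝓝 x₀,
      (∀ v : V x, v = ∑ i, ε i x v • e i x) ∧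
      ∀ v : V x, (trivializationAt F V x₀ ⟨x, v⟩).2 = ∑ i, ε i x v • Module.finBasis ℝ F i := by
  obtain ⟨e, he, -⟩ := exists_frame_germ (F := F) (V := V) I x₀
  let t := trivializationAt F V x₀
  let b := Module.finBasis ℝ F
  have hxt : x₀ ∈ t.baseSet := FiberBundle.mem_baseSet_trivializationAt F V x₀
  have hα (i : Fin (finrank ℝ F)) : ∃ α : Cₛ^∞⟮I; F →L[ℝ] ℝ, fun x => V x →L[ℝ] ℝ⟯,
      α x₀ = (LinearMap.toContinuousLinearMap (b.coord i)).comp (t.continuousLinearMapAt ℝ x₀) :=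
    exists_section_eq (F := F →L[ℝ] ℝ) I
      (V := fun x => V x →L[ℝ] ℝ) (x := x₀) _
  choose α hα using hα
  have hte {x} (hx : x ∈ t.baseSet) (v : V x) :
      t.continuousLinearMapAt ℝ x v = (t ⟨x, v⟩).2 :=
    congrFun (t.coe_linearMapAt_of_mem (R := ℝ) hx) v
  obtain ⟨ε, hε⟩ := exists_dual_germ (I := I) (x₀ := x₀)
    (fun (s : Cₛ^∞⟮I; F, V⟯) (β : Cₛ^∞⟮I; F →L[ℝ] ℝ, fun x => V x →L[ℝ] ℝ⟯) => ev β s)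
    (fun _ _ _ => rfl) (fun _ _ _ => rfl) e α (fun i j => by
      change α j x₀ (e i x₀) = _
      rw [hα]
      change b.coord j (t.continuousLinearMapAt ℝ x₀ (e i x₀)) = _
      rw [hte hxt, he.self_of_nhds i]
      simp [b, Finsupp.single_apply])
  refine ⟨e, ε, ?_⟩
  filter_upwards [he, hε, t.open_baseSet.mem_nhds hxt] with x hx hεx hxt
  have h1 (v : V x) : v = ∑ i, b.coord i (t ⟨x, v⟩).2 • e i x := by
    have hinj : Function.Injective (t.continuousLinearMapAt ℝ x) :=
      Function.LeftInverse.injective (t.symmL_continuousLinearMapAt (R := ℝ) hxt)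
    apply hinj
    refine Eq.trans ?_ (map_sum (t.continuousLinearMapAt ℝ x) _ _).symm
    refine Eq.trans ((hte hxt v).trans (b.sum_repr _).symm) (Finset.sum_congr rfl fun i _ => ?_)
    refine Eq.trans ?_ (map_smul (t.continuousLinearMapAt ℝ x) _ _).symm
    rw [hte hxt, hx i]
    rfl
  have h2 (v : V x) (j) : ε j x v = b.coord j (t ⟨x, v⟩).2 := by
    conv_lhs => rw [h1 v]
    rw [map_sum]
    have h3 (i) : ε j x (e i x) = if i = j then 1 else 0 := hεx i j
    simp [h3]
  refine ⟨fun v => ?_, fun v => ?_⟩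
  · simp only [h2]; exact h1 v
  · simp only [h2]; exact (b.sum_repr _).symm

end Frames

section PairFib

variable {E : Type*} [NormedAddCommGroup E] [NormedSpace ℝ E] [FiniteDimensional ℝ E]
  {H : Type*} [TopologicalSpace H] {I : ModelWithCorners ℝ E H}
  {M : Type*} [TopologicalSpace M] [ChartedSpace H M] [IsManifold I ∞ M] [T2Space M]
  {F : Type*} [NormedAddCommGroup F] [NormedSpace ℝ F] [FiniteDimensional ℝ F]
  {A : M → Type*} [TopologicalSpace (TotalSpace F A)] [∀ x, AddCommGroup (A x)]
  [∀ x, Module ℝ (A x)] [∀ x, TopologicalSpace (A x)] [FiberBundle F A] [VectorBundle ℝ F A]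
  [ContMDiffVectorBundle ∞ F A I]

theorem pairBC_apply (q : SecB I F A) (τ : SecC I F A) (x : M) :
    pairBC q τ x = pairFib x (val q x) (val τ x) := rfl

theorem pairFib_add_left {x : M} (q q' : FibB I A x) (τ : FibC I A x) :
    pairFib x (q + q') τ = pairFib x q τ + pairFib x q' τ := by
  simp only [pairFib, Prod.fst_add, Prod.snd_add, map_add, add_apply]; ring

theorem pairFib_add_right {x : M} (q : FibB I A x) (τ τ' : FibC I A x) :
    pairFib x q (τ + τ') = pairFib x q τ + pairFib x q τ' := by
  simp only [pairFib, Prod.fst_add, Prod.snd_add, map_add, add_apply]; ring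

theorem pairFib_smul_left {x : M} (c : ℝ) (q : FibB I A x) (τ : FibC I A x) :
    pairFib x (c • q) τ = c * pairFib x q τ := by
  simp only [pairFib, Prod.smul_fst, Prod.smul_snd, map_smul, smul_apply, smul_eq_mul]; ring

theorem pairFib_smul_right {x : M} (c : ℝ) (q : FibB I A x) (τ : FibC I A x) :
    pairFib x q (c • τ) = c * pairFib x q τ := by
  simp only [pairFib, Prod.smul_fst, Prod.smul_snd, map_smul, smul_apply, smul_eq_mul]; ring

variable (I A) in
/-- The canonical pairing of the fibres as a bilinear map. -/
def pairL (x : M) : FibB I A x →ₗ[ℝ] FibC I A x →ₗ[ℝ] ℝ :=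
  LinearMap.mk₂ ℝ (pairFib x) pairFib_add_left pairFib_smul_left pairFib_add_right
    pairFib_smul_right

theorem pairFib_eq_zero_left {x : M} {q : FibB I A x} (h : ∀ τ, pairFib x q τ = 0) : q = 0 := by
  refine Prod.ext ?_ ?_
  · have h1 (θ : TangentSpace I x →L[ℝ] ℝ) : θ q.1 = 0 := by simpa [pairFib] using h (0, θ)
    exact SeparatingDual.eq_zero_of_forall_dual_eq_zero (R := ℝ) (V := E) h1
  · ext a; simpa [pairFib] using h (a, 0)

/-- Every functional on the fibre of `TM ⊕ A*` is the pairing with an element of `A ⊕ T*M`. -/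
theorem exists_pairFib_eq (F : Type*) [NormedAddCommGroup F] [NormedSpace ℝ F]
    [FiniteDimensional ℝ F] {A : M → Type*} [TopologicalSpace (TotalSpace F A)]
    [∀ x, AddCommGroup (A x)] [∀ x, Module ℝ (A x)] [∀ x, TopologicalSpace (A x)]
    [FiberBundle F A] [VectorBundle ℝ F A] {x : M} (l : FibB I A x →ₗ[ℝ] ℝ) :
    ∃ τ : FibC I A x, ∀ q, pairFib x q τ = l q := by
  obtain ⟨_, _, _, _⟩ := fibre_instances F (V := A) x
  let m : Dual ℝ (Dual ℝ (A x)) :=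
    l ∘ₗ LinearMap.inr ℝ _ _ ∘ₗ (LinearMap.toContinuousLinearMap (𝕜 := ℝ) (E := A x)
      (F' := ℝ)).toLinearMap
  obtain ⟨a, ha⟩ := (Module.evalEquiv ℝ (A x)).surjective m
  refine ⟨(a, LinearMap.toContinuousLinearMap (𝕜 := ℝ) (E := E) (l ∘ₗ LinearMap.inl ℝ _ _)),
    fun q => ?_⟩
  have h1 : q.2 a = m (q.2 : A x →ₗ[ℝ] ℝ) := by rw [← ha]; rfl
  have h2 : m (q.2 : A x →ₗ[ℝ] ℝ) = l (0, q.2) := rfl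
  have h3 : q = (q.1, 0) + (0, q.2) := by simp
  conv_rhs => rw [h3, map_add]
  rw [pairFib, h1, h2, add_comm]
  rfl

variable {U : ∀ x : M, Submodule ℝ (FibB I A x)}

theorem smul_mem_secU {u : SecB I F A} {f : C^∞⟮I, M; ℝ⟯}
    (h : ∀ x, val u x ∈ U x ∨ f x = 0) : f • u ∈ secU (F := F) U := fun x => by
  change f x • val u x ∈ U x
  rcases h x with h | h
  · exact (U x).smul_mem _ h
  · rw [h, zero_smul]; exact (U x).zero_mem

theorem exists_secC_eq {x : M} (τ : FibC I A x) : ∃ σ : SecC I F A, val σ x = τ := by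
  obtain ⟨a, ha⟩ := exists_section_eq (F := F) I τ.1
  obtain ⟨θ, hθ⟩ := exists_section_eq (F := E →L[ℝ] ℝ) I
    (V := fun x : M => TangentSpace I x →L[ℝ] ℝ) τ.2
  exact ⟨(a, θ), Prod.ext ha hθ⟩

/-- A local frame of `U` consisting of global sections of `U`, with dual sections of `A ⊕ T*M`. -/
theorem exists_frame_secU (hU : IsSubbundle (F₁ := E) (F₂ := F →L[ℝ] ℝ) I U) (x₀ : M) :
    ∃ (r : ℕ) (e : Fin r → SecB I F A) (t : Fin r → SecC I F A), (∀ i, e i ∈ secU U) ∧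
      ∀ᶠ x in 𝓝 x₀, (∀ i j, pairFib x (val (e i) x) (val (t j) x) = if i = j then 1 else 0) ∧
        Submodule.span ℝ (Set.range fun i => val (e i) x) = U x := by
  classical
  obtain ⟨r, e₀, he₀⟩ := hU x₀
  obtain ⟨f, hf1, hf⟩ := exists_bump I he₀
  let e (i : Fin r) : SecB I F A := f • e₀ i
  have he (i) : e i ∈ secU (F := F) U := smul_mem_secU fun x => (hf x).imp_left fun h => by
    rw [← h.2]; exact Submodule.subset_span ⟨i, rfl⟩
  have hee : ∀ᶠ x in 𝓝 x₀, ∀ i, val (e i) x = val (e₀ i) x := by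
    filter_upwards [hf1] with x hx i
    change f x • val (e₀ i) x = _
    rw [hx, one_smul]
  have hli : LinearIndependent ℝ (fun i => val (e i) x₀) := by
    have h := he₀.self_of_nhds.1
    simpa only [hee.self_of_nhds] using h
  have ht (j : Fin r) : ∃ t : SecC I F A, ∀ i,
      pairFib x₀ (val (e i) x₀) (val t x₀) = if i = j then 1 else 0 := by
    obtain ⟨l, hl⟩ := LinearMap.exists_extend ((Finsupp.lapply j) ∘ₗ hli.repr)
    obtain ⟨τ, hτ⟩ := exists_pairFib_eq F l
    obtain ⟨t, ht⟩ := exists_secC_eq (F := F) τ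
    refine ⟨t, fun i => ?_⟩
    have h1 := LinearMap.congr_fun hl ⟨val (e i) x₀, Submodule.subset_span ⟨i, rfl⟩⟩
    rw [ht, hτ]
    refine h1.trans ?_
    rw [LinearMap.comp_apply, hli.repr_eq_single i _ rfl]
    simp [Finsupp.single_apply]
  choose t ht using ht
  obtain ⟨t', ht'⟩ := exists_dual_germ (I := I) (x₀ := x₀) (pairBC (I := I) (F := F) (A := A))
    pairBC_add pairBC_smul e t (fun i j => ht j i)
  refine ⟨r, e, t', he, ?_⟩
  filter_upwards [ht', hee, he₀] with x h1 h2 h3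
  refine ⟨h1, ?_⟩
  simp only [h2]
  exact h3.2

/-- The sections of `U` span `U`. -/
theorem exists_secU_eq (hU : IsSubbundle (F₁ := E) (F₂ := F →L[ℝ] ℝ) I U) {x : M} {u : FibB I A x}
    (hu : u ∈ U x) : ∃ s ∈ secU (F := F) U, val s x = u := by
  obtain ⟨r, e, t, he, h⟩ := exists_frame_secU hU x
  rw [← h.self_of_nhds.2] at hu
  induction hu using Submodule.span_induction with
  | mem v hv => obtain ⟨i, rfl⟩ := hv; exact ⟨e i, he i, rfl⟩
  | zero => exact ⟨0, (secU U).zero_mem, rfl⟩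
  | add v w _ _ hv hw =>
    obtain ⟨s, hs, rfl⟩ := hv
    obtain ⟨s', hs', rfl⟩ := hw
    exact ⟨s + s', (secU U).add_mem hs hs', rfl⟩
  | smul c v _ hv =>
    obtain ⟨s, hs, rfl⟩ := hv
    exact ⟨c • s, (secU U).smul_mem c hs, rfl⟩

/-- The sections of `U°` span `U°`. -/
theorem exists_secAnn_eq (hU : IsSubbundle (F₁ := E) (F₂ := F →L[ℝ] ℝ) I U) {x : M}
    {k : FibC I A x} (hk : k ∈ ann U x) :
    ∃ s : SecC I F A, (∀ y, val s y ∈ ann U y) ∧ val s x = k := by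
  classical
  obtain ⟨r, e, t, he, h⟩ := exists_frame_secU hU x
  obtain ⟨f, hf1, hf⟩ := exists_bump I h
  obtain ⟨σ, hσ⟩ := exists_secC_eq (F := F) k
  have hval (y) : val (f • (σ - ∑ i, pairBC (e i) σ • t i)) y
      = f y • (val σ y - ∑ i, pairFib y (val (e i) y) (val σ y) • val (t i) y) := by
    have h1 (s : SecC I F A) : val (f • s) y = f y • val s y := rfl
    have h2 (s s' : SecC I F A) : val (s - s') y = val s y - val s' y := rfl
    have h3 : val (∑ i, pairBC (e i) σ • t i) y
        = ∑ i, pairFib y (val (e i) y) (val σ y) • val (t i) y := by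
      refine Prod.ext ?_ ?_
      · simp only [val, Prod.fst_sum, sum_sec_apply]; rfl
      · simp only [val, Prod.snd_sum, sum_sec_apply]; rfl
    rw [h1, h2, h3]
  refine ⟨f • (σ - ∑ i, pairBC (e i) σ • t i), fun y u hu => ?_, ?_⟩
  · rw [hval, pairFib_smul_right]
    rcases hf y with ⟨h1, h2⟩ | h0
    · suffices hs : U y ≤ LinearMap.ker ((pairL I A y).flip
          (val σ y - ∑ i, pairFib y (val (e i) y) (val σ y) • val (t i) y)) by
        have := hs hu
        rw [LinearMap.mem_ker] at this
        exact mul_eq_zero_of_right _ this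
      rw [← h2, Submodule.span_le]
      rintro _ ⟨j, rfl⟩
      have h1' (i) : pairL I A y (val (e j) y) (val (t i) y) = if j = i then 1 else 0 := h1 j i
      change pairL I A y (val (e j) y) _ = 0
      rw [map_sub, map_sum]
      simp only [map_smul, h1', smul_eq_mul, mul_ite, mul_one, mul_zero, Finset.sum_ite_eq,
        Finset.mem_univ, if_true]
      exact sub_self _
    · rw [h0, zero_mul]
  · rw [hval, hf1.self_of_nhds, one_smul, hσ, sub_eq_self]
    refine Finset.sum_eq_zero fun i _ => ?_
    rw [hk _ (he i x), zero_smul]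

end PairFib

section TotalSpaceCalculus

variable {E : Type*} [NormedAddCommGroup E] [NormedSpace ℝ E] [FiniteDimensional ℝ E]
  {H : Type*} [TopologicalSpace H] {I : ModelWithCorners ℝ E H}
  {M : Type*} [TopologicalSpace M] [ChartedSpace H M] [IsManifold I ∞ M] [T2Space M]
  {F : Type*} [NormedAddCommGroup F] [NormedSpace ℝ F] [FiniteDimensional ℝ F]
  {A : M → Type*} [TopologicalSpace (TotalSpace F A)] [∀ x, AddCommGroup (A x)]
  [∀ x, Module ℝ (A x)] [∀ x, TopologicalSpace (A x)] [FiberBundle F A] [VectorBundle ℝ F A]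
  [ContMDiffVectorBundle ∞ F A I]

theorem contMDiff_linFun (α : DualSec I F A) :
    ContMDiff (I.prod 𝓘(ℝ, F)) 𝓘(ℝ, ℝ) ∞ (linFun α) := by
  have h : ContMDiff (I.prod 𝓘(ℝ, F)) (I.prod 𝓘(ℝ, ℝ)) ∞
      (fun p : TotalSpace F A => TotalSpace.mk' ℝ (E := Bundle.Trivial M ℝ) p.1 (α p.1 p.2)) :=
    ContMDiff.clm_bundle_apply (F₁ := F) (F₂ := ℝ) (E₁ := A) (E₂ := Bundle.Trivial M ℝ)
      (IB := I) (b := fun p : TotalSpace F A => p.1)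
      (α.contMDiff.comp (contMDiff_proj A)) contMDiff_id
  intro x
  have h' := h x
  simp only [contMDiffAt_totalSpace] at h'
  exact h'.2

/-- The fibrewise linear function `ℓ_α` as a smooth function. -/
def linF (α : DualSec I F A) : C^∞⟮I.prod 𝓘(ℝ, F), TotalSpace F A; ℝ⟯ :=
  ⟨linFun α, contMDiff_linFun α⟩

/-- The differential of `ℓ_α`. -/
def dlin (α : DualSec I F A) (p : TotalSpace F A) : TangentSpace (I.prod 𝓘(ℝ, F)) p →L[ℝ] ℝ :=
  mfderiv (I.prod 𝓘(ℝ, F)) 𝓘(ℝ, ℝ) (linFun α) p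

/-- The pullback of a function to the total space. -/
def pullF (f : C^∞⟮I, M; ℝ⟯) : C^∞⟮I.prod 𝓘(ℝ, F), TotalSpace F A; ℝ⟯ :=
  ⟨fun p => f p.1, f.contMDiff.comp (contMDiff_proj A)⟩

theorem mfderiv_pullF (f : C^∞⟮I, M; ℝ⟯) (p : TotalSpace F A)
    (v : TangentSpace (I.prod 𝓘(ℝ, F)) p) :
    mfderiv (I.prod 𝓘(ℝ, F)) 𝓘(ℝ, ℝ) (pullF (F := F) (A := A) f) p v
      = mfderiv I 𝓘(ℝ, ℝ) f p.1 (dproj I p v) := by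
  have h := mfderiv_comp (I := I.prod 𝓘(ℝ, F)) (I' := I) (I'' := 𝓘(ℝ, ℝ)) p
    (g := f) (f := fun z : TotalSpace F A => z.1)
    (f.contMDiff.mdifferentiable (by simp) p.1)
    ((contMDiff_proj (n := ∞) A).mdifferentiable (by simp) p)
  exact congrArg (fun L => L v) h

theorem dproj_section (a : Cₛ^∞⟮I; F, A⟯) (x : M) (v : TangentSpace I x) :
    dproj I (⟨x, a x⟩ : TotalSpace F A)
      (mfderiv I (I.prod 𝓘(ℝ, F)) (fun y => (⟨y, a y⟩ : TotalSpace F A)) x v) = v := by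
  have h := mfderiv_comp (I := I) (I' := I.prod 𝓘(ℝ, F)) (I'' := I) x
    (g := fun z : TotalSpace F A => z.1) (f := fun y => (⟨y, a y⟩ : TotalSpace F A))
    ((contMDiff_proj (n := ∞) A).mdifferentiable (by simp) _)
    (a.contMDiff.mdifferentiable (by simp) x)
  have h2 : mfderiv I I ((fun z : TotalSpace F A => z.1) ∘ fun y => (⟨y, a y⟩ : TotalSpace F A)) x
      = ContinuousLinearMap.id ℝ (TangentSpace I x) := mfderiv_id
  rw [h2] at h
  exact (congrArg (fun L => L v) h).symm

theorem dlin_section (α : DualSec I F A) (a : Cₛ^∞⟮I; F, A⟯) (x : M)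
    (v : TangentSpace I x) :
    dlin α (⟨x, a x⟩ : TotalSpace F A)
      (mfderiv I (I.prod 𝓘(ℝ, F)) (fun y => (⟨y, a y⟩ : TotalSpace F A)) x v)
      = mfderiv I 𝓘(ℝ, ℝ) (ev α a) x v := by
  have h := mfderiv_comp (I := I) (I' := I.prod 𝓘(ℝ, F)) (I'' := 𝓘(ℝ, ℝ)) x
    (g := linFun α) (f := fun y => (⟨y, a y⟩ : TotalSpace F A))
    ((contMDiff_linFun α).mdifferentiable (by simp) _)
    (a.contMDiff.mdifferentiable (by simp) x)
  exact (congrArg (fun L => L v) h).symm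

theorem mdifferentiableAt_vline (p : TotalSpace F A) (b : A p.1) :
    MDifferentiableAt 𝓘(ℝ, ℝ) (I.prod 𝓘(ℝ, F))
      (fun t : ℝ => (⟨p.1, p.2 + t • b⟩ : TotalSpace F A)) 0 := by
  have h : ContMDiffAt 𝓘(ℝ, ℝ) (I.prod 𝓘(ℝ, F)) ∞
      (fun t : ℝ => (⟨p.1, p.2 + t • b⟩ : TotalSpace F A)) 0 := by
    rw [contMDiffAt_totalSpace]
    refine ⟨contMDiffAt_const, ?_⟩
    let T := trivializationAt F A p.1
    have hp : p.1 ∈ T.baseSet := FiberBundle.mem_baseSet_trivializationAt F A p.1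
    have h2 (t : ℝ) : (T ⟨p.1, p.2 + t • b⟩).2
        = T.linearMapAt ℝ p.1 p.2 + t • T.linearMapAt ℝ p.1 b := by
      rw [← map_smul, ← map_add]
      exact (congrFun (T.coe_linearMapAt_of_mem (R := ℝ) hp) _).symm
    refine ContMDiffAt.congr_of_eventuallyEq (f := fun t : ℝ => T.linearMapAt ℝ p.1 p.2
      + t • T.linearMapAt ℝ p.1 b) ?_ (Eventually.of_forall h2)
    exact contMDiffAt_const.add (contMDiffAt_id.smul contMDiffAt_const)
  exact h.mdifferentiableAt (by simp)

theorem dproj_vlift (p : TotalSpace F A) (b : A p.1) : dproj I p (vlift I p b) = 0 := by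
  have h := mfderiv_comp (I := 𝓘(ℝ, ℝ)) (I' := I.prod 𝓘(ℝ, F)) (I'' := I) (0 : ℝ)
    (g := fun z : TotalSpace F A => z.1)
    (f := fun t : ℝ => (⟨p.1, p.2 + t • b⟩ : TotalSpace F A))
    ((contMDiff_proj (n := ∞) A).mdifferentiable (by simp) _) (mdifferentiableAt_vline p b)
  have h2 : mfderiv 𝓘(ℝ, ℝ) I ((fun z : TotalSpace F A => z.1) ∘
      fun t : ℝ => (⟨p.1, p.2 + t • b⟩ : TotalSpace F A)) 0 = 0 :=
    mfderiv_const (c := p.1)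
  rw [h2] at h
  have h3 := (congrArg (fun L => L (1 : ℝ)) h).symm
  have h4 : (⟨p.1, p.2 + (0 : ℝ) • b⟩ : TotalSpace F A) = p := by simp
  have h5 : (dproj I (⟨p.1, p.2 + (0 : ℝ) • b⟩ : TotalSpace F A) : E × F →L[ℝ] E) = dproj I p := by
    rw [h4]
  exact (congrArg (fun L : E × F →L[ℝ] E => L (vlift I p b)) h5).symm.trans h3

theorem dlin_vlift (α : DualSec I F A) (p : TotalSpace F A) (b : A p.1) :
    dlin α p (vlift I p b) = α p.1 b := by
  have h := mfderiv_comp (I := 𝓘(ℝ, ℝ)) (I' := I.prod 𝓘(ℝ, F)) (I'' := 𝓘(ℝ, ℝ)) (0 : ℝ)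
    (g := linFun α)
    (f := fun t : ℝ => (⟨p.1, p.2 + t • b⟩ : TotalSpace F A))
    ((contMDiff_linFun α).mdifferentiable (by simp) _) (mdifferentiableAt_vline p b)
  have h1 : (linFun α) ∘ (fun t : ℝ => (⟨p.1, p.2 + t • b⟩ : TotalSpace F A))
      = fun t : ℝ => α p.1 p.2 + t * α p.1 b := by
    funext t
    change α p.1 (p.2 + t • b) = _
    rw [map_add, map_smul, smul_eq_mul]
  have h2 : HasDerivAt (fun t : ℝ => α p.1 p.2 + t * α p.1 b) (α p.1 b) 0 := by
    simpa using ((hasDerivAt_id (0 : ℝ)).mul_const (α p.1 b)).const_add (α p.1 p.2)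
  have h3 := (congrArg (fun L => L (1 : ℝ)) h).symm
  rw [h1, mfderiv_eq_fderiv] at h3
  have h4 : (⟨p.1, p.2 + (0 : ℝ) • b⟩ : TotalSpace F A) = p := by simp
  have h5 : (mfderiv (I.prod 𝓘(ℝ, F)) 𝓘(ℝ, ℝ) (linFun α)
      (⟨p.1, p.2 + (0 : ℝ) • b⟩ : TotalSpace F A) : E × F →L[ℝ] ℝ)
      = mfderiv (I.prod 𝓘(ℝ, F)) 𝓘(ℝ, ℝ) (linFun α) p := by
    rw [h4]
  refine (congrArg (fun L : E × F →L[ℝ] ℝ => L (vlift I p b)) h5).symm.trans (Eq.trans h3 ?_)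
  rw [h2.hasFDerivAt.fderiv]
  exact one_smul ℝ (α p.1 b)

/-- Tangent vectors of the total space are separated by the linear and the pulled back functions;
in the chart at `p₀` they are given by their projection and their action on linear functions. -/
theorem mfderiv_extChartAt_totalSpace (p₀ : TotalSpace F A) :
    ∃ ε : Fin (finrank ℝ F) → DualSec I F A, ∀ᶠ p in 𝓝 p₀, ∀ v : TangentSpace (I.prod 𝓘(ℝ, F)) p,
      mfderiv (I.prod 𝓘(ℝ, F)) 𝓘(ℝ, E × F) (extChartAt (I.prod 𝓘(ℝ, F)) p₀) p v =
        ((mfderiv I 𝓘(ℝ, E) (extChartAt I p₀.1) p.1 (dproj I p v) : E),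
          ∑ i, dlin (ε i) p v •
            Module.finBasis ℝ F i) := by
  obtain ⟨e, ε, h⟩ := exists_dual_frame_germ (F := F) (V := A) I p₀.1
  refine ⟨ε, ?_⟩
  let t := trivializationAt F A p₀.1
  have hc : Continuous (fun p : TotalSpace F A => p.1) := FiberBundle.continuous_proj F A
  have h2 : ∀ᶠ p : TotalSpace F A in 𝓝 p₀, (extChartAt (I.prod 𝓘(ℝ, F)) p₀ p : E × F)
      = (extChartAt I p₀.1 p.1, ∑ i, linFun (ε i) p • Module.finBasis ℝ F i) := by
    filter_upwards [(hc.tendsto p₀).eventually h, (hc.tendsto p₀).eventually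
      (t.open_baseSet.mem_nhds (FiberBundle.mem_baseSet_trivializationAt F A p₀.1))] with p hp hb
    rw [FiberBundle.extChartAt]
    refine Prod.ext ?_ ?_
    · change extChartAt I p₀.1 (t p).1 = _
      rw [t.coe_fst' hb]
    · exact hp.2 p.2
  have h3 : ∀ᶠ p : TotalSpace F A in 𝓝 p₀, p.1 ∈ (chartAt H p₀.1).source :=
    (hc.tendsto p₀).eventually ((chartAt H p₀.1).open_source.mem_nhds (mem_chart_source H _))
  have h4 : ∀ᶠ p : TotalSpace F A in 𝓝 p₀, p ∈ (chartAt (ModelProd H F) p₀).source :=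
    (chartAt (ModelProd H F) p₀).open_source.mem_nhds (mem_chart_source _ _)
  filter_upwards [h2.eventually_nhds, h3, h4] with p hp hp3 hp4 v
  have hG : MDifferentiableAt (I.prod 𝓘(ℝ, F)) 𝓘(ℝ, E × F) (extChartAt (I.prod 𝓘(ℝ, F)) p₀) p :=
    mdifferentiableAt_extChartAt hp4
  have hd2 (i) : HasMFDerivAt (I.prod 𝓘(ℝ, F)) 𝓘(ℝ, F)
      ((ContinuousLinearMap.toSpanSingleton ℝ (Module.finBasis ℝ F i)) ∘ linFun (ε i)) p _ :=
    (ContinuousLinearMap.hasMFDerivAt _).comp p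
      ((contMDiff_linFun (ε i)).mdifferentiable (by simp) p).hasMFDerivAt
  have hf : (ContinuousLinearMap.fst ℝ E F) ∘ (extChartAt (I.prod 𝓘(ℝ, F)) p₀)
      =ᶠ[𝓝 p] (extChartAt I p₀.1) ∘ fun p : TotalSpace F A => p.1 :=
    hp.mono fun y hy => congrArg Prod.fst hy
  have hs : (ContinuousLinearMap.snd ℝ E F) ∘ (extChartAt (I.prod 𝓘(ℝ, F)) p₀)
      =ᶠ[𝓝 p] ∑ i, (ContinuousLinearMap.toSpanSingleton ℝ (Module.finBasis ℝ F i)) ∘ linFun (ε i) :=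
    hp.mono fun y hy => (congrArg Prod.snd hy).trans (by rw [Finset.sum_apply]; rfl)
  have h5 := mfderiv_comp (I := I.prod 𝓘(ℝ, F)) (I' := I) (I'' := 𝓘(ℝ, E)) p
      (g := extChartAt I p₀.1) (f := fun z : TotalSpace F A => z.1)
      (mdifferentiableAt_extChartAt hp3)
      ((contMDiff_proj (n := ∞) A).mdifferentiable (by simp) p)
  have h6 := (HasMFDerivAt.sum (t := Finset.univ) fun i _ => hd2 i).mfderiv
  rw [← hf.mfderiv_eq, ((ContinuousLinearMap.fst ℝ E F).hasMFDerivAt.comp p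
    hG.hasMFDerivAt).mfderiv] at h5
  rw [← hs.mfderiv_eq, ((ContinuousLinearMap.snd ℝ E F).hasMFDerivAt.comp p
    hG.hasMFDerivAt).mfderiv] at h6
  refine Prod.ext ?_ ?_
  · exact congrArg (fun L => L v) h5
  · exact (congrArg (fun L : E × F →L[ℝ] F => L v) h6).trans
      (sum_apply (F := E × F →L[ℝ] F) _ _ _)

/-- Tangent vectors of the total space are separated by their projection and their action on the
fibrewise linear functions. -/
theorem tangent_totalSpace_ext {p : TotalSpace F A} {v w : TangentSpace (I.prod 𝓘(ℝ, F)) p}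
    (h1 : dproj I p v = dproj I p w)
    (h2 : ∀ β : DualSec I F A, dlin β p v = dlin β p w) : v = w := by
  obtain ⟨ε, h⟩ := mfderiv_extChartAt_totalSpace (I := I) p
  have h3 : (mfderiv (I.prod 𝓘(ℝ, F)) 𝓘(ℝ, E × F) (extChartAt (I.prod 𝓘(ℝ, F)) p) p).IsInvertible :=
    isInvertible_mfderiv_extChartAt (mem_extChartAt_source p)
  refine h3.injective ?_
  rw [h.self_of_nhds v, h.self_of_nhds w, h1]
  simp only [h2]
  rfl

theorem tangent_trivializationAt_snd {E : Type*} [NormedAddCommGroup E] [NormedSpace ℝ E]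
    {H : Type*} [TopologicalSpace H] {I : ModelWithCorners ℝ E H}
    {M : Type*} [TopologicalSpace M] [ChartedSpace H M] [IsManifold I ∞ M] {x₀ x : M}
    (hx : x ∈ (chartAt H x₀).source) (w : TangentSpace I x) :
    (trivializationAt E (TangentSpace I) x₀ (⟨x, w⟩ : TangentBundle I M)).2
      = mfderiv I 𝓘(ℝ, E) (extChartAt I x₀) x w := by
  rw [← TangentBundle.continuousLinearMapAt_trivializationAt hx]
  exact (congrFun (Trivialization.coe_linearMapAt_of_mem (R := ℝ)
    (trivializationAt E (TangentSpace I : M → Type _) x₀) hx) w).symm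

/-- A family of tangent vectors of the total space is smooth if its projection and its action on
fibrewise linear functions are smooth. -/
theorem contMDiff_vectorField_totalSpace (v : ∀ p : TotalSpace F A, TangentSpace (I.prod 𝓘(ℝ, F)) p)
    (X : VF I M) (h1 : ∀ p, dproj I p (v p) = X p.1)
    (h2 : ∀ β : DualSec I F A, ContMDiff (I.prod 𝓘(ℝ, F)) 𝓘(ℝ, ℝ) ∞ fun p =>
      dlin β p (v p)) :
    ContMDiff (I.prod 𝓘(ℝ, F)) ((I.prod 𝓘(ℝ, F)).prod 𝓘(ℝ, E × F)) ∞
      fun p => TotalSpace.mk' (E × F) (E := TangentSpace (I.prod 𝓘(ℝ, F))) p (v p) := by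
  intro p₀
  rw [Bundle.contMDiffAt_section]
  obtain ⟨ε, h⟩ := mfderiv_extChartAt_totalSpace (I := I) p₀
  have hX : ContMDiffAt I 𝓘(ℝ, E) ∞
      (fun x => (trivializationAt E (TangentSpace I) p₀.1 (⟨x, X x⟩ : TangentBundle I M)).2) p₀.1 :=
    (Bundle.contMDiffAt_section _).1 (X.contMDiff p₀.1)
  have hX' : ContMDiffAt (I.prod 𝓘(ℝ, F)) 𝓘(ℝ, E) ∞ (fun p : TotalSpace F A =>
      (trivializationAt E (TangentSpace I) p₀.1 (⟨p.1, X p.1⟩ : TangentBundle I M)).2) p₀ :=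
    hX.comp p₀ ((contMDiff_proj (n := ∞) A) p₀)
  have hY : ContMDiffAt (I.prod 𝓘(ℝ, F)) 𝓘(ℝ, F) ∞ (fun p : TotalSpace F A =>
      ∑ i, dlin (ε i) p (v p) •
            Module.finBasis ℝ F i) p₀ :=
    contMDiffAt_finsetSum fun i _ => (h2 (ε i) p₀).smul contMDiffAt_const
  refine (hX'.prodMk_space hY).congr_of_eventuallyEq ?_
  have hc : Continuous (fun p : TotalSpace F A => p.1) := FiberBundle.continuous_proj F A
  have h3 : ∀ᶠ p : TotalSpace F A in 𝓝 p₀, p.1 ∈ (chartAt H p₀.1).source :=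
    (hc.tendsto p₀).eventually ((chartAt H p₀.1).open_source.mem_nhds (mem_chart_source H _))
  have h4 : ∀ᶠ p : TotalSpace F A in 𝓝 p₀, p ∈ (chartAt (ModelProd H F) p₀).source :=
    (chartAt (ModelProd H F) p₀).open_source.mem_nhds (mem_chart_source _ _)
  filter_upwards [h, h3, h4] with p hp hp3 hp4
  rw [tangent_trivializationAt_snd hp3, ← h1]
  exact (tangent_trivializationAt_snd hp4 (v p)).trans (hp (v p))

end TotalSpaceCalculus

section TotalSpaceSections

variable {E : Type*} [NormedAddCommGroup E] [NormedSpace ℝ E] [FiniteDimensional ℝ E]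
  {H : Type*} [TopologicalSpace H] {I : ModelWithCorners ℝ E H}
  {M : Type*} [TopologicalSpace M] [ChartedSpace H M] [IsManifold I ∞ M] [T2Space M]
  {F : Type*} [NormedAddCommGroup F] [NormedSpace ℝ F] [FiniteDimensional ℝ F]
  {A : M → Type*} [TopologicalSpace (TotalSpace F A)] [∀ x, AddCommGroup (A x)]
  [∀ x, Module ℝ (A x)] [∀ x, TopologicalSpace (A x)] [FiberBundle F A] [VectorBundle ℝ F A]
  [ContMDiffVectorBundle ∞ F A I]

theorem exists_section_totalSpace (I : ModelWithCorners ℝ E H) [IsManifold I ∞ M]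
    [ContMDiffVectorBundle ∞ F A I] (p : TotalSpace F A) :
    ∃ (a : Cₛ^∞⟮I; F, A⟯) (x : M), p = ⟨x, a x⟩ := by
  obtain ⟨a, ha⟩ := exists_section_eq (F := F) I p.2
  exact ⟨a, p.1, by rw [ha]⟩

theorem ev_dualDer (X : VF I M) (D : Cₛ^∞⟮I; F, A⟯ → Cₛ^∞⟮I; F, A⟯)
    (hadd : ∀ s t, D (s + t) = D s + D t)
    (hsmul : ∀ (f : C^∞⟮I, M; ℝ⟯) s, D (f • s) = f • D s + lieD X f • s) (β : DualSec I F A)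
    (a : Cₛ^∞⟮I; F, A⟯) :
    ev (dualDer X D hadd hsmul β) a = lieD X (ev β a) - ev β (D a) := ev_dualSection _ _

/-- The linear vector field on the total space given by a derivation of `Γ(A)`. -/
theorem exists_linearVectorField (X : VF I M) (D : Cₛ^∞⟮I; F, A⟯ → Cₛ^∞⟮I; F, A⟯)
    (hadd : ∀ s t, D (s + t) = D s + D t)
    (hsmul : ∀ (f : C^∞⟮I, M; ℝ⟯) s, D (f • s) = f • D s + lieD X f • s) :
    ∃ V : VF (I.prod 𝓘(ℝ, F)) (TotalSpace F A), (∀ p, dproj I p (V p) = X p.1) ∧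
      (∀ β, lieD V (linF β) = linF (dualDer X D hadd hsmul β)) ∧
      ∀ (a : Cₛ^∞⟮I; F, A⟯) x, V ⟨x, a x⟩ =
        mfderiv I (I.prod 𝓘(ℝ, F)) (fun y => (⟨y, a y⟩ : TotalSpace F A)) x (X x)
          - vlift I ⟨x, a x⟩ (D a x) := by
  have hval (a : Cₛ^∞⟮I; F, A⟯) (x : M) (v : TangentSpace (I.prod 𝓘(ℝ, F)) (⟨x, a x⟩ : TotalSpace F A))
      (hv : v = mfderiv I (I.prod 𝓘(ℝ, F)) (fun y => (⟨y, a y⟩ : TotalSpace F A)) x (X x)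
          - vlift I ⟨x, a x⟩ (D a x)) : dproj I _ v = X x ∧
      ∀ β : DualSec I F A, dlin β _ v = dualDer X D hadd hsmul β x (a x) := by
    subst hv
    refine ⟨?_, fun β => ?_⟩
    · rw [map_sub, dproj_section, dproj_vlift, sub_zero]
    · rw [map_sub, dlin_section, dlin_vlift]
      exact (congrArg (fun g => g x) (ev_dualDer X D hadd hsmul β a)).symm
  have hex (p : TotalSpace F A) : ∃ v : TangentSpace (I.prod 𝓘(ℝ, F)) p, dproj I p v = X p.1 ∧
      ∀ β : DualSec I F A, dlin β p v = dualDer X D hadd hsmul β p.1 p.2 := by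
    obtain ⟨a, x, rfl⟩ := exists_section_totalSpace I p
    exact ⟨_, hval a x _ rfl⟩
  choose v hv1 hv2 using hex
  refine ⟨⟨v, contMDiff_vectorField_totalSpace v X hv1 fun β => ?_⟩, hv1, fun β => ?_,
    fun a x => ?_⟩
  · simp only [hv2]
    exact contMDiff_linFun _
  · ext p
    exact hv2 p β
  · refine tangent_totalSpace_ext ?_ fun β => ?_
    · exact (hv1 _).trans (hval a x _ rfl).1.symm
    · exact (hv2 _ β).trans ((hval a x _ rfl).2 β).symm

/-- The vertical vector field given by a section of `A`. -/
theorem exists_verticalVectorField (b : Cₛ^∞⟮I; F, A⟯) :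
    ∃ V : VF (I.prod 𝓘(ℝ, F)) (TotalSpace F A), (∀ p, V p = vlift I p (b p.1)) ∧
      ∀ β, lieD V (linF β) = pullF (ev β b) := by
  refine ⟨⟨fun p => vlift I p (b p.1), contMDiff_vectorField_totalSpace _ 0
    (fun p => dproj_vlift _ _) fun β => ?_⟩, fun _ => rfl, fun β => ?_⟩
  · simp only [dlin_vlift]
    exact (pullF (F := F) (A := A) (ev β b)).contMDiff
  · ext p
    exact dlin_vlift _ _ _

theorem contMDiff_form_dproj (θ : Form I M) (V : VF (I.prod 𝓘(ℝ, F)) (TotalSpace F A)) :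
    ContMDiff (I.prod 𝓘(ℝ, F)) 𝓘(ℝ, ℝ) ∞
      (fun p : TotalSpace F A => θ p.1 (dproj I p (V p))) := by
  have hV : ContMDiff (I.prod 𝓘(ℝ, F)) I.tangent ∞
      (fun p : TotalSpace F A => (⟨p.1, dproj I p (V p)⟩ : TangentBundle I M)) :=
    ((contMDiff_proj (n := ∞) (IB := I) (F := F) A).contMDiff_tangentMap (m := ∞) (by simp)).comp V.contMDiff
  have h : ContMDiff (I.prod 𝓘(ℝ, F)) (I.prod 𝓘(ℝ, ℝ)) ∞
      (fun p : TotalSpace F A => TotalSpace.mk' ℝ (E := Bundle.Trivial M ℝ) p.1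
        (θ p.1 (dproj I p (V p)))) :=
    ContMDiff.clm_bundle_apply (F₁ := E) (F₂ := ℝ) (E₁ := (TangentSpace I : M → Type _))
      (E₂ := Bundle.Trivial M ℝ) (IB := I) (b := fun p : TotalSpace F A => p.1)
      (θ.contMDiff.comp (contMDiff_proj A)) hV
  intro x
  have h' := h x
  simp only [contMDiffAt_totalSpace] at h'
  exact h'.2

/-- The linear `1`-form `d ℓ_α - ⟨η(·), dq⟩` on the total space. -/
theorem exists_linearForm (α : DualSec I F A) (η : Cₛ^∞⟮I; F, A⟯ →ₗ[C^∞⟮I, M; ℝ⟯] Form I M) :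
    ∃ Θ : Form (I.prod 𝓘(ℝ, F)) (TotalSpace F A), ∀ (a : Cₛ^∞⟮I; F, A⟯) x v,
      Θ ⟨x, a x⟩ v = dlin α ⟨x, a x⟩ v - η a x (dproj I ⟨x, a x⟩ v) := by
  choose s hs using fun p : TotalSpace F A => exists_section_eq (F := F) I p.2
  have hη (x : M) (a b : Cₛ^∞⟮I; F, A⟯) (h : a x = b x) : η a x = η b x :=
    apply_congr_point η x (⟨⟨fun θ => θ x, rfl⟩, fun _ _ => rfl⟩ : Form I M →+
      (TangentSpace I x →L[ℝ] ℝ)) (fun _ _ => rfl) a b h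
  let ζ (V : VF (I.prod 𝓘(ℝ, F)) (TotalSpace F A)) : C^∞⟮I.prod 𝓘(ℝ, F), TotalSpace F A; ℝ⟯ :=
    ⟨fun p => η (s p) p.1 (dproj I p (V p)), fun p₀ => by
      obtain ⟨e, ε, h⟩ := exists_dual_frame_germ (F := F) (V := A) I p₀.1
      have h1 : ContMDiffAt (I.prod 𝓘(ℝ, F)) 𝓘(ℝ, ℝ) ∞ (fun p : TotalSpace F A =>
          ∑ i, linFun (ε i) p • η (e i) p.1 (dproj I p (V p))) p₀ :=
        contMDiffAt_finsetSum fun i _ =>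
          (contMDiff_linFun (ε i) p₀).smul (contMDiff_form_dproj (η (e i)) V p₀)
      refine h1.congr_of_eventuallyEq ?_
      have hc : Continuous (fun p : TotalSpace F A => p.1) := FiberBundle.continuous_proj F A
      filter_upwards [(hc.tendsto p₀).eventually h] with p hp
      obtain ⟨c, hc⟩ : ∃ c : Fin (finrank ℝ F) → C^∞⟮I, M; ℝ⟯, ∀ i, c i p.1 = linFun (ε i) p :=
        ⟨fun i => algebraMap ℝ _ (linFun (ε i) p), fun _ => rfl⟩
      have h2 : η (s p) p.1 = η (∑ i, c i • e i) p.1 := by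
        refine hη _ _ _ ?_
        rw [hs, sum_sec_apply]
        conv_lhs => rw [hp.1 p.2]
        exact Finset.sum_congr rfl fun i _ => by rw [smul_sec_apply, hc]; rfl
      rw [h2, map_sum, sum_sec_apply]
      refine (sum_apply (F := E →L[ℝ] ℝ) _ _ _).trans (Finset.sum_congr rfl fun i _ => ?_)
      rw [map_smul, ← hc]
      rfl⟩
  refine ⟨dualSection
    { toFun := fun V => lieD V (linF α) - ζ V
      map_add' := fun V W => ?_
      map_smul' := fun f V => ?_ }, fun a x v => ?_⟩
  · ext p
    change dlin α p (V p + W p) - η (s p) p.1 (dproj I p (V p + W p))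
      = dlin α p (V p) - η (s p) p.1 (dproj I p (V p))
        + (dlin α p (W p) - η (s p) p.1 (dproj I p (W p)))
    rw [map_add, map_add, map_add]
    ring
  · ext p
    change dlin α p (f p • V p) - η (s p) p.1 (dproj I p (f p • V p))
      = f p * (dlin α p (V p) - η (s p) p.1 (dproj I p (V p)))
    rw [map_smul, map_smul, map_smul, smul_eq_mul, smul_eq_mul]
    ring
  · obtain ⟨V, rfl⟩ := exists_section_eq (F := E × F) (I.prod 𝓘(ℝ, F)) v
    refine (dualSection_apply _ V _).trans ?_
    change dlin α _ (V _) - η (s ⟨x, a x⟩) x (dproj I _ (V _)) = _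
    rw [hη x (s ⟨x, a x⟩) a (hs _)]

theorem smul_form_zero (f : C^∞⟮I, M; ℝ⟯) : f • (0 : Form I M) = 0 := by
  ext x : 1; exact smul_zero (f x)

namespace DorfmanConnection

variable (Δ : DorfmanConnection I F A)

/-- The derivation `a ↦ pr_A Δ_q (a, 0)`. -/
def der (q : SecB I F A) (a : Cₛ^∞⟮I; F, A⟯) : Cₛ^∞⟮I; F, A⟯ := (Δ.toFun q (a, 0)).1

theorem toFun_sum (q : SecB I F A) (a b : Cₛ^∞⟮I; F, A⟯) :
    Δ.toFun q (a + b, 0) = Δ.toFun q (a, 0) + Δ.toFun q (b, 0) := by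
  rw [← map_add, Prod.mk_add_mk, add_zero]

theorem toFun_smul (q : SecB I F A) (f : C^∞⟮I, M; ℝ⟯) (a : Cₛ^∞⟮I; F, A⟯) :
    Δ.toFun q (f • a, 0) = f • Δ.toFun q (a, 0) + lieD q.1 f • (a, 0) := by
  rw [← Δ.leibniz_right]
  exact congrArg (Δ.toFun q) (Prod.ext rfl (smul_form_zero f).symm)

theorem der_add (q : SecB I F A) (a b : Cₛ^∞⟮I; F, A⟯) :
    Δ.der q (a + b) = Δ.der q a + Δ.der q b := by
  rw [der, toFun_sum]; rfl

theorem der_smul (q : SecB I F A) (f : C^∞⟮I, M; ℝ⟯) (a : Cₛ^∞⟮I; F, A⟯) :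
    Δ.der q (f • a) = f • Δ.der q a + lieD q.1 f • a := by
  rw [der, toFun_smul]; rfl

/-- The linear map `a ↦ pr_{T*M} Δ_q (a, 0)`. -/
def formPart (q : SecB I F A) : Cₛ^∞⟮I; F, A⟯ →ₗ[C^∞⟮I, M; ℝ⟯] Form I M where
  toFun a := (Δ.toFun q (a, 0)).2
  map_add' a b := by rw [toFun_sum]; rfl
  map_smul' f a := by
    rw [toFun_smul]
    change f • _ + lieD q.1 f • (0 : Form I M) = _
    rw [smul_form_zero, add_zero]; rfl

/-- The derivation of `Γ(A*)` dual to `der`. -/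
def derDual (q : SecB I F A) (β : DualSec I F A) : DualSec I F A :=
  dualDer q.1 (Δ.der q) (Δ.der_add q) (Δ.der_smul q) β

theorem ev_derDual (q : SecB I F A) (β : DualSec I F A) (a : Cₛ^∞⟮I; F, A⟯) :
    ev (Δ.derDual q β) a = lieD q.1 (ev β a) - ev β (Δ.der q a) := ev_dualDer _ _ _ _ _ _

theorem toFun_eq (q : SecB I F A) (a : Cₛ^∞⟮I; F, A⟯) :
    Δ.toFun q (a, 0) = (Δ.der q a, Δ.formPart q a) := rfl

/-- The section `σ^Δ(q)` of `TA ⊕ T*A → A` is smooth. -/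
theorem exists_sigma_section (q : SecB I F A) :
    ∃ s : VF (I.prod 𝓘(ℝ, F)) (TotalSpace F A) × Form (I.prod 𝓘(ℝ, F)) (TotalSpace F A),
      (∀ (a : Cₛ^∞⟮I; F, A⟯) x, val s ⟨x, a x⟩ = sigma Δ q a x) ∧
      (∀ p, dproj I p (s.1 p) = q.1 p.1) ∧
      (∀ β, lieD s.1 (linF β) = linF (Δ.derDual q β)) ∧
      ∀ (a : Cₛ^∞⟮I; F, A⟯) x v,
        s.2 ⟨x, a x⟩ v = dlin q.2 ⟨x, a x⟩ v - Δ.formPart q a x (dproj I ⟨x, a x⟩ v) := by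
  obtain ⟨V, h1, h2, h3⟩ := exists_linearVectorField q.1 (Δ.der q) (Δ.der_add q) (Δ.der_smul q)
  obtain ⟨Θ, hΘ⟩ := exists_linearForm q.2 (Δ.formPart q)
  refine ⟨(V, Θ), fun a x => Prod.ext (h3 a x) ?_, h1, h2, hΘ⟩
  ext v
  exact hΘ a x v

end DorfmanConnection

end TotalSpaceSections

section AdaptedConnections

variable {E : Type*} [NormedAddCommGroup E] [NormedSpace ℝ E] [FiniteDimensional ℝ E]
  {H : Type*} [TopologicalSpace H] {I : ModelWithCorners ℝ E H}
  {M : Type*} [TopologicalSpace M] [ChartedSpace H M] [IsManifold I ∞ M] [T2Space M]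
  {F : Type*} [NormedAddCommGroup F] [NormedSpace ℝ F] [FiniteDimensional ℝ F]
  {A : M → Type*} [TopologicalSpace (TotalSpace F A)] [∀ x, AddCommGroup (A x)]
  [∀ x, Module ℝ (A x)] [∀ x, TopologicalSpace (A x)] [FiberBundle F A] [VectorBundle ℝ F A]
  [ContMDiffVectorBundle ∞ F A I]

theorem tangent_ext {x : M} {v w : TangentSpace I x}
    (h : ∀ f : C^∞⟮I, M; ℝ⟯, mfderiv I 𝓘(ℝ, ℝ) f x v = mfderiv I 𝓘(ℝ, ℝ) f x w) : v = w := by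
  have hd (f : C^∞⟮I, M; ℝ⟯) (v : TangentSpace I x) : dOne f x v = mfderiv I 𝓘(ℝ, ℝ) f x v := by
    obtain ⟨Y, rfl⟩ := exists_section_eq (F := E) I v
    exact congrArg (fun g => g x) (ev_dOne f Y)
  refine sub_eq_zero.1 (SeparatingDual.eq_zero_of_forall_dual_eq_zero (R := ℝ) (V := E)
    fun θ => ?_)
  obtain ⟨η, hη⟩ := exists_section_eq (F := E →L[ℝ] ℝ) I
    (V := fun x : M => TangentSpace I x →L[ℝ] ℝ) (x := x) θ
  obtain ⟨f, hf⟩ := exists_dOne_eq η x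
  rw [hη] at hf
  refine (congrArg (fun L : E →L[ℝ] ℝ => L (v - w)) hf).symm.trans ?_
  refine (map_sub (dOne f x) v w).trans ?_
  rw [hd, hd, h]
  exact sub_self (G := ℝ) _

theorem lieD_pullF {V : VF (I.prod 𝓘(ℝ, F)) (TotalSpace F A)} {X : VF I M}
    (hV : ∀ p, dproj I p (V p) = X p.1) (f : C^∞⟮I, M; ℝ⟯) :
    lieD V (pullF f) = pullF (lieD X f) := by
  ext p
  refine (mfderiv_pullF f p (V p)).trans ?_
  rw [hV]
  rfl

/-- The bracket of projectable vector fields projects to the bracket. -/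
theorem dproj_vbracket {V W : VF (I.prod 𝓘(ℝ, F)) (TotalSpace F A)} {X Y : VF I M}
    (hV : ∀ p, dproj I p (V p) = X p.1) (hW : ∀ p, dproj I p (W p) = Y p.1)
    (p : TotalSpace F A) : dproj I p (vbracket V W p) = vbracket X Y p.1 := by
  refine tangent_ext fun f => ?_
  rw [← mfderiv_pullF]
  have h : lieD (vbracket V W) (pullF f) p = lieD (vbracket X Y) f p.1 := by
    rw [lieD_vbracket, lieD_vbracket, lieD_pullF hW, lieD_pullF hV, lieD_pullF hV, lieD_pullF hW]
    rfl
  exact h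

theorem IsOver.unique {p : TotalSpace F A} {d : Pont I p} {u v : FibB I A p.1}
    (hd : IsOver p d u) (he : IsOver p d v) : u = v := by
  refine Prod.ext (hd.1.symm.trans he.1) ?_
  ext b
  exact (hd.2 b).symm.trans (he.2 b)

theorem IsOver.pair_core {p : TotalSpace F A} {d : Pont I p} {u : FibB I A p.1}
    (hd : IsOver p d u) (k : FibC I A p.1) :
    d.2 (core p k).1 + (core p k).2 d.1 = pairFib p.1 u k := by
  rw [pairFib, ← hd.1, ← hd.2]
  rfl

section

variable {𝒜 : LieAlgebroid I F A} {D : ∀ p : TotalSpace F A, Submodule ℝ (Pont I p)}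
  {U : ∀ x : M, Submodule ℝ (FibB I A x)}

theorem IsLADirac.core_mem_iff (hD : IsLADirac 𝒜 D U) (p : TotalSpace F A) (k : FibC I A p.1) :
    core p k ∈ D p ↔ k ∈ ann U p.1 := by
  rw [hD.dirac.lagrangian]
  constructor
  · intro h u hu
    obtain ⟨d, hd, hdu⟩ := hD.proj_surj p u hu
    rw [← hdu.pair_core, add_comm]
    exact h d hd
  · intro h d hd
    obtain ⟨u, hu, hdu⟩ := hD.proj_mem p d hd
    rw [add_comm, hdu.pair_core]
    exact h u hu

theorem IsLADirac.mem_of_isOver (hD : IsLADirac 𝒜 D U) {p : TotalSpace F A} {d : Pont I p}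
    {u : FibB I A p.1} (hd : d ∈ D p) (hu : IsOver p d u) : u ∈ U p.1 := by
  obtain ⟨v, hv, hdv⟩ := hD.proj_mem p d hd
  rwa [hu.unique hdv]

variable {Δ : DorfmanConnection I F A}

theorem IsAdapted.sigma_mem (hΔ : IsAdapted Δ D U) {u : SecB I F A} (hu : u ∈ secU (F := F) U)
    (a : Cₛ^∞⟮I; F, A⟯) (x : M) : sigma Δ u a x ∈ D ⟨x, a x⟩ := by
  rw [hΔ]
  exact Submodule.subset_span (.inl ⟨u, hu, rfl⟩)

end

namespace DorfmanConnection

variable (Δ : DorfmanConnection I F A)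

theorem ev_dull (q₁ q₂ : SecB I F A) (b : Cₛ^∞⟮I; F, A⟯) :
    ev (Δ.dull q₁ q₂).2 b
      = lieD q₁.1 (ev q₂.2 b) - ev q₂.2 (Δ.der q₁ b) - ev (Δ.formPart q₁ b) q₂.1 := by
  refine (ev_dualSection (Δ.dullFun q₁ q₂) b).trans ?_
  change lieD q₁.1 (pairBC q₂ (b, 0)) - pairBC q₂ (Δ.toFun q₁ (b, 0)) = _
  rw [Δ.toFun_eq]
  have h : pairBC q₂ (b, 0) = ev q₂.2 b := add_eq_left.2 (by ext x; rfl)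
  rw [h, pairBC]
  ring

/-- The linear function `⟨σ^Δ(q₁), σ^Δ(q₂)⟩`, one half of the pairing. -/
def halfPair (q₁ q₂ : SecB I F A) : DualSec I F A :=
  Δ.derDual q₂ q₁.2 - dualSection
    { toFun := fun a => ev (Δ.formPart q₁ a) q₂.1
      map_add' := fun a b => by rw [map_add]; rfl
      map_smul' := fun f a => by rw [map_smul]; rfl }

theorem ev_halfPair (q₁ q₂ : SecB I F A) (a : Cₛ^∞⟮I; F, A⟯) :
    ev (Δ.halfPair q₁ q₂) a
      = lieD q₂.1 (ev q₁.2 a) - ev q₁.2 (Δ.der q₂ a) - ev (Δ.formPart q₁ a) q₂.1 := by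
  have h (α β : DualSec I F A) : ev (α - β) a = ev α a - ev β a := rfl
  rw [halfPair, h, ev_derDual]
  exact congrArg _ (ev_dualSection _ a)

end DorfmanConnection

theorem ev_courantDorfman (s t : VF I M × Form I M) (V : VF I M) :
    ev (courantDorfman s t).2 V = lieD s.1 (ev t.2 V) - ev t.2 (vbracket s.1 V)
      - (lieD t.1 (ev s.2 V) - ev s.2 (vbracket t.1 V)) + lieD V (ev s.2 t.1) := by
  have h (θ η : Form I M) : ev (θ - η) V = ev θ V - ev η V := rfl
  rw [courantDorfman, h, insD, h, ev_lieForm, ev_lieForm, ev_dOne]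
  ring

section

variable {𝒜 : LieAlgebroid I F A} {D : ∀ p : TotalSpace F A, Submodule ℝ (Pont I p)}
  {U : ∀ x : M, Submodule ℝ (FibB I A x)} {Δ : DorfmanConnection I F A}

theorem secB_ext {q q' : SecB I F A} (h1 : q.1 = q'.1) (h2 : ∀ b, ev q.2 b = ev q'.2 b) : q = q' :=
  Prod.ext h1 (form_ext h2)

theorem lieD_sub (X : VF I M) (f g : C^∞⟮I, M; ℝ⟯) : lieD X (f - g) = lieD X f - lieD X g := by
  have := lieD_add X (f - g) g
  rw [sub_add_cancel] at this
  rw [this, add_sub_cancel_right]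

theorem vbracket_skew (X Y : VF I M) : vbracket X Y = -vbracket Y X := by
  refine DFunLike.ext _ _ fun x => tangent_ext fun f => ?_
  have h : lieD (vbracket X Y) f x = -lieD (vbracket Y X) f x := by
    rw [lieD_vbracket, lieD_vbracket]
    change lieD X (lieD Y f) x - lieD Y (lieD X f) x = -(lieD Y (lieD X f) x - lieD X (lieD Y f) x)
    ring
  refine Eq.trans h ?_
  exact (map_neg (mfderiv I 𝓘(ℝ, ℝ) f x) _).symm

theorem dull_add_dull (hD : IsLADirac 𝒜 D U) (hΔ : IsAdapted Δ D U) {u v : SecB I F A}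
    (hu : u ∈ secU (F := F) U) (hv : v ∈ secU (F := F) U) : Δ.dull u v + Δ.dull v u = 0 := by
  refine secB_ext ?_ fun a => ?_
  · change vbracket u.1 v.1 + vbracket v.1 u.1 = 0
    rw [vbracket_skew u.1 v.1, neg_add_cancel]
  · have h (α β : DualSec I F A) : ev (α + β) a = ev α a + ev β a := rfl
    have h0 : ev (0 : DualSec I F A) a = 0 := rfl
    change ev ((Δ.dull u v).2 + (Δ.dull v u).2) a = ev (0 : DualSec I F A) a
    rw [h, h0, Δ.ev_dull, Δ.ev_dull]
    ext x
    obtain ⟨s, hs, hs1, hs2, hs3⟩ := Δ.exists_sigma_section u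
    obtain ⟨t, ht, ht1, ht2, ht3⟩ := Δ.exists_sigma_section v
    have h1 := (hD.dirac.lagrangian _ _).1 (hΔ.sigma_mem hu a x) _ (hΔ.sigma_mem hv a x)
    rw [← hs, ← ht] at h1
    change s.2 _ (t.1 _) + t.2 _ (s.1 _) = 0 at h1
    rw [hs3, ht3, hs1, ht1] at h1
    have h2 : dlin u.2 ⟨x, a x⟩ (t.1 ⟨x, a x⟩) = ev (Δ.derDual v u.2) a x :=
      congrArg (fun g => g (⟨x, a x⟩ : TotalSpace F A)) (ht2 u.2)
    have h3 : dlin v.2 ⟨x, a x⟩ (s.1 ⟨x, a x⟩) = ev (Δ.derDual u v.2) a x :=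
      congrArg (fun g => g (⟨x, a x⟩ : TotalSpace F A)) (hs2 v.2)
    rw [h2, h3, Δ.ev_derDual, Δ.ev_derDual] at h1
    change lieD v.1 (ev u.2 a) x - ev u.2 (Δ.der v a) x - ev (Δ.formPart u a) v.1 x
      + (lieD u.1 (ev v.2 a) x - ev v.2 (Δ.der u a) x - ev (Δ.formPart v a) u.1 x) = 0 at h1
    change lieD u.1 (ev v.2 a) x - ev v.2 (Δ.der u a) x - ev (Δ.formPart u a) v.1 x
      + (lieD v.1 (ev u.2 a) x - ev u.2 (Δ.der v a) x - ev (Δ.formPart v a) u.1 x) = 0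
    linarith

end

end AdaptedConnections

section Integrability

variable {E : Type*} [NormedAddCommGroup E] [NormedSpace ℝ E] [FiniteDimensional ℝ E]
  {H : Type*} [TopologicalSpace H] {I : ModelWithCorners ℝ E H}
  {M : Type*} [TopologicalSpace M] [ChartedSpace H M] [IsManifold I ∞ M] [T2Space M]
  {F : Type*} [NormedAddCommGroup F] [NormedSpace ℝ F] [FiniteDimensional ℝ F]
  {A : M → Type*} [TopologicalSpace (TotalSpace F A)] [∀ x, AddCommGroup (A x)]
  [∀ x, Module ℝ (A x)] [∀ x, TopologicalSpace (A x)] [FiberBundle F A] [VectorBundle ℝ F A]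
  [ContMDiffVectorBundle ∞ F A I]
  {𝒜 : LieAlgebroid I F A} {D : ∀ p : TotalSpace F A, Submodule ℝ (Pont I p)}
  {U : ∀ x : M, Submodule ℝ (FibB I A x)} {Δ : DorfmanConnection I F A}

theorem vbracket_zero_right (X : VF I M) : vbracket X 0 = 0 := by
  have := vbracket_add_right X 0 0
  rw [add_zero] at this
  exact left_eq_add.1 this

theorem courantDorfman_mem (hD : IsLADirac 𝒜 D U)
    {s t : VF (I.prod 𝓘(ℝ, F)) (TotalSpace F A) × Form (I.prod 𝓘(ℝ, F)) (TotalSpace F A)}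
    (hΔ : IsAdapted Δ D U) {u v : SecB I F A} (hu : u ∈ secU (F := F) U) (hv : v ∈ secU (F := F) U)
    (hs : ∀ (a : Cₛ^∞⟮I; F, A⟯) x, val s ⟨x, a x⟩ = sigma Δ u a x)
    (ht : ∀ (a : Cₛ^∞⟮I; F, A⟯) x, val t ⟨x, a x⟩ = sigma Δ v a x) (p : TotalSpace F A) :
    val (courantDorfman s t) p ∈ D p := by
  refine hD.dirac.involutive s t (fun p => ?_) (fun p => ?_) p
  · obtain ⟨a, x, rfl⟩ := exists_section_totalSpace I p
    rw [hs]; exact hΔ.sigma_mem hu a x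
  · obtain ⟨a, x, rfl⟩ := exists_section_totalSpace I p
    rw [ht]; exact hΔ.sigma_mem hv a x

theorem dull_mem (hD : IsLADirac 𝒜 D U) (hΔ : IsAdapted Δ D U) {u v : SecB I F A}
    (hu : u ∈ secU (F := F) U) (hv : v ∈ secU (F := F) U) : Δ.dull u v ∈ secU (F := F) U := by
  intro x
  obtain ⟨s, hs, hs1, hs2, hs3⟩ := Δ.exists_sigma_section u
  obtain ⟨t, ht, ht1, ht2, ht3⟩ := Δ.exists_sigma_section v
  let a : Cₛ^∞⟮I; F, A⟯ := 0
  refine hD.mem_of_isOver (courantDorfman_mem hD hΔ hu hv hs ht ⟨x, a x⟩)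
    ⟨dproj_vbracket hs1 ht1 _, fun b => ?_⟩
  obtain ⟨b, rfl⟩ := exists_section_eq (F := F) I b
  obtain ⟨V, hV, hVl⟩ := exists_verticalVectorField (I := I) b
  have hV0 (p) : dproj I p (V p) = (0 : VF I M) p.1 := by rw [hV]; exact dproj_vlift _ _
  have h1 := congrArg (fun g => g (⟨x, a x⟩ : TotalSpace F A)) (ev_courantDorfman s t V)
  have hev (W : VF (I.prod 𝓘(ℝ, F)) (TotalSpace F A)) (hW : ∀ p, dproj I p (W p) = 0) (w : SecB I F A)
      (r : VF (I.prod 𝓘(ℝ, F)) (TotalSpace F A) × Form (I.prod 𝓘(ℝ, F)) (TotalSpace F A))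
      (hr : ∀ (a : Cₛ^∞⟮I; F, A⟯) x v,
        r.2 ⟨x, a x⟩ v = dlin w.2 ⟨x, a x⟩ v - Δ.formPart w a x (dproj I ⟨x, a x⟩ v)) :
      ev r.2 W = lieD W (linF w.2) := by
    ext p
    obtain ⟨a, x, rfl⟩ := exists_section_totalSpace I p
    refine (hr a x _).trans ?_
    rw [hW, map_zero, sub_zero]
    rfl
  have hbr (w : SecB I F A)
      (r : VF (I.prod 𝓘(ℝ, F)) (TotalSpace F A) × Form (I.prod 𝓘(ℝ, F)) (TotalSpace F A))
      (hr1 : ∀ p, dproj I p (r.1 p) = w.1 p.1)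
      (hr2 : ∀ β, lieD r.1 (linF β) = linF (Δ.derDual w β)) (β : DualSec I F A) :
      lieD (vbracket r.1 V) (linF β) = pullF (ev β (Δ.der w b)) := by
    rw [lieD_vbracket, hr2, hVl, hVl, lieD_pullF hr1, Δ.ev_derDual]
    ext p
    exact sub_sub_cancel _ _
  have hbr0 (w : SecB I F A)
      (r : VF (I.prod 𝓘(ℝ, F)) (TotalSpace F A) × Form (I.prod 𝓘(ℝ, F)) (TotalSpace F A))
      (hr1 : ∀ p, dproj I p (r.1 p) = w.1 p.1) (p) : dproj I p (vbracket r.1 V p) = 0 := by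
    rw [dproj_vbracket hr1 hV0, vbracket_zero_right]
    rfl
  have hst : ev s.2 t.1 = linF (Δ.halfPair u v) := by
    ext p
    obtain ⟨a, x, rfl⟩ := exists_section_totalSpace I p
    refine (hs3 a x _).trans ?_
    rw [ht1]
    refine Eq.trans (congrArg₂ (fun r r' : ℝ => r - r')
      (congrArg (fun g => g (⟨x, a x⟩ : TotalSpace F A)) (ht2 u.2)) rfl) ?_
    change ev (Δ.derDual v u.2) a x - ev (Δ.formPart u a) v.1 x = ev (Δ.halfPair u v) a x
    rw [Δ.ev_halfPair, Δ.ev_derDual]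
    rfl
  rw [hev V hV0 u s hs3, hev V hV0 v t ht3, hev _ (hbr0 u s hs1) v t ht3,
    hev _ (hbr0 v t ht1) u s hs3, hbr u s hs1 hs2, hbr v t ht1 ht2, hVl, hVl, hst, hVl,
    lieD_pullF hs1, lieD_pullF ht1] at h1
  have h2 : (courantDorfman s t).2 ⟨x, a x⟩ (V ⟨x, a x⟩) = ev (Δ.dull u v).2 b x := by
    refine h1.trans ?_
    rw [Δ.ev_dull, Δ.ev_halfPair]
    change lieD u.1 (ev v.2 b) x - ev v.2 (Δ.der u b) x
      - (lieD v.1 (ev u.2 b) x - ev u.2 (Δ.der v b) x) +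
      (lieD v.1 (ev u.2 b) x - ev u.2 (Δ.der v b) x - ev (Δ.formPart u b) v.1 x)
      = lieD u.1 (ev v.2 b) x - ev v.2 (Δ.der u b) x - ev (Δ.formPart u b) v.1 x
    ring
  rw [hV] at h2
  exact h2

/-- The Jacobi identity of the dull bracket on sections of `U`. -/
theorem dull_jacobi (hD : IsLADirac 𝒜 D U) (hΔ : IsAdapted Δ D U) {u v w : SecB I F A}
    (hu : u ∈ secU (F := F) U) (hv : v ∈ secU (F := F) U) (hw : w ∈ secU (F := F) U) :
    Δ.dull u (Δ.dull v w) = Δ.dull (Δ.dull u v) w + Δ.dull v (Δ.dull u w) := by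
  have hskew : Δ.dull (Δ.dull u v) w = -Δ.dull w (Δ.dull u v) :=
    eq_neg_of_add_eq_zero_left (dull_add_dull hD hΔ (dull_mem hD hΔ hu hv) hw)
  refine secB_ext (vbracket_jacobi u.1 v.1 w.1) fun a => ?_
  rw [hskew]
  ext x
  obtain ⟨s, hs, hs1, hs2, hs3⟩ := Δ.exists_sigma_section u
  obtain ⟨t, ht, ht1, ht2, ht3⟩ := Δ.exists_sigma_section v
  obtain ⟨r, hr, hr1, hr2, hr3⟩ := Δ.exists_sigma_section w
  have h0 := (hD.dirac.lagrangian _ _).1 (courantDorfman_mem hD hΔ hu hv hs ht ⟨x, a x⟩) _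
    (hΔ.sigma_mem hw a x)
  rw [← hr] at h0
  have h1 := congrArg (fun g => g (⟨x, a x⟩ : TotalSpace F A)) (ev_courantDorfman s t r.1)
  have hpair (q q' : SecB I F A)
      (k k' : VF (I.prod 𝓘(ℝ, F)) (TotalSpace F A) × Form (I.prod 𝓘(ℝ, F)) (TotalSpace F A))
      (hk3 : ∀ (a : Cₛ^∞⟮I; F, A⟯) x v,
        k.2 ⟨x, a x⟩ v = dlin q.2 ⟨x, a x⟩ v - Δ.formPart q a x (dproj I ⟨x, a x⟩ v))
      (hk1 : ∀ p, dproj I p (k'.1 p) = q'.1 p.1)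
      (hk2 : ∀ β, lieD k'.1 (linF β) = linF (Δ.derDual q' β)) :
      ev k.2 k'.1 = linF (Δ.halfPair q q') := by
    ext p
    obtain ⟨a, x, rfl⟩ := exists_section_totalSpace I p
    refine (hk3 a x _).trans ?_
    rw [hk1]
    refine Eq.trans (congrArg₂ (fun r r' : ℝ => r - r')
      (congrArg (fun g => g (⟨x, a x⟩ : TotalSpace F A)) (hk2 q.2)) rfl) ?_
    change ev (Δ.derDual q' q.2) a x - ev (Δ.formPart q a) q'.1 x = ev (Δ.halfPair q q') a x
    rw [Δ.ev_halfPair, Δ.ev_derDual]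
    rfl
  have hbr (q q' q'' : SecB I F A)
      (k k' k'' : VF (I.prod 𝓘(ℝ, F)) (TotalSpace F A) × Form (I.prod 𝓘(ℝ, F)) (TotalSpace F A))
      (hk3 : ∀ (a : Cₛ^∞⟮I; F, A⟯) x v,
        k.2 ⟨x, a x⟩ v = dlin q.2 ⟨x, a x⟩ v - Δ.formPart q a x (dproj I ⟨x, a x⟩ v))
      (hk1 : ∀ p, dproj I p (k'.1 p) = q'.1 p.1)
      (hk2 : ∀ β, lieD k'.1 (linF β) = linF (Δ.derDual q' β))
      (hk1' : ∀ p, dproj I p (k''.1 p) = q''.1 p.1)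
      (hk2' : ∀ β, lieD k''.1 (linF β) = linF (Δ.derDual q'' β)) :
      k.2 ⟨x, a x⟩ (vbracket k'.1 k''.1 ⟨x, a x⟩) = ev (Δ.derDual q' (Δ.derDual q'' q.2)) a x
        - ev (Δ.derDual q'' (Δ.derDual q' q.2)) a x
        - ev (Δ.formPart q a) (vbracket q'.1 q''.1) x := by
    have h := lieD_vbracket k'.1 k''.1 (linF q.2)
    rw [hk2, hk2', hk2, hk2'] at h
    have h' : dlin q.2 ⟨x, a x⟩ (vbracket k'.1 k''.1 ⟨x, a x⟩) =
      ev (Δ.derDual q' (Δ.derDual q'' q.2)) a x - ev (Δ.derDual q'' (Δ.derDual q' q.2)) a x :=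
      congrArg (fun g => g (⟨x, a x⟩ : TotalSpace F A)) h
    rw [hk3, dproj_vbracket hk1 hk1', h']
    rfl
  rw [hpair v w t r ht3 hr1 hr2, hpair u w s r hs3 hr1 hr2, hpair u v s t hs3 ht1 ht2, hs2, ht2,
    hr2] at h1
  have hbr1 := hbr w u v r s t hr3 hs1 hs2 ht1 ht2
  have hbr2 := hbr v u w t s r ht3 hs1 hs2 hr1 hr2
  have hbr3 := hbr u v w s t r hs3 ht1 ht2 hr1 hr2
  have h2 : ev (Δ.derDual u (Δ.halfPair v w)) a x - t.2 ⟨x, a x⟩ (vbracket s.1 r.1 ⟨x, a x⟩)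
      - (ev (Δ.derDual v (Δ.halfPair u w)) a x - s.2 ⟨x, a x⟩ (vbracket t.1 r.1 ⟨x, a x⟩))
      + ev (Δ.derDual w (Δ.halfPair u v)) a x + r.2 ⟨x, a x⟩ (vbracket s.1 t.1 ⟨x, a x⟩) = 0 :=
    (congrArg₂ (fun r r' : ℝ => r + r') h1.symm rfl).trans h0
  rw [hbr1, hbr2, hbr3] at h2
  simp only [Δ.ev_derDual, Δ.ev_halfPair, lieD_sub] at h2
  have h3 : ev (Δ.dull u (Δ.dull v w)).2 a x - (-ev (Δ.dull w (Δ.dull u v)).2 a x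
      + ev (Δ.dull v (Δ.dull u w)).2 a x) = 0 := by
    have hd (q q' : SecB I F A) : (Δ.dull q q').1 = vbracket q.1 q'.1 := rfl
    simp only [Δ.ev_dull, hd, lieD_sub]
    have hf (f g : C^∞⟮I, M; ℝ⟯) : (f - g) x = f x - g x := rfl
    simp only [hf] at h2 ⊢
    linarith
  exact sub_eq_zero.1 h3

end Integrability

section BasicConnection

variable {E : Type*} [NormedAddCommGroup E] [NormedSpace ℝ E] [FiniteDimensional ℝ E]
  {H : Type*} [TopologicalSpace H] {I : ModelWithCorners ℝ E H}
  {M : Type*} [TopologicalSpace M] [ChartedSpace H M] [IsManifold I ∞ M] [T2Space M]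
  {F : Type*} [NormedAddCommGroup F] [NormedSpace ℝ F] [FiniteDimensional ℝ F]
  {A : M → Type*} [TopologicalSpace (TotalSpace F A)] [∀ x, AddCommGroup (A x)]
  [∀ x, Module ℝ (A x)] [∀ x, TopologicalSpace (A x)] [FiberBundle F A] [VectorBundle ℝ F A]
  [ContMDiffVectorBundle ∞ F A I]

theorem vlift_sub (p : TotalSpace F A) (b c : A p.1) :
    vlift I p (b - c) = vlift I p b - vlift I p c := by
  refine tangent_totalSpace_ext ?_ fun β => ?_
  · rw [map_sub, dproj_vlift, dproj_vlift, dproj_vlift, sub_zero]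
  · rw [map_sub, dlin_vlift, dlin_vlift, dlin_vlift, map_sub]

theorem core_sub (p : TotalSpace F A) (k l : FibC I A p.1) :
    core p (k - l) = core p k - core p l :=
  Prod.ext (vlift_sub p k.1 l.1) (ContinuousLinearMap.sub_comp k.2 l.2 (dproj I p))

theorem core_zero (p : TotalSpace F A) : core p (0 : FibC I A p.1) = 0 := by
  rw [← sub_self (0 : FibC I A p.1), core_sub, sub_self]

theorem linElt_sub (a : Cₛ^∞⟮I; F, A⟯) (q : SecB I F A) (τ σ : SecC I F A) (x : M) :
    linElt a q τ x - linElt a q σ x = core ⟨x, a x⟩ (val (τ - σ) x) := by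
  have h : val (τ - σ) x = val (τ - (0, dOne (ev q.2 a))) x - val (σ - (0, dOne (ev q.2 a))) x := by
    refine (congrArg (fun s => val s x)
      (sub_sub_sub_cancel_right τ σ ((0, dOne (ev q.2 a)) : SecC I F A)).symm).trans rfl
  rw [h, core_sub, linElt, linElt, add_sub_add_left_eq_sub]

theorem dOne_add (f g : C^∞⟮I, M; ℝ⟯) : dOne (f + g) = dOne f + dOne g :=
  form_ext fun Y => by
    have h (θ η : Form I M) : ev (θ + η) Y = ev θ Y + ev η Y := rfl
    rw [h, ev_dOne, ev_dOne, ev_dOne, lieD_add]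

theorem dOne_mul (f g : C^∞⟮I, M; ℝ⟯) : dOne (f * g) = f • dOne g + g • dOne f :=
  form_ext fun Y => by
    have h (θ η : Form I M) : ev (θ + η) Y = ev θ Y + ev η Y := rfl
    have h' (f : C^∞⟮I, M; ℝ⟯) (θ : Form I M) : ev (f • θ) Y = f * ev θ Y := rfl
    rw [h, h', h', ev_dOne, ev_dOne, ev_dOne, lieD_mul, mul_comm (lieD Y f)]

theorem dOne_zero : dOne (0 : C^∞⟮I, M; ℝ⟯) = 0 := by
  have := dOne_add (0 : C^∞⟮I, M; ℝ⟯) 0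
  rw [add_zero] at this
  exact left_eq_add.1 this

namespace DorfmanConnection

variable (Δ : DorfmanConnection I F A)

theorem Omega_eq (q : SecB I F A) (a : Cₛ^∞⟮I; F, A⟯) :
    Δ.Omega q a = (Δ.der q a, Δ.formPart q a - dOne (ev q.2 a)) := by
  rw [Omega, toFun_eq]
  exact Prod.ext (sub_zero _) rfl

/-- `Ω_q a` is tensorial in `q`. -/
def omegaL (a : Cₛ^∞⟮I; F, A⟯) : SecB I F A →ₗ[C^∞⟮I, M; ℝ⟯] SecC I F A where
  toFun q := Δ.Omega q a
  map_add' q q' := by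
    have h : ev (q + q').2 a = ev q.2 a + ev q'.2 a := rfl
    have h2 (θ η : Form I M) : ((0, θ + η) : SecC I F A) = (0, θ) + (0, η) := by simp
    rw [Omega, Omega, Omega, map_add, h, dOne_add, LinearMap.add_apply, sub_add_sub_comm, h2]
  map_smul' f q := by
    have h : ev (f • q).2 a = f * ev q.2 a := rfl
    have h2 : pairBC q (a, 0) = ev q.2 a := add_eq_left.2 (by ext x; rfl)
    rw [Omega, Omega, Δ.leibniz_left, h, dOne_mul, h2, RingHom.id_apply]
    have h3 : ((0, f • dOne (ev q.2 a) + ev q.2 a • dOne f) : SecC I F A)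
        = f • (0, dOne (ev q.2 a)) + ev q.2 a • (0, dOne f) := by
      rw [Prod.smul_mk, smul_zero, Prod.smul_mk, smul_zero, Prod.mk_add_mk, add_zero]
    rw [h3]
    module

/-- The basic curvature. -/
def curvBas (𝒜 : LieAlgebroid I F A) (a b : Cₛ^∞⟮I; F, A⟯) (u : SecB I F A) : SecC I F A :=
  -Δ.Omega u (𝒜.bracket a b) + 𝒜.lieC a (Δ.Omega u b) - 𝒜.lieC b (Δ.Omega u a)
    + Δ.Omega (Δ.nablaBas 𝒜 b u) a - Δ.Omega (Δ.nablaBas 𝒜 a u) b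

end DorfmanConnection

variable {𝒜 : LieAlgebroid I F A} {D : ∀ p : TotalSpace F A, Submodule ℝ (Pont I p)}
  {U : ∀ x : M, Submodule ℝ (FibB I A x)} {Δ : DorfmanConnection I F A}

theorem ev_rhoT (𝒜 : LieAlgebroid I F A) (θ : Form I M) (a : Cₛ^∞⟮I; F, A⟯) :
    ev (𝒜.rhoT θ) a = ev θ (𝒜.rho a) := ev_dualSection _ _

theorem par_neg (τ : SecC I F A) : 𝒜.par (-τ) = -𝒜.par τ := by
  refine secB_ext ?_ fun b => ?_
  · ext x; exact map_neg (𝒜.anchor x) _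
  · have h (α : DualSec I F A) : ev (-α) b = -ev α b := rfl
    have h' (θ : Form I M) (X : VF I M) : ev (-θ) X = -ev θ X := rfl
    change ev (𝒜.rhoT (-τ.2)) b = ev (-𝒜.rhoT τ.2) b
    rw [h, ev_rhoT, ev_rhoT, h']

theorem linElt_omega (Δ : DorfmanConnection I F A) (a : Cₛ^∞⟮I; F, A⟯) (q : SecB I F A) (x : M) :
    linElt a q (-Δ.Omega q a) x = sigma Δ q a x := by
  have h : -Δ.Omega q a - (0, dOne (ev q.2 a)) = 0 - Δ.toFun q (a, 0) := by
    rw [DorfmanConnection.Omega]; abel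
  have h2 : val (0 - Δ.toFun q (a, 0)) x = 0 - val (Δ.toFun q (a, 0)) x := rfl
  rw [linElt, h, h2, core_sub, core_zero, sigma, zero_sub, sub_eq_add_neg]

theorem linIn_omega (hΔ : IsAdapted Δ D U) (a : Cₛ^∞⟮I; F, A⟯) :
    LinIn D U a (fun q => -Δ.Omega q a) := fun u hu x => by
  rw [linElt_omega]; exact hΔ.sigma_mem hu a x

theorem coreIn_of_ann (hD : IsLADirac 𝒜 D U) (hΔ : IsAdapted Δ D U) {τ : SecC I F A}
    (hτ : ∀ y, val τ y ∈ ann U y) : CoreIn D U τ := fun u hu x => by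
  have h1 := linElt_sub (0 : Cₛ^∞⟮I; F, A⟯) u τ (-Δ.Omega u 0) x
  have h2 : Δ.Omega u 0 = 0 := by
    have h3 : ev u.2 (0 : Cₛ^∞⟮I; F, A⟯) = 0 := by ext y; exact map_zero (u.2 y)
    rw [DorfmanConnection.Omega, h3, dOne_zero]
    exact (sub_zero _).trans (map_zero (Δ.toFun u))
  have h3 := hΔ.sigma_mem hu 0 x
  rw [linElt_omega, h2, neg_zero, sub_zero, sub_eq_iff_eq_add] at h1
  rw [h1]
  exact (D _).add_mem ((hD.core_mem_iff _ _).2 (hτ x)) h3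

theorem parFib_mem (hD : IsLADirac 𝒜 D U) (hΔ : IsAdapted Δ D U) {x : M} {k : FibC I A x}
    (hk : k ∈ ann U x) : 𝒜.parFib x k ∈ U x := by
  obtain ⟨s, hs, rfl⟩ := exists_secAnn_eq hD.subbundle hk
  have h := hD.anchor_core s (coreIn_of_ann hD hΔ hs) x
  have h2 : val (𝒜.par s) x = 𝒜.parFib x (val s x) := by
    refine Prod.ext rfl ?_
    ext v
    obtain ⟨b, rfl⟩ := exists_section_eq (F := F) I v
    exact dualSection_apply _ b x
  rwa [h2] at h

theorem nablaBas_mem (hD : IsLADirac 𝒜 D U) (hΔ : IsAdapted Δ D U) (a : Cₛ^∞⟮I; F, A⟯)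
    {u : SecB I F A} (hu : u ∈ secU (F := F) U) : Δ.nablaBas 𝒜 a u ∈ secU (F := F) U := by
  have h := hD.anchor_lin a (-Δ.omegaL a) (linIn_omega hΔ a) u hu
  rw [show (-Δ.omegaL a) u = -Δ.Omega u a from rfl, par_neg, sub_neg_eq_add, add_comm] at h
  exact h

theorem pairBC_curvBas (hD : IsLADirac 𝒜 D U) (hΔ : IsAdapted Δ D U) (a b : Cₛ^∞⟮I; F, A⟯)
    {u v : SecB I F A} (hu : u ∈ secU (F := F) U) (hv : v ∈ secU (F := F) U) :
    pairBC v (Δ.curvBas 𝒜 a b u) = 0 := by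
  have hC (a : Cₛ^∞⟮I; F, A⟯) (τ : SecC I F A) : 𝒜.lieC a (-τ) = -𝒜.lieC a τ := by
    have h := lieForm_add (𝒜.rho a) τ.2 (-τ.2)
    have h0 := lieForm_add (𝒜.rho a) 0 0
    rw [add_zero] at h0
    rw [add_neg_cancel, left_eq_add.1 h0] at h
    exact Prod.ext (map_neg (𝒜.bracket a) τ.1) (eq_neg_of_add_eq_zero_right h.symm)
  ext x
  have h := hD.bracket_lin_lin a b (-Δ.omegaL a) (-Δ.omegaL b) (linIn_omega hΔ a)
    (linIn_omega hΔ b) u hu x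
  have h1 := linIn_omega hΔ (𝒜.bracket a b) u hu x
  have h2 := (D _).sub_mem h1 h
  rw [linElt_sub, hD.core_mem_iff] at h2
  have h3 := h2 _ (hv x)
  refine Eq.trans ?_ h3
  rw [← pairBC_apply]
  refine congrArg (fun τ => pairBC v τ x) ?_
  have hO (q : SecB I F A) (c : Cₛ^∞⟮I; F, A⟯) : (-Δ.omegaL c) q = -Δ.Omega q c := rfl
  have hO' (q q' : SecB I F A) (c : Cₛ^∞⟮I; F, A⟯) :
      Δ.Omega (q + q') c = Δ.Omega q c + Δ.Omega q' c := (Δ.omegaL c).map_add q q'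
  have hO'' (q : SecB I F A) (c : Cₛ^∞⟮I; F, A⟯) :
      Δ.Omega (-q) c = -Δ.Omega q c := (Δ.omegaL c).map_neg q
  simp only [hO, par_neg, hC, DorfmanConnection.curvBas, DorfmanConnection.nablaBas, hO', hO'']
  abel

end BasicConnection

section BracketOnSum

variable {E : Type*} [NormedAddCommGroup E] [NormedSpace ℝ E] [FiniteDimensional ℝ E]
  {H : Type*} [TopologicalSpace H] {I : ModelWithCorners ℝ E H}
  {M : Type*} [TopologicalSpace M] [ChartedSpace H M] [IsManifold I ∞ M] [T2Space M]
  {F : Type*} [NormedAddCommGroup F] [NormedSpace ℝ F] [FiniteDimensional ℝ F]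
  {A : M → Type*} [TopologicalSpace (TotalSpace F A)] [∀ x, AddCommGroup (A x)]
  [∀ x, Module ℝ (A x)] [∀ x, TopologicalSpace (A x)] [FiberBundle F A] [VectorBundle ℝ F A]
  [ContMDiffVectorBundle ∞ F A I]

section

variable {V : M → Type*} [TopologicalSpace (TotalSpace F V)] [∀ x, AddCommGroup (V x)]
  [∀ x, Module ℝ (V x)] [∀ x, TopologicalSpace (V x)] [FiberBundle F V] [VectorBundle ℝ F V]

theorem ev_add_left (α β : Cₛ^∞⟮I; F →L[ℝ] ℝ, fun x => V x →L[ℝ] ℝ⟯) (a : Cₛ^∞⟮I; F, V⟯) :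
    ev (α + β) a = ev α a + ev β a := rfl

theorem ev_diff_left (α β : Cₛ^∞⟮I; F →L[ℝ] ℝ, fun x => V x →L[ℝ] ℝ⟯) (a : Cₛ^∞⟮I; F, V⟯) :
    ev (α - β) a = ev α a - ev β a := rfl

theorem ev_zero_left (a : Cₛ^∞⟮I; F, V⟯) :
    ev (0 : Cₛ^∞⟮I; F →L[ℝ] ℝ, fun x => V x →L[ℝ] ℝ⟯) a = 0 := rfl

theorem ev_zero_right (α : Cₛ^∞⟮I; F →L[ℝ] ℝ, fun x => V x →L[ℝ] ℝ⟯) :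
    ev α (0 : Cₛ^∞⟮I; F, V⟯) = 0 := by ext x; exact map_zero (α x)

theorem ev_neg_right (α : Cₛ^∞⟮I; F →L[ℝ] ℝ, fun x => V x →L[ℝ] ℝ⟯) (a : Cₛ^∞⟮I; F, V⟯) :
    ev α (-a) = -ev α a := by ext x; exact map_neg (α x) (a x)

theorem ev_sub_right (α : Cₛ^∞⟮I; F →L[ℝ] ℝ, fun x => V x →L[ℝ] ℝ⟯) (a b : Cₛ^∞⟮I; F, V⟯) :
    ev α (a - b) = ev α a - ev α b := by ext x; exact map_sub (α x) (a x) (b x)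

end

theorem lieD_add_left (X Y : VF I M) (f : C^∞⟮I, M; ℝ⟯) :
    lieD (X + Y) f = lieD X f + lieD Y f := by
  ext x; exact map_add (mfderiv I 𝓘(ℝ, ℝ) f x) (X x) (Y x)

theorem lieD_zero_left (f : C^∞⟮I, M; ℝ⟯) : lieD (0 : VF I M) f = 0 := by
  ext x; exact map_zero (mfderiv I 𝓘(ℝ, ℝ) f x)

theorem lieD_zero (X : VF I M) : lieD X 0 = 0 := by
  have := lieD_add X 0 0
  rw [add_zero] at this
  exact left_eq_add.1 this

theorem vbracket_add_left (X Y Z : VF I M) :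
    vbracket (X + Y) Z = vbracket X Z + vbracket Y Z := by
  rw [vbracket_skew, vbracket_add_right, neg_add, ← vbracket_skew, ← vbracket_skew]

theorem vbracket_zero_left (X : VF I M) : vbracket 0 X = 0 := by
  rw [vbracket_skew, vbracket_zero_right, neg_zero]

namespace LieAlgebroid

variable (𝒜 : LieAlgebroid I F A)

theorem rho_add (a b : Cₛ^∞⟮I; F, A⟯) : 𝒜.rho (a + b) = 𝒜.rho a + 𝒜.rho b := by
  ext x; exact map_add (𝒜.anchor x) (a x) (b x)

theorem rho_sub (a b : Cₛ^∞⟮I; F, A⟯) : 𝒜.rho (a - b) = 𝒜.rho a - 𝒜.rho b := by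
  ext x; exact map_sub (𝒜.anchor x) (a x) (b x)

theorem rho_zero : 𝒜.rho 0 = 0 := by
  ext x; exact map_zero (𝒜.anchor x)

theorem rho_bracket (a b : Cₛ^∞⟮I; F, A⟯) :
    𝒜.rho (𝒜.bracket a b) = vbracket (𝒜.rho a) (𝒜.rho b) := 𝒜.anchor_bracket a b

theorem ev_lieDual (a b : Cₛ^∞⟮I; F, A⟯) (α : DualSec I F A) :
    ev (𝒜.lieDual a α) b = lieD (𝒜.rho a) (ev α b) - ev α (𝒜.bracket a b) := ev_dualDer _ _ _ _ _ _

end LieAlgebroid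

variable (𝒜 : LieAlgebroid I F A) (Δ : DorfmanConnection I F A)

/-- The anchor on sections of `TM ⊕ A* ⊕ A ⊕ T*M`. -/
def anchorW (w : SecB I F A × SecC I F A) : VF I M := w.1.1 + 𝒜.rho w.2.1

/-- The pairing on sections of `TM ⊕ A* ⊕ A ⊕ T*M`. -/
def pairW (v w : SecB I F A × SecC I F A) : C^∞⟮I, M; ℝ⟯ :=
  pairBC v.1 w.2 + pairBC w.1 v.2 + pairBC (𝒜.par w.2) v.2

/-- The bracket on sections of `TM ⊕ A* ⊕ A ⊕ T*M`. -/
def brW (v w : SecB I F A × SecC I F A) : SecB I F A × SecC I F A :=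
  (Δ.dull v.1 w.1 + Δ.nablaBas 𝒜 v.2.1 w.1 - Δ.nablaBas 𝒜 w.2.1 v.1,
    𝒜.brD v.2 w.2 + Δ.toFun v.1 w.2 - Δ.toFun w.1 v.2 + (0, dOne (pairBC w.1 v.2)))

theorem toFun_pair (q : SecB I F A) (τ : SecC I F A) :
    Δ.toFun q τ = (Δ.der q τ.1, Δ.formPart q τ.1 + lieForm q.1 τ.2) := by
  have h : τ = (τ.1, 0) + (0, τ.2) := by simp
  conv_lhs => rw [h, map_add, Δ.toFun_form, Δ.toFun_eq, Prod.mk_add_mk, add_zero]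

theorem pairW_eq (v w : SecB I F A × SecC I F A) : pairW 𝒜 v w =
    ev v.1.2 w.2.1 + ev w.1.2 v.2.1 + ev w.2.2 (anchorW 𝒜 v) + ev v.2.2 (anchorW 𝒜 w) := by
  rw [pairW, pairBC, pairBC, pairBC, LieAlgebroid.par, ev_rhoT, anchorW, anchorW, ev_add, ev_add]
  ring

theorem nablaBas_fst (a : Cₛ^∞⟮I; F, A⟯) (q : SecB I F A) :
    (Δ.nablaBas 𝒜 a q).1 = 𝒜.rho (Δ.der q a) + vbracket (𝒜.rho a) q.1 := by
  rw [DorfmanConnection.nablaBas, Δ.Omega_eq]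
  rfl

theorem ev_nablaBas (a b : Cₛ^∞⟮I; F, A⟯) (q : SecB I F A) :
    ev (Δ.nablaBas 𝒜 a q).2 b = ev (Δ.formPart q a) (𝒜.rho b) - lieD (𝒜.rho b) (ev q.2 a)
      + (lieD (𝒜.rho a) (ev q.2 b) - ev q.2 (𝒜.bracket a b)) := by
  rw [DorfmanConnection.nablaBas, Δ.Omega_eq, Prod.snd_add, ev_add_left, LieAlgebroid.par, ev_rhoT,
    ev_diff_left, ev_dOne, LieAlgebroid.lieB, 𝒜.ev_lieDual]

theorem brW_fst_fst (v w : SecB I F A × SecC I F A) : (brW 𝒜 Δ v w).1.1 =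
    vbracket v.1.1 w.1.1 + (𝒜.rho (Δ.der w.1 v.2.1) + vbracket (𝒜.rho v.2.1) w.1.1)
      - (𝒜.rho (Δ.der v.1 w.2.1) + vbracket (𝒜.rho w.2.1) v.1.1) := by
  rw [← nablaBas_fst, ← nablaBas_fst]
  rfl

theorem ev_brW_fst_snd (v w : SecB I F A × SecC I F A) (b : Cₛ^∞⟮I; F, A⟯) :
    ev (brW 𝒜 Δ v w).1.2 b = ev (Δ.dull v.1 w.1).2 b + ev (Δ.nablaBas 𝒜 v.2.1 w.1).2 b
      - ev (Δ.nablaBas 𝒜 w.2.1 v.1).2 b := rfl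

theorem brW_snd_fst (v w : SecB I F A × SecC I F A) : (brW 𝒜 Δ v w).2.1 =
    𝒜.bracket v.2.1 w.2.1 + Δ.der v.1 w.2.1 - Δ.der w.1 v.2.1 := by
  rw [brW, toFun_pair, toFun_pair]
  exact add_zero _

theorem ev_brW_snd_snd (v w : SecB I F A × SecC I F A) (Y : VF I M) :
    ev (brW 𝒜 Δ v w).2.2 Y = lieD (anchorW 𝒜 v) (ev w.2.2 Y) - ev w.2.2 (vbracket (anchorW 𝒜 v) Y)
      - (lieD (anchorW 𝒜 w) (ev v.2.2 Y) - ev v.2.2 (vbracket (anchorW 𝒜 w) Y))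
      + lieD Y (ev v.2.2 (anchorW 𝒜 w)) + ev (Δ.formPart v.1 w.2.1) Y - ev (Δ.formPart w.1 v.2.1) Y
      + lieD Y (ev w.1.2 v.2.1) := by
  have h : (brW 𝒜 Δ v w).2.2 = lieForm (𝒜.rho v.2.1) w.2.2 - (lieForm (𝒜.rho w.2.1) v.2.2
      - dOne (ev v.2.2 (𝒜.rho w.2.1))) + (Δ.formPart v.1 w.2.1 + lieForm v.1.1 w.2.2)
      - (Δ.formPart w.1 v.2.1 + lieForm w.1.1 v.2.2) + dOne (pairBC w.1 v.2) := by
    rw [brW, toFun_pair, toFun_pair]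
    rfl
  rw [h]
  simp only [ev_add_left, ev_diff_left, ev_lieForm, ev_dOne, anchorW, lieD_add_left,
    vbracket_add_left, ev_add, lieD_add, pairBC]
  ring

/-- The anchor is compatible with the brackets. -/
theorem anchorW_brW (v w : SecB I F A × SecC I F A) :
    anchorW 𝒜 (brW 𝒜 Δ v w) = vbracket (anchorW 𝒜 v) (anchorW 𝒜 w) := by
  rw [anchorW, brW_fst_fst, brW_snd_fst, 𝒜.rho_sub, 𝒜.rho_add, 𝒜.rho_bracket, anchorW, anchorW,
    vbracket_add_left, vbracket_add_right, vbracket_add_right, vbracket_skew (𝒜.rho w.2.1)]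
  abel

/-- The invariance of the pairing under the bracket. -/
theorem invariance_brW {v w z : SecB I F A × SecC I F A} (h : Δ.dull w.1 z.1 + Δ.dull z.1 w.1 = 0) :
    lieD (anchorW 𝒜 v) (pairW 𝒜 w z) = pairW 𝒜 (brW 𝒜 Δ v w) z + pairW 𝒜 w (brW 𝒜 Δ v z) := by
  have h1 : ev (Δ.dull w.1 z.1).2 v.2.1 + ev (Δ.dull z.1 w.1).2 v.2.1 = 0 :=
    congrArg (fun q : SecB I F A => ev q.2 v.2.1) h
  have h2 : ev v.1.2 (𝒜.bracket w.2.1 z.2.1) = -ev v.1.2 (𝒜.bracket z.2.1 w.2.1) := by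
    rw [𝒜.skew, ev_neg_right]
  have h3 : ev v.2.2 (vbracket (anchorW 𝒜 w) (anchorW 𝒜 z))
      = -ev v.2.2 (vbracket (anchorW 𝒜 z) (anchorW 𝒜 w)) := by
    rw [vbracket_skew, ev_neg_right]
  rw [pairW_eq, pairW_eq, pairW_eq, anchorW_brW, anchorW_brW, ev_brW_snd_snd, ev_brW_snd_snd,
    ev_brW_fst_snd, ev_brW_fst_snd, brW_snd_fst, brW_snd_fst, h3]
  simp only [Δ.ev_dull, ev_nablaBas, ev_sub_right, ev_add, lieD_add] at h1 ⊢
  have hc (f : C^∞⟮I, M; ℝ⟯) (y : SecB I F A × SecC I F A) :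
      lieD (anchorW 𝒜 y) f = lieD y.1.1 f + lieD (𝒜.rho y.2.1) f := lieD_add_left _ _ _
  have hf (q : SecB I F A) (a : Cₛ^∞⟮I; F, A⟯) (y : SecB I F A × SecC I F A) :
      ev (Δ.formPart q a) (anchorW 𝒜 y) = ev (Δ.formPart q a) y.1.1
        + ev (Δ.formPart q a) (𝒜.rho y.2.1) := ev_add _ _ _
  simp only [hc, hf]
  linear_combination -h1 - h2

/-- The symmetric part of the bracket. -/
theorem brW_add_brW {v w : SecB I F A × SecC I F A} (h : Δ.dull v.1 w.1 + Δ.dull w.1 v.1 = 0) :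
    brW 𝒜 Δ v w + brW 𝒜 Δ w v = (0, (0, dOne (pairW 𝒜 v w))) := by
  refine Prod.ext ?_ (Prod.ext ?_ (form_ext fun Y => ?_))
  · change Δ.dull v.1 w.1 + Δ.nablaBas 𝒜 v.2.1 w.1 - Δ.nablaBas 𝒜 w.2.1 v.1
      + (Δ.dull w.1 v.1 + Δ.nablaBas 𝒜 w.2.1 v.1 - Δ.nablaBas 𝒜 v.2.1 w.1) = 0
    rw [← h]; abel
  · change (brW 𝒜 Δ v w).2.1 + (brW 𝒜 Δ w v).2.1 = 0
    rw [brW_snd_fst, brW_snd_fst, 𝒜.skew]; abel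
  · change ev (brW 𝒜 Δ v w).2.2 Y + ev (brW 𝒜 Δ w v).2.2 Y = ev (dOne (pairW 𝒜 v w)) Y
    rw [ev_brW_snd_snd, ev_brW_snd_snd, ev_dOne, pairW_eq]
    simp only [lieD_add]
    ring

theorem brW_form (v : SecB I F A × SecC I F A) (θ : Form I M) :
    brW 𝒜 Δ v (0, (0, θ)) = (0, (0, lieForm (anchorW 𝒜 v) θ)) := by
  have hd (q : SecB I F A) : Δ.der q 0 = 0 := congrArg Prod.fst (map_zero (Δ.toFun q))
  have hd' (a : Cₛ^∞⟮I; F, A⟯) : Δ.der 0 a = 0 :=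
    congrArg (fun L => (L ((a, 0) : SecC I F A)).1) (map_zero Δ.toFun)
  have hf' (a : Cₛ^∞⟮I; F, A⟯) : Δ.formPart 0 a = 0 :=
    congrArg (fun L => (L ((a, 0) : SecC I F A)).2) (map_zero Δ.toFun)
  refine Prod.ext (secB_ext ?_ fun b => ?_) (Prod.ext ?_ (form_ext fun Y => ?_))
  · rw [brW_fst_fst]
    simp only [Prod.fst_zero, vbracket_zero_right, vbracket_zero_left, hd, hd', 𝒜.rho_zero,
      add_zero, sub_zero]
  · rw [ev_brW_fst_snd, Δ.ev_dull, ev_nablaBas, ev_nablaBas]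
    simp only [Prod.fst_zero, Prod.snd_zero, hf', map_zero, ev_zero_left, ev_zero_right,
      lieD_zero, 𝒜.rho_zero, lieD_zero_left, LinearMap.zero_apply]
    ring
  · rw [brW_snd_fst]
    simp only [map_zero, hd, hd']
    simp
  · rw [ev_brW_snd_snd, ev_lieForm]
    have ha : anchorW 𝒜 ((0, (0, θ)) : SecB I F A × SecC I F A) = 0 := by
      rw [anchorW, 𝒜.rho_zero]; exact add_zero _
    simp only [ha, Prod.snd_zero, hf', map_zero, ev_zero_left, ev_zero_right, lieD_zero,
      lieD_zero_left, vbracket_zero_left]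
    ring

theorem brW_side (u v : SecB I F A) : brW 𝒜 Δ (u, 0) (v, 0) = (Δ.dull u v, 0) := by
  have hd (q : SecB I F A) : Δ.der q 0 = 0 := congrArg Prod.fst (map_zero (Δ.toFun q))
  have ha (q : SecB I F A) : anchorW 𝒜 (q, (0 : SecC I F A)) = q.1 := by
    rw [anchorW]; exact (congrArg _ 𝒜.rho_zero).trans (add_zero _)
  refine Prod.ext (secB_ext ?_ fun b => ?_) (Prod.ext ?_ (form_ext fun Y => ?_))
  · rw [brW_fst_fst]
    simp only [Prod.fst_zero, vbracket_zero_left, hd, 𝒜.rho_zero,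
      add_zero, sub_zero]
    rfl
  · rw [ev_brW_fst_snd, ev_nablaBas, ev_nablaBas]
    simp only [Prod.fst_zero, map_zero, ev_zero_left, ev_zero_right,
      lieD_zero, 𝒜.rho_zero, lieD_zero_left, LinearMap.zero_apply]
    ring
  · rw [brW_snd_fst]
    simp only [Prod.fst_zero, map_zero, hd]
    simp
  · rw [ev_brW_snd_snd]
    simp only [ha, Prod.snd_zero, Prod.fst_zero, map_zero, ev_zero_left, ev_zero_right, lieD_zero]
    ring

theorem brW_linear (a : Cₛ^∞⟮I; F, A⟯) (w : SecB I F A × SecC I F A) :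
    brW 𝒜 Δ (0, (a, 0)) w = (Δ.nablaBas 𝒜 a w.1, 𝒜.lieC a w.2 - Δ.Omega w.1 a) := by
  have hd' (a : Cₛ^∞⟮I; F, A⟯) : Δ.der 0 a = 0 :=
    congrArg (fun L => (L ((a, 0) : SecC I F A)).1) (map_zero Δ.toFun)
  have hf' (a : Cₛ^∞⟮I; F, A⟯) : Δ.formPart 0 a = 0 :=
    congrArg (fun L => (L ((a, 0) : SecC I F A)).2) (map_zero Δ.toFun)
  have ha : anchorW 𝒜 ((0, (a, 0)) : SecB I F A × SecC I F A) = 𝒜.rho a := zero_add _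
  refine Prod.ext (secB_ext ?_ fun b => ?_) (Prod.ext ?_ (form_ext fun Y => ?_))
  · rw [brW_fst_fst, nablaBas_fst]
    simp only [Prod.fst_zero, vbracket_zero_right, vbracket_zero_left, hd', 𝒜.rho_zero,
      add_zero, sub_zero, zero_add]
  · rw [ev_brW_fst_snd, Δ.ev_dull, ev_nablaBas, ev_nablaBas]
    simp only [Prod.fst_zero, Prod.snd_zero, hf', hd', ev_zero_left, ev_zero_right,
      lieD_zero, lieD_zero_left]
    ring
  · rw [brW_snd_fst, Δ.Omega_eq]
    simp only [hd', add_zero]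
    rfl
  · change _ = ev (lieForm (𝒜.rho a) w.2.2 - (Δ.Omega w.1 a).2) Y
    rw [ev_brW_snd_snd, Δ.Omega_eq, ev_diff_left, ev_diff_left, ev_lieForm, ev_dOne]
    simp only [ha, hf', ev_zero_left, lieD_zero]
    ring

end BracketOnSum

section AbstractJacobi

variable {G R : Type*} [AddCommGroup G] [AddCommGroup R] {P : G →+ G →+ R} {br : G → G → G}
  {act : G →+ R →+ R} {d : R → G}

theorem nondegenerate_ext (hnd : ∀ a, (∀ b, P a b = 0) → a = 0) {a b : G}
    (h : ∀ c, P a c = P b c) : a = b :=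
  sub_eq_zero.1 (hnd _ fun c => by rw [map_sub, AddMonoidHom.sub_apply, h, sub_self])

theorem bracket_add_right (hnd : ∀ a, (∀ b, P a b = 0) → a = 0)
    (hinv : ∀ a b c, act a (P b c) = P (br a b) c + P b (br a c)) (a b c : G) :
    br a (b + c) = br a b + br a c :=
  nondegenerate_ext hnd fun e => by
    have h (x) : P (br a x) e = act a (P x e) - P x (br a e) := by rw [hinv]; abel
    rw [h, map_add P, AddMonoidHom.add_apply, AddMonoidHom.add_apply, map_add (act a), map_add P,
      AddMonoidHom.add_apply, h, h]
    abel

theorem diff_add (hnd : ∀ a, (∀ b, P a b = 0) → a = 0) (hd : ∀ f a, P (d f) a = act a f)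
    (f g : R) : d (f + g) = d f + d g :=
  nondegenerate_ext hnd fun e => by
    rw [map_add P, AddMonoidHom.add_apply, hd, hd, hd, map_add]

theorem bracket_add_left (hnd : ∀ a, (∀ b, P a b = 0) → a = 0)
    (hinv : ∀ a b c, act a (P b c) = P (br a b) c + P b (br a c))
    (hsym : ∀ a b, br a b + br b a = d (P a b)) (hd : ∀ f a, P (d f) a = act a f) (a b c : G) :
    br (a + b) c = br a c + br b c := by
  have h (x) : br x c = d (P x c) - br c x := by rw [← hsym]; abel
  rw [h, h a, h b, map_add P, AddMonoidHom.add_apply, diff_add hnd hd,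
    bracket_add_right hnd hinv]
  abel

theorem bracket_diff (hnd : ∀ a, (∀ b, P a b = 0) → a = 0)
    (hinv : ∀ a b c, act a (P b c) = P (br a b) c + P b (br a c))
    (hd : ∀ f a, P (d f) a = act a f)
    (hact : ∀ a b f, act (br a b) f = act a (act b f) - act b (act a f)) (a : G) (f : R) :
    br a (d f) = d (act a f) :=
  nondegenerate_ext hnd fun c => by
    have h := hinv a (d f) c
    rw [hd, hd, hact] at h
    rw [hd]
    rw [eq_sub_of_add_eq h.symm]; abel

/-- The Jacobiator of a bracket. -/
def jacobiator (br : G → G → G) (a b c : G) : G := br a (br b c) - br (br a b) c - br b (br a c)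

/-- The Jacobi identity of a Courant bracket can be checked on generators, since
`⟨J(a, b, c), e⟩` is skew-symmetric in all arguments. -/
theorem jacobiator_eq_zero (hP : ∀ a b, P a b = P b a) (hnd : ∀ a, (∀ b, P a b = 0) → a = 0)
    (hinv : ∀ a b c, act a (P b c) = P (br a b) c + P b (br a c))
    (hsym : ∀ a b, br a b + br b a = d (P a b)) (hd : ∀ f a, P (d f) a = act a f)
    (hact : ∀ a b f, act (br a b) f = act a (act b f) - act b (act a f))
    {S₁ S₂ S₃ : Set G} (hgen : ∀ g, ∃ u ∈ S₁, ∃ a ∈ S₂, ∃ t ∈ S₃, g = u + a + t)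
    (h3 : ∀ a b, ∀ t ∈ S₃, jacobiator br a b t = 0)
    (h1 : ∀ u ∈ S₁, ∀ v ∈ S₁, ∀ w ∈ S₁, jacobiator br u v w = 0)
    (h2 : ∀ a ∈ S₂, ∀ b ∈ S₂, ∀ c ∈ S₂, jacobiator br a b c = 0)
    (h12 : ∀ a ∈ S₂, ∀ b ∈ S₂, ∀ u ∈ S₁, ∀ v ∈ S₁, P (jacobiator br a b u) v = 0) (a b c : G) :
    jacobiator br a b c = 0 := by
  have hl := bracket_add_left hnd hinv hsym hd
  have hr := bracket_add_right hnd hinv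
  have hbd := bracket_diff hnd hinv hd hact
  have hda := diff_add hnd hd
  have hr0 (a) : br a 0 = 0 := by
    have := hr a 0 0
    rw [add_zero] at this
    exact left_eq_add.1 this
  have hl0 (a) : br 0 a = 0 := by
    have := hl 0 0 a
    rw [add_zero] at this
    exact left_eq_add.1 this
  have hdb (f c) : br (d f) c = 0 := by
    have := hsym (d f) c
    rw [hbd, hd] at this
    exact add_eq_right.1 this
  have J1 (a a' b c) : jacobiator br (a + a') b c = jacobiator br a b c + jacobiator br a' b c := by
    simp only [jacobiator, hl, hr]; abel
  have J2 (a b b' c) : jacobiator br a (b + b') c = jacobiator br a b c + jacobiator br a b' c := by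
    simp only [jacobiator, hl, hr]; abel
  have J3 (a b c c') : jacobiator br a b (c + c') = jacobiator br a b c + jacobiator br a b c' := by
    simp only [jacobiator, hr]; abel
  have s12 (a b c) : jacobiator br a b c = -jacobiator br b a c := by
    have h : br (br a b) c = -br (br b a) c := by
      rw [eq_neg_iff_add_eq_zero, ← hl, hsym, hdb]
    simp only [jacobiator, h]; abel
  have s23 (a b c) : jacobiator br a b c = -jacobiator br a c b := by
    have e1 : br a (br b c) = d (act a (P b c)) - br a (br c b) := by
      rw [← hbd, ← hsym, hr]; abel
    have e2 : br (br a b) c = d (P (br a b) c) - br c (br a b) := by rw [← hsym]; abel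
    have e3 : br (br a c) b = d (P b (br a c)) - br b (br a c) := by rw [← hsym]; abel
    rw [jacobiator, jacobiator, e1, e2, e3, hinv, hda]; abel
  have s34 (a b c e) : P (jacobiator br a b c) e = -P (jacobiator br a b e) c := by
    have e1 (a b c e) : P (br a (br b c)) e
        = act a (act b (P c e)) - act a (P c (br b e)) - P (br b c) (br a e) := by
      have h1 := hinv a (br b c) e
      have h2 := hinv b c e
      rw [h2, map_add, h1]; abel
    have e2 (a b c e) : P (br (br a b) c) e = act a (act b (P c e)) - act b (act a (P c e))
        - P c (br (br a b) e) := by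
      rw [← hact, hinv]; abel
    have e3 (a b c e) : act a (P c (br b e)) = P (br a c) (br b e) + P c (br a (br b e)) :=
      hinv _ _ _
    have hs (x y) : P (x - y) e = P x e - P y e := by rw [map_sub]; rfl
    rw [jacobiator, hs, hs, e1, e2, e1 b a, e3, e3, hP _ c, jacobiator, map_sub, map_sub]
    rw [hP (br a c), hP (br b c)]
    abel
  have k3 {a b c e} (hc : c ∈ S₃) : P (jacobiator br a b e) c = 0 := by
    rw [s34, h3 _ _ _ hc, map_zero, AddMonoidHom.zero_apply, neg_zero]
  have hext {x} (hu : ∀ u ∈ S₁, P x u = 0) (ha : ∀ a ∈ S₂, P x a = 0) (ht : ∀ t ∈ S₃, P x t = 0) :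
      x = 0 := hnd _ fun g => by
    obtain ⟨u, hu', a, ha', t, ht', rfl⟩ := hgen g
    rw [map_add, map_add, hu _ hu', ha _ ha', ht _ ht', add_zero, add_zero]
  have m2 {a b u} (ha : a ∈ S₂) (hb : b ∈ S₂) (hu : u ∈ S₁) : jacobiator br a b u = 0 :=
    hext (fun v hv => h12 a ha b hb u hu v hv)
      (fun c hc => by rw [s34, h2 a ha b hb c hc, map_zero, AddMonoidHom.zero_apply, neg_zero])
      (fun t ht => k3 ht)
  have m1 {u v a} (hu : u ∈ S₁) (hv : v ∈ S₁) (ha : a ∈ S₂) : jacobiator br u v a = 0 :=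
    hext (fun w hw => by
        rw [s34, h1 u hu v hv w hw, map_zero, AddMonoidHom.zero_apply, neg_zero])
      (fun b hb => by
        rw [s23, s12, neg_neg, s34, s23, m2 ha hb hu, neg_zero, map_zero, AddMonoidHom.zero_apply,
          neg_zero])
      (fun t ht => k3 ht)
  have g3 {a b c} (hu : ∀ u ∈ S₁, jacobiator br a b u = 0) (ha : ∀ e ∈ S₂, jacobiator br a b e = 0) :
      jacobiator br a b c = 0 := by
    obtain ⟨u, hu', e, he, t, ht, rfl⟩ := hgen c
    rw [J3, J3, hu u hu', ha e he, h3 _ _ t ht, add_zero, add_zero]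
  have t2 {a b c} (hb : b ∈ S₃) : jacobiator br a b c = 0 := by rw [s23, h3 _ _ _ hb, neg_zero]
  have t1 {a b c} (ha : a ∈ S₃) : jacobiator br a b c = 0 := by rw [s12, t2 ha, neg_zero]
  have n12 {u a c} (hu : u ∈ S₁) (ha : a ∈ S₂) : jacobiator br u a c = 0 :=
    g3 (fun v hv => by rw [s23, m1 hu hv ha, neg_zero])
      (fun b hb => by rw [s12, s23, m2 ha hb hu, neg_zero, neg_zero])
  obtain ⟨u, hu, a, ha, t, ht, rfl⟩ := hgen a
  obtain ⟨v, hv, b, hb, s, hs, rfl⟩ := hgen b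
  simp only [J1, J2, t1 ht, t2 hs, n12 hu hb, add_zero]
  rw [g3 (fun w hw => h1 u hu v hv w hw) (fun c hc => m1 hu hv hc),
    g3 (fun w hw => m2 ha hb hw) (fun c hc => h2 a ha b hb c hc), s12, n12 hv ha]
  simp

end AbstractJacobi

section QuotientPairing

variable {E : Type*} [NormedAddCommGroup E] [NormedSpace ℝ E] [FiniteDimensional ℝ E]
  {H : Type*} [TopologicalSpace H] {I : ModelWithCorners ℝ E H}
  {M : Type*} [TopologicalSpace M] [ChartedSpace H M] [IsManifold I ∞ M] [T2Space M]
  {F : Type*} [NormedAddCommGroup F] [NormedSpace ℝ F] [FiniteDimensional ℝ F]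
  {A : M → Type*} [TopologicalSpace (TotalSpace F A)] [∀ x, AddCommGroup (A x)]
  [∀ x, Module ℝ (A x)] [∀ x, TopologicalSpace (A x)] [FiberBundle F A] [VectorBundle ℝ F A]
  [ContMDiffVectorBundle ∞ F A I]
  (𝒜 : LieAlgebroid I F A) (U : ∀ x : M, Submodule ℝ (FibB I A x))

instance : AddCommGroup (secQ 𝒜 U) := Submodule.addCommGroup _

instance : Module ℝ (secQ 𝒜 U) := Submodule.module _

instance : SMul ℝ (secQ 𝒜 U) := Module.toDistribMulAction.toSMul

theorem pairFib_parFib_symm (x : M) (τ σ : FibC I A x) :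
    pairFib x (𝒜.parFib x τ) σ = pairFib x (𝒜.parFib x σ) τ := by
  change τ.2 (𝒜.anchor x σ.1) + σ.2 (𝒜.anchor x τ.1)
    = σ.2 (𝒜.anchor x τ.1) + τ.2 (𝒜.anchor x σ.1)
  exact add_comm _ _

/-- The pairing on `U ⊕ A ⊕ T*M`. -/
def prePair (x : M) : (U x × FibC I A x) →ₗ[ℝ] (U x × FibC I A x) →ₗ[ℝ] ℝ :=
  LinearMap.mk₂ ℝ (fun v w => pairFib x v.1 w.2 + pairFib x w.1 v.2
      + pairFib x (𝒜.parFib x w.2) v.2)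
    (fun v v' w => by
      simp only [Prod.fst_add, Prod.snd_add, Submodule.coe_add, pairFib_add_left,
        pairFib_add_right]
      ring)
    (fun c v w => by
      simp only [Prod.smul_fst, Prod.smul_snd, Submodule.coe_smul, pairFib_smul_left,
        pairFib_smul_right, smul_eq_mul]
      ring)
    (fun v w w' => by
      simp only [Prod.fst_add, Prod.snd_add, Submodule.coe_add, pairFib_add_left,
        pairFib_add_right, map_add]
      ring)
    (fun c v w => by
      simp only [Prod.smul_fst, Prod.smul_snd, Submodule.coe_smul, pairFib_smul_left,
        pairFib_smul_right, smul_eq_mul, map_smul]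
      ring)

theorem prePair_apply (x : M) (v w : U x × FibC I A x) : prePair 𝒜 U x v w =
    pairFib x v.1 w.2 + pairFib x w.1 v.2 + pairFib x (𝒜.parFib x w.2) v.2 := rfl

theorem prePair_symm (x : M) (v w : U x × FibC I A x) :
    prePair 𝒜 U x v w = prePair 𝒜 U x w v := by
  rw [prePair_apply, prePair_apply, pairFib_parFib_symm]; ring

theorem pairFib_neg_left {x : M} (q : FibB I A x) (τ : FibC I A x) :
    pairFib x (-q) τ = -pairFib x q τ := by
  rw [← neg_one_smul ℝ q, pairFib_smul_left, neg_one_mul]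

theorem prePair_graph (x : M) {v : U x × FibC I A x} (hv : v ∈ graphSub 𝒜 U x)
    (w : U x × FibC I A x) : prePair 𝒜 U x v w = 0 := by
  rw [prePair_apply, hv.2, hv.1 _ w.1.2, pairFib_parFib_symm 𝒜 x w.2, pairFib_neg_left]
  ring

/-- The pairing on the fibres of `C`. -/
def pairQ (x : M) : QFib 𝒜 U x →ₗ[ℝ] QFib 𝒜 U x →ₗ[ℝ] ℝ :=
  (graphSub 𝒜 U x).liftQ
    { toFun := fun v => (graphSub 𝒜 U x).liftQ (prePair 𝒜 U x v) fun w hw => by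
        rw [LinearMap.mem_ker, prePair_symm, prePair_graph 𝒜 U x hw]
      map_add' := fun v v' => Submodule.linearMap_qext _ (LinearMap.ext fun w => by
        simp only [LinearMap.comp_apply, Submodule.mkQ_apply, Submodule.liftQ_apply, map_add,
          LinearMap.add_apply])
      map_smul' := fun c v => Submodule.linearMap_qext _ (LinearMap.ext fun w => by
        simp only [LinearMap.comp_apply, Submodule.mkQ_apply, Submodule.liftQ_apply, map_smul,
          LinearMap.smul_apply, RingHom.id_apply]) }
    fun v hv => Submodule.linearMap_qext _ (LinearMap.ext fun w => prePair_graph 𝒜 U x hv w)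

theorem pairQ_mk (x : M) (v w : U x × FibC I A x) :
    pairQ 𝒜 U x (Submodule.Quotient.mk v) (Submodule.Quotient.mk w) = prePair 𝒜 U x v w := rfl

theorem pairQ_symm (x : M) (v w : QFib 𝒜 U x) : pairQ 𝒜 U x v w = pairQ 𝒜 U x w v := by
  obtain ⟨v, rfl⟩ := Submodule.Quotient.mk_surjective _ v
  obtain ⟨w, rfl⟩ := Submodule.Quotient.mk_surjective _ w
  rw [pairQ_mk, pairQ_mk, prePair_symm]

theorem pairQ_nondegenerate (x : M) (v : QFib 𝒜 U x) (h : ∀ w, pairQ 𝒜 U x v w = 0) : v = 0 := by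
  obtain ⟨⟨u, τ⟩, rfl⟩ := Submodule.Quotient.mk_surjective _ v
  refine (Submodule.Quotient.mk_eq_zero _).2 ⟨fun u' hu' => ?_, ?_⟩
  · have h1 := h (Submodule.Quotient.mk (⟨u', hu'⟩, 0))
    rw [pairQ_mk, prePair_apply] at h1
    have h2 : pairFib x (u : FibB I A x) 0 = 0 := (pairL I A x u).map_zero
    have h3 : pairFib x (𝒜.parFib x 0) τ = 0 := by
      rw [map_zero]
      exact LinearMap.congr_fun (pairL I A x).map_zero τ
    rwa [h2, h3, zero_add, add_zero] at h1
  · refine eq_neg_of_add_eq_zero_left (pairFib_eq_zero_left fun σ => ?_)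
    have h1 := h (Submodule.Quotient.mk (0, σ))
    rw [pairQ_mk, prePair_apply] at h1
    have h2 : pairFib x ((0 : U x) : FibB I A x) τ = 0 :=
      LinearMap.congr_fun (pairL I A x).map_zero τ
    rw [h2, add_zero, pairFib_parFib_symm] at h1
    rw [pairFib_add_left]
    exact h1

/-- The anchor on the fibres of `C`. -/
def anchorQ (x : M) : QFib 𝒜 U x →ₗ[ℝ] TangentSpace I x :=
  (graphSub 𝒜 U x).liftQ
    { toFun := fun v => (v.1 : FibB I A x).1 + 𝒜.anchor x v.2.1
      map_add' := fun v w => by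
        rw [Prod.fst_add, Prod.snd_add, Prod.fst_add, map_add, Submodule.coe_add, Prod.fst_add]
        abel
      map_smul' := fun c v => by
        rw [Prod.smul_fst, Prod.smul_snd, Prod.smul_fst, map_smul, Submodule.coe_smul,
          Prod.smul_fst, smul_add, RingHom.id_apply] }
    fun v hv => by
      change (v.1 : FibB I A x).1 + 𝒜.anchor x v.2.1 = 0
      rw [hv.2]
      exact neg_add_cancel _

theorem anchorQ_mk (x : M) (v : U x × FibC I A x) :
    anchorQ 𝒜 U x (Submodule.Quotient.mk v) = (v.1 : FibB I A x).1 + 𝒜.anchor x v.2.1 := rfl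

theorem val_par (τ : SecC I F A) (x : M) : val (𝒜.par τ) x = 𝒜.parFib x (val τ x) := by
  refine Prod.ext rfl ?_
  ext v
  obtain ⟨b, rfl⟩ := exists_section_eq (F := F) I v
  exact dualSection_apply _ b x

/-- The section of `C` given by a section of `U ⊕ A ⊕ T*M`. -/
def clsW (w : secU (F := F) U × SecC I F A) : secQ 𝒜 U := cls 𝒜 U w.1 w.2

theorem clsW_surjective : Function.Surjective (clsW 𝒜 U) := by
  rintro ⟨_, w, rfl⟩; exact ⟨w, rfl⟩

variable {U} in
/-- A section of `U ⊕ A ⊕ T*M` as a section of `TM ⊕ A* ⊕ A ⊕ T*M`. -/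
abbrev inc (w : secU (F := F) U × SecC I F A) : SecB I F A × SecC I F A :=
  ((w.1 : SecB I F A), w.2)

theorem pairQ_clsW (v w : secU (F := F) U × SecC I F A) (x : M) :
    pairQ 𝒜 U x ((clsW 𝒜 U v).1 x) ((clsW 𝒜 U w).1 x) = pairW 𝒜 (inc v) (inc w) x := by
  refine (pairQ_mk 𝒜 U x _ _).trans ?_
  rw [prePair_apply]
  exact congrArg (fun q => pairFib x (val (v.1 : SecB I F A) x) (val w.2 x)
    + pairFib x (val (w.1 : SecB I F A) x) (val v.2 x) + pairFib x q (val v.2 x))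
    (val_par 𝒜 w.2 x).symm

/-- The pairing of sections of `C`. -/
def pairS : secQ 𝒜 U →+ secQ 𝒜 U →+ C^∞⟮I, M; ℝ⟯ :=
  AddMonoidHom.mk' (fun s => AddMonoidHom.mk' (fun t =>
    ⟨fun x => pairQ 𝒜 U x (s.1 x) (t.1 x), by
      obtain ⟨v, rfl⟩ := clsW_surjective 𝒜 U s
      obtain ⟨w, rfl⟩ := clsW_surjective 𝒜 U t
      simp only [pairQ_clsW]
      exact (pairW 𝒜 (inc v) (inc w)).contMDiff⟩)
    fun t t' => by ext x; exact map_add (pairQ 𝒜 U x (s.1 x)) (t.1 x) (t'.1 x))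
    fun s s' => by ext t x; exact LinearMap.map_add₂ (pairQ 𝒜 U x) (s.1 x) (s'.1 x) (t.1 x)

theorem pairS_clsW (v w : secU (F := F) U × SecC I F A) :
    pairS 𝒜 U (clsW 𝒜 U v) (clsW 𝒜 U w) = pairW 𝒜 (inc v) (inc w) := by
  ext x; exact pairQ_clsW 𝒜 U v w x

theorem pairS_symm (s t : secQ 𝒜 U) : pairS 𝒜 U s t = pairS 𝒜 U t s := by
  ext x; exact pairQ_symm 𝒜 U x _ _

/-- The anchor of a section of `C`. -/
def anchorS (s : secQ 𝒜 U) : VF I M :=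
  ⟨fun x => anchorQ 𝒜 U x (s.1 x), by
    obtain ⟨w, rfl⟩ := clsW_surjective 𝒜 U s
    exact (anchorW 𝒜 (inc w)).contMDiff⟩

/-- The action of sections of `C` on functions. -/
def actS : secQ 𝒜 U →+ C^∞⟮I, M; ℝ⟯ →+ C^∞⟮I, M; ℝ⟯ :=
  AddMonoidHom.mk' (fun s => AddMonoidHom.mk' (lieD (anchorS 𝒜 U s)) (lieD_add _)) fun s t => by
    have h : anchorS 𝒜 U (s + t) = anchorS 𝒜 U s + anchorS 𝒜 U t := by
      ext x; exact map_add (anchorQ 𝒜 U x) (s.1 x) (t.1 x)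
    ext f : 1
    exact (congrArg (fun X => lieD X f) h).trans (lieD_add_left _ _ _)

/-- The map `𝒟`. -/
def diffS (f : C^∞⟮I, M; ℝ⟯) : secQ 𝒜 U := cls 𝒜 U 0 (0, dOne f)

theorem dOne_apply (f : C^∞⟮I, M; ℝ⟯) (x : M) (v : TangentSpace I x) :
    dOne f x v = mfderiv I 𝓘(ℝ, ℝ) f x v := by
  obtain ⟨Y, rfl⟩ := exists_section_eq (F := E) I v
  exact congrArg (fun g => g x) (ev_dOne f Y)

theorem pairQ_diffS (f : C^∞⟮I, M; ℝ⟯) (x : M) (v : QFib 𝒜 U x) :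
    pairQ 𝒜 U x ((diffS 𝒜 U f).1 x) v = mfderiv I 𝓘(ℝ, ℝ) f x (anchorQ 𝒜 U x v) := by
  obtain ⟨⟨u, τ⟩, rfl⟩ := Submodule.Quotient.mk_surjective _ v
  refine (pairQ_mk 𝒜 U x (0, (0, dOne f x)) (u, τ)).trans ?_
  rw [prePair_apply, anchorQ_mk, map_add, ← dOne_apply, ← dOne_apply]
  have h2 : pairFib x ((0 : U x) : FibB I A x) τ = 0 :=
    LinearMap.congr_fun (pairL I A x).map_zero τ
  have h3 (q : FibB I A x) : pairFib x q (0, dOne f x) = dOne f x q.1 := by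
    rw [pairFib]
    exact (congrArg (· + _) (map_zero q.2)).trans (zero_add _)
  rw [h2, zero_add, h3, h3]
  rfl

theorem pairS_diffS (f : C^∞⟮I, M; ℝ⟯) (s : secQ 𝒜 U) :
    pairS 𝒜 U (diffS 𝒜 U f) s = actS 𝒜 U s f := by
  ext x; exact pairQ_diffS 𝒜 U f x _

variable {U} in
theorem pairS_nondegenerate (hU : IsSubbundle (F₁ := E) (F₂ := F →L[ℝ] ℝ) I U) (s : secQ 𝒜 U)
    (h : ∀ t, pairS 𝒜 U s t = 0) : s = 0 := by
  refine Subtype.ext (funext fun x => pairQ_nondegenerate 𝒜 U x _ fun w => ?_)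
  obtain ⟨⟨u, τ⟩, rfl⟩ := Submodule.Quotient.mk_surjective _ w
  obtain ⟨u', hu', h1⟩ := exists_secU_eq hU u.2
  obtain ⟨τ', h2⟩ := exists_secC_eq (F := F) τ
  have h3 : (clsW 𝒜 U (⟨u', hu'⟩, τ')).1 x = Submodule.Quotient.mk (u, τ) :=
    congrArg Submodule.Quotient.mk (Prod.ext (Subtype.ext h1) h2)
  rw [← h3]
  exact congrArg (fun g => g x) (h (clsW 𝒜 U (⟨u', hu'⟩, τ')))

end QuotientPairing

section QuotientBracket

variable {E : Type*} [NormedAddCommGroup E] [NormedSpace ℝ E] [FiniteDimensional ℝ E]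
  {H : Type*} [TopologicalSpace H] {I : ModelWithCorners ℝ E H}
  {M : Type*} [TopologicalSpace M] [ChartedSpace H M] [IsManifold I ∞ M] [T2Space M]
  {F : Type*} [NormedAddCommGroup F] [NormedSpace ℝ F] [FiniteDimensional ℝ F]
  {A : M → Type*} [TopologicalSpace (TotalSpace F A)] [∀ x, AddCommGroup (A x)]
  [∀ x, Module ℝ (A x)] [∀ x, TopologicalSpace (A x)] [FiberBundle F A] [VectorBundle ℝ F A]
  [ContMDiffVectorBundle ∞ F A I]
  {𝒜 : LieAlgebroid I F A} {D : ∀ p : TotalSpace F A, Submodule ℝ (Pont I p)}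
  {U : ∀ x : M, Submodule ℝ (FibB I A x)} {Δ : DorfmanConnection I F A}

theorem lieForm_vbracket (X Y : VF I M) (θ : Form I M) :
    lieForm (vbracket X Y) θ = lieForm X (lieForm Y θ) - lieForm Y (lieForm X θ) :=
  form_ext fun Z => by
    simp only [ev_diff_left, ev_lieForm, lieD_sub, lieD_vbracket, vbracket_jacobi X Y Z, ev_add]
    abel

theorem brW_fst_mem (hD : IsLADirac 𝒜 D U) (hΔ : IsAdapted Δ D U)
    (v w : secU (F := F) U × SecC I F A) : (brW 𝒜 Δ (inc v) (inc w)).1 ∈ secU (F := F) U :=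
  Submodule.sub_mem _ (Submodule.add_mem _ (dull_mem hD hΔ v.1.2 w.1.2)
    (nablaBas_mem hD hΔ _ w.1.2)) (nablaBas_mem hD hΔ _ v.1.2)

/-- The bracket on `Γ(U) × Γ(A ⊕ T*M)`. -/
def brR (hD : IsLADirac 𝒜 D U) (hΔ : IsAdapted Δ D U) (v w : secU (F := F) U × SecC I F A) :
    secU (F := F) U × SecC I F A :=
  (⟨(brW 𝒜 Δ (inc v) (inc w)).1, brW_fst_mem hD hΔ v w⟩, (brW 𝒜 Δ (inc v) (inc w)).2)

theorem inc_brR (hD : IsLADirac 𝒜 D U) (hΔ : IsAdapted Δ D U)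
    (v w : secU (F := F) U × SecC I F A) :
    inc (brR hD hΔ v w) = brW 𝒜 Δ (inc v) (inc w) := rfl

theorem inc_injective {v w : secU (F := F) U × SecC I F A} (h : inc v = inc w) : v = w :=
  Prod.ext (Subtype.ext (congrArg Prod.fst h)) (congrArg (fun z : SecB I F A × SecC I F A => z.2) h)

/-- The bracket of sections of `C`. -/
def brS (hD : IsLADirac 𝒜 D U) (hΔ : IsAdapted Δ D U) (s t : secQ 𝒜 U) : secQ 𝒜 U :=
  clsW 𝒜 U (brR hD hΔ (clsW_surjective 𝒜 U s).choose (clsW_surjective 𝒜 U t).choose)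

theorem pairS_brR (hD : IsLADirac 𝒜 D U) (hΔ : IsAdapted Δ D U)
    (v w z : secU (F := F) U × SecC I F A) :
    pairS 𝒜 U (clsW 𝒜 U (brR hD hΔ v w)) (clsW 𝒜 U z)
      = actS 𝒜 U (clsW 𝒜 U v) (pairS 𝒜 U (clsW 𝒜 U w) (clsW 𝒜 U z))
        - pairS 𝒜 U (clsW 𝒜 U w) (clsW 𝒜 U (brR hD hΔ v z)) := by
  simp only [pairS_clsW, inc_brR]
  exact eq_sub_of_add_eq (invariance_brW 𝒜 Δ (dull_add_dull hD hΔ w.1.2 z.1.2)).symm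

theorem clsW_brR_add (hD : IsLADirac 𝒜 D U) (hΔ : IsAdapted Δ D U)
    (v w : secU (F := F) U × SecC I F A) :
    clsW 𝒜 U (brR hD hΔ v w) + clsW 𝒜 U (brR hD hΔ w v)
      = diffS 𝒜 U (pairS 𝒜 U (clsW 𝒜 U v) (clsW 𝒜 U w)) := by
  rw [pairS_clsW]
  have h : brR hD hΔ v w + brR hD hΔ w v
      = (0, (0, dOne (pairW 𝒜 (inc v) (inc w)))) :=
    inc_injective (brW_add_brW 𝒜 Δ (dull_add_dull hD hΔ v.1.2 w.1.2))
  exact congrArg (clsW 𝒜 U) h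

theorem clsW_brR_right (hD : IsLADirac 𝒜 D U) (hΔ : IsAdapted Δ D U)
    {v w w' : secU (F := F) U × SecC I F A} (h : clsW 𝒜 U w = clsW 𝒜 U w') :
    clsW 𝒜 U (brR hD hΔ v w) = clsW 𝒜 U (brR hD hΔ v w') :=
  nondegenerate_ext (pairS_nondegenerate 𝒜 hD.subbundle) fun s => by
    obtain ⟨z, rfl⟩ := clsW_surjective 𝒜 U s
    rw [pairS_brR, pairS_brR, h]

theorem clsW_brR_left (hD : IsLADirac 𝒜 D U) (hΔ : IsAdapted Δ D U)
    {v v' w : secU (F := F) U × SecC I F A} (h : clsW 𝒜 U v = clsW 𝒜 U v') :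
    clsW 𝒜 U (brR hD hΔ v w) = clsW 𝒜 U (brR hD hΔ v' w) := by
  rw [eq_sub_of_add_eq (clsW_brR_add hD hΔ v w), eq_sub_of_add_eq (clsW_brR_add hD hΔ v' w), h,
    clsW_brR_right hD hΔ h]

theorem brS_clsW (hD : IsLADirac 𝒜 D U) (hΔ : IsAdapted Δ D U)
    (v w : secU (F := F) U × SecC I F A) :
    brS hD hΔ (clsW 𝒜 U v) (clsW 𝒜 U w) = clsW 𝒜 U (brR hD hΔ v w) :=
  (clsW_brR_left hD hΔ (clsW_surjective 𝒜 U (clsW 𝒜 U v)).choose_spec).trans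
    (clsW_brR_right hD hΔ (clsW_surjective 𝒜 U (clsW 𝒜 U w)).choose_spec)

theorem actS_pairS (hD : IsLADirac 𝒜 D U) (hΔ : IsAdapted Δ D U) (s t r : secQ 𝒜 U) :
    actS 𝒜 U s (pairS 𝒜 U t r)
      = pairS 𝒜 U (brS hD hΔ s t) r + pairS 𝒜 U t (brS hD hΔ s r) := by
  obtain ⟨v, rfl⟩ := clsW_surjective 𝒜 U s
  obtain ⟨w, rfl⟩ := clsW_surjective 𝒜 U t
  obtain ⟨z, rfl⟩ := clsW_surjective 𝒜 U r
  have h := (sub_eq_iff_eq_add.1 (pairS_brR hD hΔ v w z).symm)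
  exact h.trans (congrArg₂ (fun x y => pairS 𝒜 U x (clsW 𝒜 U z) + pairS 𝒜 U (clsW 𝒜 U w) y)
    (brS_clsW hD hΔ v w).symm (brS_clsW hD hΔ v z).symm)

theorem brS_add_brS (hD : IsLADirac 𝒜 D U) (hΔ : IsAdapted Δ D U) (s t : secQ 𝒜 U) :
    brS hD hΔ s t + brS hD hΔ t s = diffS 𝒜 U (pairS 𝒜 U s t) := by
  obtain ⟨v, rfl⟩ := clsW_surjective 𝒜 U s
  obtain ⟨w, rfl⟩ := clsW_surjective 𝒜 U t
  rw [brS_clsW, brS_clsW, clsW_brR_add]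

theorem actS_brS (hD : IsLADirac 𝒜 D U) (hΔ : IsAdapted Δ D U) (s t : secQ 𝒜 U)
    (f : C^∞⟮I, M; ℝ⟯) : actS 𝒜 U (brS hD hΔ s t) f
      = actS 𝒜 U s (actS 𝒜 U t f) - actS 𝒜 U t (actS 𝒜 U s f) := by
  obtain ⟨v, rfl⟩ := clsW_surjective 𝒜 U s
  obtain ⟨w, rfl⟩ := clsW_surjective 𝒜 U t
  rw [brS_clsW]
  change lieD (anchorW 𝒜 (brW 𝒜 Δ (inc v) (inc w))) f = _
  rw [anchorW_brW, lieD_vbracket]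
  rfl

theorem jacobiator_brS (hD : IsLADirac 𝒜 D U) (hΔ : IsAdapted Δ D U)
    (v w z : secU (F := F) U × SecC I F A) :
    jacobiator (brS hD hΔ) (clsW 𝒜 U v) (clsW 𝒜 U w) (clsW 𝒜 U z)
      = clsW 𝒜 U (jacobiator (brR hD hΔ) v w z) := by
  rw [jacobiator]
  simp only [brS_clsW]
  rfl

theorem inc_jacobiator (hD : IsLADirac 𝒜 D U) (hΔ : IsAdapted Δ D U)
    (v w z : secU (F := F) U × SecC I F A) :
    inc (jacobiator (brR hD hΔ) v w z) = jacobiator (brW 𝒜 Δ) (inc v) (inc w) (inc z) := rfl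

theorem jacobiator_brW_form (v w : SecB I F A × SecC I F A) (θ : Form I M) :
    jacobiator (brW 𝒜 Δ) v w (0, (0, θ)) = 0 := by
  rw [jacobiator, brW_form, brW_form, brW_form, brW_form, brW_form, anchorW_brW, lieForm_vbracket]
  refine Prod.ext (by simp) (Prod.ext (by simp) ?_)
  change lieForm _ (lieForm _ θ) - (lieForm _ (lieForm _ θ) - lieForm _ (lieForm _ θ))
    - lieForm _ (lieForm _ θ) = 0
  abel

theorem jacobiator_brW_side (hD : IsLADirac 𝒜 D U) (hΔ : IsAdapted Δ D U) {u v w : SecB I F A}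
    (hu : u ∈ secU (F := F) U) (hv : v ∈ secU (F := F) U) (hw : w ∈ secU (F := F) U) :
    jacobiator (brW 𝒜 Δ) (u, 0) (v, 0) (w, 0) = 0 := by
  rw [jacobiator, brW_side, brW_side, brW_side, brW_side, brW_side, brW_side,
    dull_jacobi hD hΔ hu hv hw]
  exact Prod.ext (by simp) (by simp)

theorem lieForm_zero (X : VF I M) : lieForm X 0 = 0 := by
  have h0 := lieForm_add X 0 0
  rw [add_zero] at h0
  exact left_eq_add.1 h0

theorem brW_linear_linear (a b : Cₛ^∞⟮I; F, A⟯) :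
    brW 𝒜 Δ (0, (a, 0)) (0, (b, 0)) = (0, (𝒜.bracket a b, 0)) := by
  have hO : Δ.Omega 0 a = 0 := (Δ.omegaL a).map_zero
  have hL : 𝒜.lieB a 0 = 0 := secB_ext (vbracket_zero_right _) fun b => by
    rw [LieAlgebroid.lieB, 𝒜.ev_lieDual]
    exact (congrArg₂ (· - ·) (lieD_zero _) rfl).trans (sub_zero 0)
  have hp : 𝒜.par 0 = 0 := secB_ext 𝒜.rho_zero fun b => by
    rw [LieAlgebroid.par, ev_rhoT]; rfl
  rw [brW_linear]
  dsimp only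
  rw [DorfmanConnection.nablaBas, hO, hL, hp, add_zero, sub_zero, LieAlgebroid.lieC, lieForm_zero]

theorem jacobiator_brW_linear (a b c : Cₛ^∞⟮I; F, A⟯) :
    jacobiator (brW 𝒜 Δ) (0, (a, 0)) (0, (b, 0)) (0, (c, 0)) = 0 := by
  simp only [jacobiator, brW_linear_linear]
  refine Prod.ext (by simp) (Prod.ext ?_ (by simp))
  change 𝒜.bracket a (𝒜.bracket b c) - 𝒜.bracket (𝒜.bracket a b) c - 𝒜.bracket b (𝒜.bracket a c) = 0
  rw [𝒜.jacobi a b c]; abel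

theorem jacobiator_brW_linear_side (a b : Cₛ^∞⟮I; F, A⟯) (u : SecB I F A) :
    (jacobiator (brW 𝒜 Δ) (0, (a, 0)) (0, (b, 0)) (u, 0)).2 = -Δ.curvBas 𝒜 a b u := by
  have hz (a : Cₛ^∞⟮I; F, A⟯) : 𝒜.lieC a 0 = 0 :=
    Prod.ext (map_zero (𝒜.bracket a)) (lieForm_zero _)
  have hC (a : Cₛ^∞⟮I; F, A⟯) (τ : SecC I F A) : 𝒜.lieC a (-τ) = -𝒜.lieC a τ := by
    have h := lieForm_add (𝒜.rho a) τ.2 (-τ.2)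
    rw [add_neg_cancel, lieForm_zero] at h
    exact Prod.ext (map_neg (𝒜.bracket a) τ.1) (eq_neg_of_add_eq_zero_right h.symm)
  rw [jacobiator, brW_linear_linear]
  simp only [brW_linear, hz, zero_sub, hC]
  rw [DorfmanConnection.curvBas]
  change (-𝒜.lieC a (Δ.Omega u b) - Δ.Omega (Δ.nablaBas 𝒜 b u) a) - (-Δ.Omega u (𝒜.bracket a b))
    - (-𝒜.lieC b (Δ.Omega u a) - Δ.Omega (Δ.nablaBas 𝒜 a u) b) = _
  abel

theorem jacobiator_brS_eq_zero (hD : IsLADirac 𝒜 D U) (hΔ : IsAdapted Δ D U) (s t r : secQ 𝒜 U) :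
    jacobiator (brS hD hΔ) s t r = 0 := by
  have hc0 : clsW 𝒜 U 0 = 0 := rfl
  refine jacobiator_eq_zero (P := pairS 𝒜 U) (act := actS 𝒜 U) (d := diffS 𝒜 U)
    (S₁ := Set.range fun u => clsW 𝒜 U (u, 0)) (S₂ := Set.range fun a => clsW 𝒜 U (0, (a, 0)))
    (S₃ := Set.range fun θ => clsW 𝒜 U (0, (0, θ)))
    (pairS_symm 𝒜 U) (pairS_nondegenerate 𝒜 hD.subbundle) (actS_pairS hD hΔ) (brS_add_brS hD hΔ)
    (pairS_diffS 𝒜 U) (actS_brS hD hΔ) ?_ ?_ ?_ ?_ ?_ s t r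
  · intro g
    obtain ⟨⟨u, a, θ⟩, rfl⟩ := clsW_surjective 𝒜 U g
    refine ⟨_, ⟨u, rfl⟩, _, ⟨a, rfl⟩, _, ⟨θ, rfl⟩, ?_⟩
    refine Eq.trans (b := clsW 𝒜 U ((u, 0) + (0, (a, 0)) + (0, (0, θ)))) ?_ rfl
    simp
  · rintro a b _ ⟨θ, rfl⟩
    obtain ⟨v, rfl⟩ := clsW_surjective 𝒜 U a
    obtain ⟨w, rfl⟩ := clsW_surjective 𝒜 U b
    refine (jacobiator_brS hD hΔ _ _ _).trans ((congrArg (clsW 𝒜 U) ?_).trans hc0)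
    exact inc_injective (jacobiator_brW_form _ _ θ)
  · rintro _ ⟨u, rfl⟩ _ ⟨v, rfl⟩ _ ⟨w, rfl⟩
    refine (jacobiator_brS hD hΔ _ _ _).trans ((congrArg (clsW 𝒜 U) ?_).trans hc0)
    exact inc_injective (jacobiator_brW_side hD hΔ u.2 v.2 w.2)
  · rintro _ ⟨a, rfl⟩ _ ⟨b, rfl⟩ _ ⟨c, rfl⟩
    refine (jacobiator_brS hD hΔ _ _ _).trans ((congrArg (clsW 𝒜 U) ?_).trans hc0)
    exact inc_injective (jacobiator_brW_linear a b c)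
  · rintro _ ⟨a, rfl⟩ _ ⟨b, rfl⟩ _ ⟨u, rfl⟩ _ ⟨v, rfl⟩
    refine (congrArg (fun s => pairS 𝒜 U s _) (jacobiator_brS hD hΔ _ _ _)).trans
      ((pairS_clsW 𝒜 U _ _).trans ?_)
    have h := jacobiator_brW_linear_side (𝒜 := 𝒜) (Δ := Δ) a b u
    have h1 := pairBC_curvBas hD hΔ a b u.2 v.2
    rw [inc_jacobiator, pairW_eq]
    have h2 (w : SecB I F A × SecC I F A) :
      ev w.1.2 0 + ev (v : SecB I F A).2 w.2.1 + ev 0 (anchorW 𝒜 w)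
        + ev w.2.2 (anchorW 𝒜 ((v : SecB I F A), (0 : SecC I F A))) = pairBC v w.2 := by
      rw [ev_zero_right, ev_zero_left, anchorW, pairBC]
      have : (v : SecB I F A).1 + 𝒜.rho 0 = (v : SecB I F A).1 := by rw [𝒜.rho_zero, add_zero]
      exact (by rw [zero_add, add_zero]; exact congrArg (fun X => _ + ev w.2.2 X) this)
    refine (h2 _).trans ?_
    refine (congrArg (pairBC (v : SecB I F A)) h).trans ?_
    have h3 := pairBC_add (v : SecB I F A) (Δ.curvBas 𝒜 a b u) (-Δ.curvBas 𝒜 a b u)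
    rw [add_neg_cancel, h1, zero_add] at h3
    rw [← h3]
    exact (congrArg₂ (· + ·) (ev_zero_right _) (ev_zero_left _)).trans (add_zero 0)

theorem pairS_smul_left (c : ℝ) (s t : secQ 𝒜 U) :
    pairS 𝒜 U (c • s) t = c • pairS 𝒜 U s t := by
  ext x; exact LinearMap.map_smul₂ (pairQ 𝒜 U x) c (s.1 x) (t.1 x)

theorem lieD_smul (X : VF I M) (c : ℝ) (f : C^∞⟮I, M; ℝ⟯) : lieD X (c • f) = c • lieD X f := by
  ext x
  have hf := f.contMDiff.mdifferentiable (by simp) x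
  change mfderiv I 𝓘(ℝ, ℝ) (c • ⇑f) x (X x) = _
  rw [const_smul_mfderiv hf]
  rfl

theorem brS_smul_right (hD : IsLADirac 𝒜 D U) (hΔ : IsAdapted Δ D U) (c : ℝ) (s t : secQ 𝒜 U) :
    brS hD hΔ s (c • t) = c • brS hD hΔ s t :=
  nondegenerate_ext (pairS_nondegenerate 𝒜 hD.subbundle) fun r => by
    have h (t) : pairS 𝒜 U (brS hD hΔ s t) r
        = actS 𝒜 U s (pairS 𝒜 U t r) - pairS 𝒜 U t (brS hD hΔ s r) := by
      exact eq_sub_of_add_eq (actS_pairS hD hΔ s t r).symm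
    have h' : actS 𝒜 U s (pairS 𝒜 U (c • t) r) - pairS 𝒜 U (c • t) (brS hD hΔ s r)
        = c • (actS 𝒜 U s (pairS 𝒜 U t r) - pairS 𝒜 U t (brS hD hΔ s r)) :=
      (congrArg₂ (fun x y => actS 𝒜 U s x - y) (pairS_smul_left c t r)
        (pairS_smul_left c t (brS hD hΔ s r))).trans
        ((congrArg (· - _) (lieD_smul _ c _)).trans (smul_sub c _ _).symm)
    exact (h (c • t)).trans (h'.trans ((congrArg (c • ·) (h t).symm).trans
      (pairS_smul_left c (brS hD hΔ s t) r).symm))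

theorem diffS_smul (hU : IsSubbundle (F₁ := E) (F₂ := F →L[ℝ] ℝ) I U) (c : ℝ)
    (f : C^∞⟮I, M; ℝ⟯) : diffS 𝒜 U (c • f) = c • diffS 𝒜 U f :=
  nondegenerate_ext (pairS_nondegenerate 𝒜 hU) fun r => by
    rw [pairS_smul_left, pairS_diffS, pairS_diffS]
    exact lieD_smul _ _ _

theorem brS_smul_left (hD : IsLADirac 𝒜 D U) (hΔ : IsAdapted Δ D U) (c : ℝ) (s t : secQ 𝒜 U) :
    brS hD hΔ (c • s) t = c • brS hD hΔ s t := by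
  rw [eq_sub_of_add_eq (brS_add_brS hD hΔ _ _), eq_sub_of_add_eq (brS_add_brS hD hΔ s t),
    brS_smul_right, pairS_smul_left, diffS_smul hD.subbundle, smul_sub]

/-- The bracket of sections of `C` as a bilinear map. -/
def brL (hD : IsLADirac 𝒜 D U) (hΔ : IsAdapted Δ D U) :
    secQ 𝒜 U →ₗ[ℝ] secQ 𝒜 U →ₗ[ℝ] secQ 𝒜 U :=
  LinearMap.mk₂ ℝ (brS hD hΔ)
    (bracket_add_left (pairS_nondegenerate 𝒜 hD.subbundle) (actS_pairS hD hΔ) (brS_add_brS hD hΔ)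
      (pairS_diffS 𝒜 U))
    (brS_smul_left hD hΔ)
    (bracket_add_right (pairS_nondegenerate 𝒜 hD.subbundle) (actS_pairS hD hΔ))
    (brS_smul_right hD hΔ)

end QuotientBracket

section Glueing

variable {E : Type*} [NormedAddCommGroup E] [NormedSpace ℝ E]
  {H : Type*} [TopologicalSpace H] {I : ModelWithCorners ℝ E H}
  {M : Type*} [TopologicalSpace M] [ChartedSpace H M]
  {F : Type*} [NormedAddCommGroup F] [NormedSpace ℝ F]
  {V : M → Type*} [TopologicalSpace (TotalSpace F V)] [∀ x, AddCommGroup (V x)]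
  [∀ x, Module ℝ (V x)] [∀ x, TopologicalSpace (V x)] [FiberBundle F V] [VectorBundle ℝ F V]

theorem exists_section_eq_sum {ι : Type*} {z : Set M} (ρ : SmoothPartitionOfUnity ι I M z)
    (s : ι → Cₛ^∞⟮I; F, V⟯) :
    ∃ t : Cₛ^∞⟮I; F, V⟯, ∀ x, t x = ∑ i ∈ ρ.finsupport x, ρ i x • s i x := by
  refine ⟨⟨fun x => ∑ᶠ i, ρ i x • s i x, ContMDiff.finsum_section_of_locallyFinite
    (ρ.locallyFinite.subset fun i x hx => left_ne_zero_of_smul hx)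
    fun i => (ρ i).contMDiff.smul_section (s i).contMDiff⟩, fun x => ?_⟩
  exact (ρ.sum_finsupport_smul_eq_finsum x fun i _ => s i x).symm

end Glueing

section QuotientVectorBundle

variable {E : Type*} [NormedAddCommGroup E] [NormedSpace ℝ E] [FiniteDimensional ℝ E]
  {H : Type*} [TopologicalSpace H] {I : ModelWithCorners ℝ E H}
  {M : Type*} [TopologicalSpace M] [ChartedSpace H M] [IsManifold I ∞ M] [T2Space M]
  {F : Type*} [NormedAddCommGroup F] [NormedSpace ℝ F] [FiniteDimensional ℝ F]
  {A : M → Type*} [TopologicalSpace (TotalSpace F A)] [∀ x, AddCommGroup (A x)]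
  [∀ x, Module ℝ (A x)] [∀ x, TopologicalSpace (A x)] [FiberBundle F A] [VectorBundle ℝ F A]
  [ContMDiffVectorBundle ∞ F A I]
  {𝒜 : LieAlgebroid I F A} {D : ∀ p : TotalSpace F A, Submodule ℝ (Pont I p)}
  {U : ∀ x : M, Submodule ℝ (FibB I A x)} {Δ : DorfmanConnection I F A}

theorem smul_mem_secQ (f : C^∞⟮I, M; ℝ⟯) {s : ∀ x, QFib 𝒜 U x} (hs : s ∈ secQ 𝒜 U) :
    (fun x => f x • s x) ∈ secQ 𝒜 U := by
  obtain ⟨⟨u, τ⟩, rfl⟩ := hs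
  exact ⟨(⟨f • (u : SecB I F A), smul_mem_secU fun x => Or.inl (u.2 x)⟩, f • τ), rfl⟩

theorem mem_secQ_of_local [SigmaCompactSpace M] [I.Boundaryless] {s : ∀ x, QFib 𝒜 U x}
    (h : ∀ x₀, ∃ t ∈ secQ 𝒜 U, ∀ᶠ x in 𝓝 x₀, s x = t x) : s ∈ secQ 𝒜 U := by
  have h' (x₀) : ∃ w : secU (F := F) U × SecC I F A, ∃ O : Set M, IsOpen O ∧ x₀ ∈ O ∧
      ∀ x ∈ O, s x = clsMap 𝒜 U w x := by
    obtain ⟨_, ⟨w, rfl⟩, hw⟩ := h x₀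
    obtain ⟨O, h1, h2, h3⟩ := eventually_nhds_iff.1 hw
    exact ⟨w, O, h2, h3, h1⟩
  choose w O hO hx hs using h'
  obtain ⟨ρ, hρ⟩ := SmoothPartitionOfUnity.exists_isSubordinate I isClosed_univ O hO
    fun x _ => Set.mem_iUnion.2 ⟨x, hx x⟩
  obtain ⟨X, hX⟩ := exists_section_eq_sum ρ fun i => (w i).1.1.1
  obtain ⟨α, hα⟩ := exists_section_eq_sum ρ fun i => (w i).1.1.2
  obtain ⟨a, ha⟩ := exists_section_eq_sum ρ fun i => (w i).2.1
  obtain ⟨θ, hθ⟩ := exists_section_eq_sum ρ fun i => (w i).2.2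
  have h1 (x) : val ((X, α) : SecB I F A) x
      = ∑ i ∈ ρ.finsupport x, ρ i x • val ((w i).1 : SecB I F A) x := by
    refine Prod.ext ?_ ?_
    · rw [Prod.fst_sum]; exact hX x
    · rw [Prod.snd_sum]; exact hα x
  have h2 (x) : val ((a, θ) : SecC I F A) x = ∑ i ∈ ρ.finsupport x, ρ i x • val (w i).2 x := by
    refine Prod.ext ?_ ?_
    · rw [Prod.fst_sum]; exact ha x
    · rw [Prod.snd_sum]; exact hθ x
  have hu : ((X, α) : SecB I F A) ∈ secU (F := F) U := fun x => by
    rw [h1]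
    exact Submodule.sum_mem _ fun i _ => (U x).smul_mem _ ((w i).1.2 x)
  refine ⟨(⟨_, hu⟩, (a, θ)), funext fun x => ?_⟩
  have h3 : ((⟨val ((X, α) : SecB I F A) x, hu x⟩, val ((a, θ) : SecC I F A) x) : U x × FibC I A x)
      = ∑ i ∈ ρ.finsupport x, ρ i x • (⟨val ((w i).1 : SecB I F A) x, (w i).1.2 x⟩, val (w i).2 x) := by
    refine Prod.ext (Subtype.ext ?_) ?_
    · rw [Prod.fst_sum, Submodule.coe_sum]; exact h1 x
    · rw [Prod.snd_sum]; exact h2 x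
  refine (congrArg (graphSub 𝒜 U x).mkQ h3).trans ?_
  rw [map_sum]
  have h4 : ∀ i ∈ ρ.finsupport x, (graphSub 𝒜 U x).mkQ
      (ρ i x • (⟨val ((w i).1 : SecB I F A) x, (w i).1.2 x⟩, val (w i).2 x)) = ρ i x • s x := by
    intro i hi
    rw [map_smul]
    rw [hs i x (hρ i (subset_closure ((ρ.mem_finsupport x).1 hi)))]
    rfl
  rw [Finset.sum_congr rfl h4, ← Finset.sum_smul, ρ.sum_finsupport x (Set.mem_univ x), one_smul]

theorem eq_sum_of_mem_span {r : ℕ} {x : M} {e : Fin r → FibB I A x} {t : Fin r → FibC I A x}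
    (h : ∀ i j, pairFib x (e i) (t j) = if i = j then 1 else 0) {q : FibB I A x}
    (hq : q ∈ Submodule.span ℝ (Set.range e)) : q = ∑ i, pairFib x q (t i) • e i := by
  obtain ⟨c, rfl⟩ := (Submodule.mem_span_range_iff_exists_fun ℝ).1 hq
  refine Finset.sum_congr rfl fun i _ => congrArg (· • e i) ?_
  refine Eq.symm (Eq.trans (b := (pairL I A x).flip (t i) (∑ j, c j • e j)) rfl ?_)
  rw [map_sum, Finset.sum_eq_single i]
  · rw [map_smul]
    exact (congrArg (c i * ·) ((h i i).trans (if_pos rfl))).trans (mul_one _)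
  · intro j _ hj
    rw [map_smul]
    exact (congrArg (c j * ·) ((h j i).trans (if_neg hj))).trans (mul_zero _)
  · exact fun h => (h (Finset.mem_univ i)).elim

theorem sub_sum_mem_ann {r : ℕ} {x : M} {e : Fin r → FibB I A x} {t : Fin r → FibC I A x}
    (h : ∀ i j, pairFib x (e i) (t j) = if i = j then 1 else 0)
    (hU : Submodule.span ℝ (Set.range e) = U x) (τ : FibC I A x) :
    τ - ∑ i, pairFib x (e i) τ • t i ∈ ann U x := by
  intro u hu
  rw [← hU] at hu
  rw [eq_sum_of_mem_span h hu]
  have key (j) : pairL I A x (e j) (τ - ∑ i, pairFib x (e i) τ • t i) = 0 := by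
    rw [map_sub, map_sum, Finset.sum_eq_single j]
    · rw [map_smul]
      refine sub_eq_zero.2 (Eq.symm ?_)
      exact (congrArg (pairFib x (e j) τ * ·) ((h j j).trans (if_pos rfl))).trans (mul_one _)
    · intro i _ hi
      rw [map_smul]
      exact (congrArg (_ * ·) ((h j i).trans (if_neg hi.symm))).trans (mul_zero _)
    · exact fun h => (h (Finset.mem_univ j)).elim
  refine Eq.trans (b := pairL I A x (∑ i, pairFib x u (t i) • e i) _) rfl ?_
  rw [map_sum, LinearMap.sum_apply]
  refine Finset.sum_eq_zero fun j _ => ?_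
  rw [map_smul, LinearMap.smul_apply, key, smul_zero]

/-- The coefficients in the frame of `C` given by a frame of `U` and dual elements. -/
theorem mk_eq_sum (hD : IsLADirac 𝒜 D U) (hΔ : IsAdapted Δ D U) {r : ℕ} {x : M}
    {e : Fin r → FibB I A x} {t : Fin r → FibC I A x}
    (h : ∀ i j, pairFib x (e i) (t j) = if i = j then 1 else 0)
    (hU : Submodule.span ℝ (Set.range e) = U x) (he : ∀ i, e i ∈ U x) (u : U x) (τ : FibC I A x) :
    (Submodule.Quotient.mk (u, τ) : QFib 𝒜 U x) =
      ∑ i, pairFib x ((u : FibB I A x) + 𝒜.parFib x (τ - ∑ j, pairFib x (e j) τ • t j)) (t i) •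
          (Submodule.Quotient.mk (⟨e i, he i⟩, 0) : QFib 𝒜 U x)
        + ∑ i, pairFib x (e i) τ • (Submodule.Quotient.mk (0, t i) : QFib 𝒜 U x) := by
  have hk := sub_sum_mem_ann h hU τ
  set k := τ - ∑ j, pairFib x (e j) τ • t j with hkdef
  have hq : (u : FibB I A x) + 𝒜.parFib x k ∈ U x := (U x).add_mem u.2 (parFib_mem hD hΔ hk)
  have h1 := eq_sum_of_mem_span h (by rw [hU]; exact hq)
  have h2 : ∑ i, pairFib x ((u : FibB I A x) + 𝒜.parFib x k) (t i) •
          (Submodule.Quotient.mk (⟨e i, he i⟩, 0) : QFib 𝒜 U x)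
        + ∑ i, pairFib x (e i) τ • (Submodule.Quotient.mk (0, t i) : QFib 𝒜 U x)
      = (graphSub 𝒜 U x).mkQ (⟨_, hq⟩, τ - k) := by
    have h3 : ((⟨_, hq⟩, τ - k) : U x × FibC I A x)
        = ∑ i, pairFib x ((u : FibB I A x) + 𝒜.parFib x k) (t i) •
            ((⟨e i, he i⟩, 0) : U x × FibC I A x)
          + ∑ i, pairFib x (e i) τ • ((0, t i) : U x × FibC I A x) := by
      refine Prod.ext (Subtype.ext ?_) ?_
      · rw [Prod.fst_add, Prod.fst_sum, Prod.fst_sum, Submodule.coe_add, Submodule.coe_sum,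
          Submodule.coe_sum]
        refine h1.trans (Eq.symm ((congrArg (_ + ·) ?_).trans (add_zero _)))
        exact Finset.sum_eq_zero fun i _ => smul_zero (pairFib x (e i) τ)
      · rw [Prod.snd_add, Prod.snd_sum, Prod.snd_sum]
        refine (show τ - k = _ by rw [hkdef, sub_sub_cancel]).trans ?_
        refine Eq.symm ((congrArg (· + _) ?_).trans (zero_add _))
        exact Finset.sum_eq_zero fun i _ => smul_zero _
    rw [h3, map_add, map_sum, map_sum]
    simp only [map_smul]
    rfl
  rw [h2]
  refine (Submodule.Quotient.eq _).2 ⟨?_, ?_⟩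
  · change τ - (τ - k) ∈ _
    rwa [sub_sub_cancel]
  · change (u : FibB I A x) - (u + 𝒜.parFib x k) = -𝒜.parFib x (τ - (τ - k))
    rw [sub_sub_cancel]; abel

theorem linearIndependent_mk {r : ℕ} {x : M} {e : Fin r → FibB I A x} {t : Fin r → FibC I A x}
    (h : ∀ i j, pairFib x (e i) (t j) = if i = j then 1 else 0) (he : ∀ i, e i ∈ U x) :
    LinearIndependent ℝ (Fin.append
      (fun i => (Submodule.Quotient.mk (⟨e i, he i⟩, 0) : QFib 𝒜 U x))
      fun i => (Submodule.Quotient.mk (0, t i) : QFib 𝒜 U x)) := by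
  have z1 (τ : FibC I A x) : pairFib x 0 τ = 0 := LinearMap.congr_fun (pairL I A x).map_zero τ
  have z2 (q : FibB I A x) : pairFib x q 0 = 0 := (pairL I A x q).map_zero
  have p1 (i j) : pairQ 𝒜 U x (Submodule.Quotient.mk (⟨e j, he j⟩, 0))
      (Submodule.Quotient.mk (⟨e i, he i⟩, 0)) = 0 := by
    rw [pairQ_mk, prePair_apply, z2, z2, z2, add_zero, add_zero]
  have p2 (i j) : pairQ 𝒜 U x (Submodule.Quotient.mk (⟨e j, he j⟩, 0))
      (Submodule.Quotient.mk (0, t i)) = if j = i then 1 else 0 := by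
    rw [pairQ_mk, prePair_apply, z2, z2, add_zero, add_zero, h]
  have p3 (i j) : pairQ 𝒜 U x (Submodule.Quotient.mk (0, t j))
      (Submodule.Quotient.mk (⟨e i, he i⟩, 0)) = if i = j then 1 else 0 := by
    rw [pairQ_symm, p2]
  rw [Fintype.linearIndependent_iff]
  intro g hg
  rw [Fin.sum_univ_add] at hg
  simp only [Fin.append_left, Fin.append_right] at hg
  have h1 (j : Fin r) : g (Fin.natAdd r j) = 0 := by
    have := congrArg (pairQ 𝒜 U x (Submodule.Quotient.mk (⟨e j, he j⟩, 0))) hg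
    simpa only [map_add, map_sum, map_smul, p1, p2, smul_zero, Finset.sum_const_zero, zero_add,
      smul_eq_mul, mul_ite, mul_one, mul_zero, Finset.sum_ite_eq, Finset.mem_univ, if_true,
      map_zero] using this
  have h2 (j : Fin r) : g (Fin.castAdd r j) = 0 := by
    simp only [h1, zero_smul, Finset.sum_const_zero, add_zero] at hg
    have := congrArg (pairQ 𝒜 U x (Submodule.Quotient.mk (0, t j))) hg
    simpa only [map_sum, map_smul, p3,
      smul_eq_mul, mul_ite, mul_one, mul_zero, Finset.sum_ite_eq', Finset.mem_univ, if_true,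
      map_zero] using this
  exact fun i => Fin.addCases h2 h1 i

theorem exists_frame_secQ (hD : IsLADirac 𝒜 D U) (hΔ : IsAdapted Δ D U) (x₀ : M) :
    ∃ (r : ℕ) (e : Fin r → ∀ x, QFib 𝒜 U x), (∀ i, e i ∈ secQ 𝒜 U) ∧
      (∀ᶠ x in 𝓝 x₀, LinearIndependent ℝ (fun i => e i x) ∧
        Submodule.span ℝ (Set.range fun i => e i x) = ⊤) ∧
      ∀ s ∈ secQ 𝒜 U, ∃ f : Fin r → C^∞⟮I, M; ℝ⟯, ∀ᶠ x in 𝓝 x₀, s x = ∑ i, f i x • e i x := by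
  obtain ⟨r, e, t, he, h⟩ := exists_frame_secU hD.subbundle x₀
  have happ (x) (i) : Fin.append (fun i => (clsW 𝒜 U (⟨e i, he i⟩, 0)).1)
        (fun i => (clsW 𝒜 U (0, t i)).1) i x
      = Fin.append (fun i => (Submodule.Quotient.mk (⟨val (e i) x, he i x⟩, 0) : QFib 𝒜 U x))
          (fun i => (Submodule.Quotient.mk (0, val (t i) x) : QFib 𝒜 U x)) i := by
    refine Fin.addCases (fun i => ?_) (fun i => ?_) i
    · rw [Fin.append_left, Fin.append_left]; rfl
    · rw [Fin.append_right, Fin.append_right]; rfl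
  refine ⟨r + r, Fin.append (fun i => (clsW 𝒜 U (⟨e i, he i⟩, 0)).1)
    (fun i => (clsW 𝒜 U (0, t i)).1), fun i => ?_, ?_, ?_⟩
  · refine Fin.addCases (fun i => ?_) (fun i => ?_) i
    · rw [Fin.append_left]; exact Subtype.property _
    · rw [Fin.append_right]; exact Subtype.property _
  · filter_upwards [h] with x hx
    simp only [happ]
    refine ⟨linearIndependent_mk hx.1 fun i => he i x, Submodule.eq_top_iff'.2 fun v => ?_⟩
    obtain ⟨⟨u, τ⟩, rfl⟩ := Submodule.Quotient.mk_surjective _ v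
    rw [mk_eq_sum hD hΔ hx.1 hx.2 (fun i => he i x)]
    refine Submodule.add_mem _ (Submodule.sum_mem _ fun i _ => Submodule.smul_mem _ _ ?_)
      (Submodule.sum_mem _ fun i _ => Submodule.smul_mem _ _ ?_)
    · exact Submodule.subset_span ⟨Fin.castAdd r i, Fin.append_left _ _ i⟩
    · exact Submodule.subset_span ⟨Fin.natAdd r i, Fin.append_right _ _ i⟩
  · rintro _ ⟨⟨u, τ⟩, rfl⟩
    refine ⟨Fin.append
      (fun i => pairBC ((u : SecB I F A) + 𝒜.par (τ - ∑ j, pairBC (e j) τ • t j)) (t i))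
      fun i => pairBC (e i) τ, ?_⟩
    filter_upwards [h] with x hx
    simp only [happ]
    rw [Fin.sum_univ_add]
    simp only [Fin.append_left, Fin.append_right]
    refine (mk_eq_sum hD hΔ hx.1 hx.2 (fun i => he i x) ⟨val (u : SecB I F A) x, u.2 x⟩
      (val τ x)).trans ?_
    have hv : val (τ - ∑ j, pairBC (e j) τ • t j) x
        = val τ x - ∑ j, pairFib x (val (e j) x) (val τ x) • val (t j) x := by
      refine Prod.ext ?_ ?_
      · change (τ.1 - (∑ j, pairBC (e j) τ • t j).1) x = _
        rw [Prod.fst_sum, Prod.fst_sub, Prod.fst_sum]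
        exact congrArg (fun b => τ.1 x - b) (sum_sec_apply _ _ x)
      · change (τ.2 - (∑ j, pairBC (e j) τ • t j).2) x = _
        rw [Prod.snd_sum, Prod.snd_sub, Prod.snd_sum]
        exact congrArg (fun b => τ.2 x - b) (sum_sec_apply _ _ x)
    have hv' : val ((u : SecB I F A) + 𝒜.par (τ - ∑ j, pairBC (e j) τ • t j)) x
        = val (u : SecB I F A) x + 𝒜.parFib x
          (val τ x - ∑ j, pairFib x (val (e j) x) (val τ x) • val (t j) x) := by
      rw [← hv, ← val_par]; rfl
    simp only [pairBC_apply, hv']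

theorem isVectorBundle_secQ [SigmaCompactSpace M] [I.Boundaryless] (hD : IsLADirac 𝒜 D U)
    (hΔ : IsAdapted Δ D U) : IsVectorBundle I (secQ 𝒜 U) where
  smul_mem f _ hs := smul_mem_secQ f hs
  of_local _ h := mem_secQ_of_local h
  exists_frame := exists_frame_secQ hD hΔ

end QuotientVectorBundle

section Independence

variable {E : Type*} [NormedAddCommGroup E] [NormedSpace ℝ E] [FiniteDimensional ℝ E]
  {H : Type*} [TopologicalSpace H] {I : ModelWithCorners ℝ E H}
  {M : Type*} [TopologicalSpace M] [ChartedSpace H M] [IsManifold I ∞ M] [T2Space M]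
  {F : Type*} [NormedAddCommGroup F] [NormedSpace ℝ F] [FiniteDimensional ℝ F]
  {A : M → Type*} [TopologicalSpace (TotalSpace F A)] [∀ x, AddCommGroup (A x)]
  [∀ x, Module ℝ (A x)] [∀ x, TopologicalSpace (A x)] [FiberBundle F A] [VectorBundle ℝ F A]
  [ContMDiffVectorBundle ∞ F A I]
  {𝒜 : LieAlgebroid I F A} {D : ∀ p : TotalSpace F A, Submodule ℝ (Pont I p)}
  {U : ∀ x : M, Submodule ℝ (FibB I A x)} {Δ Δ' : DorfmanConnection I F A}

theorem toFun_sub_mem_ann (hD : IsLADirac 𝒜 D U) (hΔ : IsAdapted Δ D U) (hΔ' : IsAdapted Δ' D U)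
    {u : SecB I F A} (hu : u ∈ secU (F := F) U) (a : Cₛ^∞⟮I; F, A⟯) (x : M) :
    val (Δ'.toFun u (a, 0) - Δ.toFun u (a, 0)) x ∈ ann U x := by
  refine (hD.core_mem_iff ⟨x, a x⟩ _).1 ?_
  have h := (D ⟨x, a x⟩).sub_mem (hΔ.sigma_mem hu a x) (hΔ'.sigma_mem hu a x)
  rw [sigma, sigma, sub_sub_sub_cancel_left, ← core_sub] at h
  exact h

theorem toFun_sub_toFun (q : SecB I F A) (τ : SecC I F A) :
    Δ'.toFun q τ - Δ.toFun q τ = Δ'.toFun q (τ.1, 0) - Δ.toFun q (τ.1, 0) := by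
  have h : τ = (τ.1, 0) + (0, τ.2) := by simp
  conv_lhs => rw [h, map_add, map_add, Δ.toFun_form, Δ'.toFun_form]
  abel

theorem pairBC_sub (q : SecB I F A) (τ σ : SecC I F A) :
    pairBC q (τ - σ) = pairBC q τ - pairBC q σ := by
  rw [eq_sub_iff_add_eq, ← pairBC_add, sub_add_cancel]

theorem dull_eq_dull (hD : IsLADirac 𝒜 D U) (hΔ : IsAdapted Δ D U) (hΔ' : IsAdapted Δ' D U)
    {u v : SecB I F A} (hu : u ∈ secU (F := F) U) (hv : v ∈ secU (F := F) U) :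
    Δ'.dull u v = Δ.dull u v := by
  refine secB_ext rfl fun b => ?_
  have h := Δ'.dull_dual u v (b, 0)
  have h' := Δ.dull_dual u v (b, 0)
  have h0 : pairBC v (Δ'.toFun u (b, 0)) = pairBC v (Δ.toFun u (b, 0)) := by
    rw [← sub_eq_zero, ← pairBC_sub]
    ext x
    exact toFun_sub_mem_ann hD hΔ hΔ' hu b x _ (hv x)
  rw [h0, ← h'] at h
  have hp (q : SecB I F A) : pairBC q (b, 0) = ev q.2 b := add_eq_left.2 rfl
  rwa [hp, hp] at h

theorem nablaBas_sub_nablaBas (a : Cₛ^∞⟮I; F, A⟯) (q : SecB I F A) (x : M) :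
    val (Δ'.nablaBas 𝒜 a q) x - val (Δ.nablaBas 𝒜 a q) x
      = 𝒜.parFib x (val (Δ'.toFun q (a, 0) - Δ.toFun q (a, 0)) x) := by
  have h (Δ : DorfmanConnection I F A) : val (Δ.nablaBas 𝒜 a q) x
      = 𝒜.parFib x (val (Δ.toFun q (a, 0)) x - val ((0, dOne (ev q.2 a)) : SecC I F A) x)
        + val (𝒜.lieB a q) x :=
    congrArg (· + val (𝒜.lieB a q) x) (val_par 𝒜 (Δ.Omega q a) x)
  rw [h, h, add_sub_add_right_eq_sub, ← map_sub, sub_sub_sub_cancel_right]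
  rfl

theorem clsW_brR_eq (hD : IsLADirac 𝒜 D U) (hΔ : IsAdapted Δ D U) (hΔ' : IsAdapted Δ' D U)
    (v w : secU (F := F) U × SecC I F A) :
    clsW 𝒜 U (brR hD hΔ' v w) = clsW 𝒜 U (brR hD hΔ v w) := by
  refine Subtype.ext (funext fun x => (Submodule.Quotient.eq _).2 ?_)
  have h1 := toFun_sub_mem_ann hD hΔ hΔ' v.1.2 w.2.1 x
  have h2 := toFun_sub_mem_ann hD hΔ hΔ' w.1.2 v.2.1 x
  set k := val (Δ'.toFun v.1 (w.2.1, 0) - Δ.toFun v.1 (w.2.1, 0)) x with hk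
  set l := val (Δ'.toFun w.1 (v.2.1, 0) - Δ.toFun w.1 (v.2.1, 0)) x with hl
  have e1 : val (brW 𝒜 Δ' (inc v) (inc w)).1 x - val (brW 𝒜 Δ (inc v) (inc w)).1 x
      = -𝒜.parFib x (k - l) := by
    have hs (Δ : DorfmanConnection I F A) : val (brW 𝒜 Δ (inc v) (inc w)).1 x
        = val (Δ.dull v.1 w.1) x + val (Δ.nablaBas 𝒜 v.2.1 w.1) x
          - val (Δ.nablaBas 𝒜 w.2.1 v.1) x := rfl
    rw [hs, hs, dull_eq_dull hD hΔ hΔ' v.1.2 w.1.2, map_sub, hk, hl, ← nablaBas_sub_nablaBas,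
      ← nablaBas_sub_nablaBas]
    abel
  have e2 : val (brW 𝒜 Δ' (inc v) (inc w)).2 x - val (brW 𝒜 Δ (inc v) (inc w)).2 x = k - l := by
    rw [hk, hl, ← toFun_sub_toFun, ← toFun_sub_toFun]
    have hs (Δ : DorfmanConnection I F A) : val (brW 𝒜 Δ (inc v) (inc w)).2 x
        = val (𝒜.brD v.2 w.2) x + val (Δ.toFun v.1 w.2) x - val (Δ.toFun w.1 v.2) x
          + val ((0, dOne (pairBC (w.1 : SecB I F A) v.2)) : SecC I F A) x := rfl
    have hd (τ σ : SecC I F A) : val (τ - σ) x = val τ x - val σ x := rfl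
    rw [hs, hs, hd, hd]
    abel
  refine ⟨?_, ?_⟩
  · change val (brW 𝒜 Δ' (inc v) (inc w)).2 x - val (brW 𝒜 Δ (inc v) (inc w)).2 x ∈ _
    rw [e2]
    exact Submodule.sub_mem _ h1 h2
  · change val (brW 𝒜 Δ' (inc v) (inc w)).1 x - val (brW 𝒜 Δ (inc v) (inc w)).1 x
      = -𝒜.parFib x (val (brW 𝒜 Δ' (inc v) (inc w)).2 x - val (brW 𝒜 Δ (inc v) (inc w)).2 x)
    rw [e1, e2]

/-- The Courant algebroid `C` defined by an LA-Dirac structure. -/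
def courantAlgebroid [SigmaCompactSpace M] [I.Boundaryless] (hD : IsLADirac 𝒜 D U)
    (hΔ : IsAdapted Δ D U) : CourantAlgebroid I (secQ 𝒜 U) where
  isVectorBundle := isVectorBundle_secQ hD hΔ
  pairing := pairQ 𝒜 U
  pairing_smooth s hs t ht := (pairS 𝒜 U ⟨s, hs⟩ ⟨t, ht⟩).contMDiff
  pairing_symm := pairQ_symm 𝒜 U
  pairing_nondegenerate := pairQ_nondegenerate 𝒜 U
  anchor := anchorQ 𝒜 U
  anchor_smooth s hs := (anchorS 𝒜 U ⟨s, hs⟩).contMDiff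
  bracket := brL hD hΔ
  diff := diffS 𝒜 U
  diff_spec := pairQ_diffS 𝒜 U
  jacobi a b c := by
    have h := jacobiator_brS_eq_zero hD hΔ a b c
    rw [jacobiator, sub_sub, sub_eq_zero] at h
    exact h
  invariance a b c x := congrArg (fun g => g x) (actS_pairS hD hΔ a b c)
  symmetric_part := brS_add_brS hD hΔ

theorem hasBracket_courantAlgebroid [SigmaCompactSpace M] [I.Boundaryless] (hD : IsLADirac 𝒜 D U)
    (hΔ : IsAdapted Δ D U) (hΔ' : IsAdapted Δ' D U) :
    HasBracket 𝒜 (courantAlgebroid hD hΔ) Δ' := fun u₁ u₂ τ₁ τ₂ =>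
  ⟨brW_fst_mem hD hΔ' (u₁, τ₁) (u₂, τ₂), (brS_clsW hD hΔ (u₁, τ₁) (u₂, τ₂)).trans
    (clsW_brR_eq hD hΔ hΔ' (u₁, τ₁) (u₂, τ₂)).symm⟩

end Independence

end LADirac

end

theorem mainTheorem3
    {E : Type*} [NormedAddCommGroup E] [NormedSpace ℝ E] [FiniteDimensional ℝ E]
    {H : Type*} [TopologicalSpace H] {I : ModelWithCorners ℝ E H} [I.Boundaryless]
    {M : Type*} [TopologicalSpace M] [ChartedSpace H M] [IsManifold I ∞ M]
    [T2Space M] [SigmaCompactSpace M]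
    {F : Type*} [NormedAddCommGroup F] [NormedSpace ℝ F] [FiniteDimensional ℝ F]
    {A : M → Type*} [TopologicalSpace (TotalSpace F A)] [∀ x, AddCommGroup (A x)]
    [∀ x, Module ℝ (A x)] [∀ x, TopologicalSpace (A x)] [FiberBundle F A] [VectorBundle ℝ F A]
    [ContMDiffVectorBundle ∞ F A I]
    (𝒜 : LADirac.LieAlgebroid I F A)
    (D : ∀ p : TotalSpace F A, Submodule ℝ (LADirac.Pont I p))
    (U : ∀ x : M, Submodule ℝ (LADirac.FibB I A x))
    (hD : LADirac.IsLADirac 𝒜 D U)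
    (Δ : LADirac.DorfmanConnection I F A) (hΔ : LADirac.IsAdapted Δ D U) :
    ∃ 𝒞 : LADirac.CourantAlgebroid I (LADirac.secQ 𝒜 U),
      (∀ (x : M) (u : U x) (τ : LADirac.FibC I A x),
        𝒞.anchor x (Submodule.Quotient.mk (u, τ)) = (u : LADirac.FibB I A x).1 + 𝒜.anchor x τ.1) ∧
      (∀ (x : M) (u₁ u₂ : U x) (τ₁ τ₂ : LADirac.FibC I A x),
        𝒞.pairing x (Submodule.Quotient.mk (u₁, τ₁)) (Submodule.Quotient.mk (u₂, τ₂)) =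
          LADirac.pairFib x u₁ τ₂ + LADirac.pairFib x u₂ τ₁ +
            LADirac.pairFib x (𝒜.parFib x τ₂) τ₁) ∧
      LADirac.HasBracket 𝒜 𝒞 Δ ∧
      (∀ f : C^∞⟮I, M; ℝ⟯, 𝒞.diff f = LADirac.cls 𝒜 U 0 (0, LADirac.dOne f)) ∧
      (∀ Δ' : LADirac.DorfmanConnection I F A, LADirac.IsAdapted Δ' D U →
        LADirac.HasBracket 𝒜 𝒞 Δ') :=
  ⟨LADirac.courantAlgebroid hD hΔ, fun _ _ _ => rfl, fun _ _ _ _ _ => rfl,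
    LADirac.hasBracket_courantAlgebroid hD hΔ hΔ, fun _ => rfl,
    fun _ hΔ' => LADirac.hasBracket_courantAlgebroid hD hΔ hΔ'⟩
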